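/- Notation. For a finite set $K$, $\Delta(K)$ is the set of probability vectors on $K$. A stochastic game with incomplete information on both sides is a tuple $\Gamma=(K,L,\Omega,I,J,\rho,g)$ of finite sets $K,L$ (types), $\Omega$ (states), $I,J$ (actions), a transition $\rho:\Omega\times I\times J\to\Delta(\Omega)$ and a payoff $g:K\times L\times\Omega\times I\times J\to\mathbb R$. A state $\omega$ is absorbing if $\rho(\omega|\omega,i,j)=1$ for all $(i,j)$ and, for all $(k,\ell)$, $g(k,\ell,\omega,i,j)$ does not depend on $(i,j)$; $\Gamma$ is absorbing if exactly one state is non-absorbing. Assumption 1: there are $i^*\in I$, $j^*\in J$ and absorbing states $\omega^1,\omega^2$ with $g(\cdot,\cdot,\omega^1,\cdot,\cdot)=-\|g\|_\infty$, $g(\cdot,\cdot,\omega^2,\cdot,\cdot)=\|g\|_\infty$ and, for every non-absorbing $\omega$: $\rho(\omega,i^*,j)=\delta_{\omega^1}$ for $j\ne j^*$, $\rho(\omega,i,j^*)=\delta_{\omega^2}$ for $i\neq i^*$, and $\rho(\omega,i^*,j^*)=\frac12\delta_{\omega^1}+\frac12\delta_{\omega^2}$. Belief game. Let $X=\Delta(I)^K$,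 $Y=\Delta(J)^L$. For $p\in\Delta(K)$, $x\in X$ put $\bar x^p(i)=\sum_k p(k)x(i|k)$, and let $p^x(\cdot|i)$ be the posterior $p^x(k|i)=p(k)x(i|k)/\bar x^p(i)$ if $\bar x^p(i)\ne0$, and $p^x(\cdot|i)=p$ otherwise; similarly $\bar y^q(j)$, $q^y(\cdot|j)$ for $q\in\Delta(L)$, $y\in Y$. $\Gamma^e$ is the zero-sum stochastic game with state space $\Delta(K)\times\Delta(L)\times\Omega$, action sets $X$ and $Y$, stage payoff $g^e(p,q,\omega,x,y)=\sum_{k,\ell,i,j}p(k)q(\ell)x(i|k)y(j|\ell)g(k,\ell,\omega,i,j)$ and transition law $\sum_{i,j,\omega'}\rho(\omega'|\omega,i,j)\,\bar x^p(i)\,\bar y^q(j)\,\delta_{(p^x(\cdot|i),\,q^y(\cdot|j),\,\omega')}$. Triangulations. A triangulation of $\Delta(K)$, identified with its vertex set $P$, is a finite collection of simplices with union $\Delta(K)$, any two of which are disjoint or meet in a common face. For $p\in\Delta(K)$ the splitting $S[\cdot|p]$ is the probability on $P$ given by the barycentric coordinates of $p$ in a simplex of the triangulation that contains $p$. The stepsize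 $s$ is the maximal Euclidean distance between two vertices of a common simplex. For $\alpha,C>0$ it is an $(\alpha,C)$-triangulation if $s<\alpha$ and $1-S[p'|p]\le\frac{C}{s}\|p'-p\|_2$ for all $p\in\Delta(K)$ and $p'\in P$ with $S[p'|p]>0$ (if $|K|=1$, the left-hand side is $0$ and this second condition is void). An $(\alpha,C)$-triangulation of $\Delta(K)\times\Delta(L)$ is a pair $(P,Q)$ of $(\alpha,C)$-triangulations of $\Delta(K)$ and $\Delta(L)$. Triangulated game. Given $(P,Q)$, $\Gamma^f$ is the zero-sum stochastic game with state space $P\times Q\times\Omega$, action sets $X,Y$, payoff the restriction of $g^e$, and transition $$\rho^f(p',q',\omega'|p,q,\omega,x,y)=\sum_{i,j}\rho(\omega'|\omega,i,j)\,\bar x^p(i)\,\bar y^q(j)\,S[p'|p^x(\cdot|i)]\,S[q'|q^y(\cdot|j)].$$ In $\Gamma^e$ and $\Gamma^f$ past states and actions (elements of $X$ and $Y$) are observed, players use measurable behavior strategies, and the $\lambda$-discounted payoff is $\mathbb E\big(\sum_{m\ge1}\lambda(1-\lambda)^{m-1}g^e_m\big)$, where $g^e_m$ is the stage-$m$ payoff.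 The value from a given initial state is the common value of $\sup_\sigma\inf_\tau$ and $\inf_\tau\sup_\sigma$ of this payoff, and is denoted $v^e_\lambda$, respectively $v^f_\lambda$. Proposition. Let $\Gamma$ be an absorbing game with incomplete information on both sides that satisfies Assumption 1. For every $\varepsilon>0$ and $C>0$ there is $\alpha>0$ such that for every $(\alpha,C)$-triangulation $(P,Q)$ of $\Delta(K)\times\Delta(L)$, every $(p,q,\omega)\in P\times Q\times\Omega$ and every $\lambda\in(0,1]$, the values $v^e_\lambda(p,q,\omega)$ and $v^f_\lambda(p,q,\omega)$ exist and $$\left|v^e_\lambda(p,q,\omega)-v^f_\lambda(p,q,\omega)\right|\le\varepsilon .$$ -/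

import Mathlib

open MeasureTheory ProbabilityTheory
open scoped ENNReal

noncomputable section

/-! ## Discounted stochastic games with general state and action spaces -/

/-- A two-player zero-sum stochastic game with perfectly observed states and actions: state space
`S`, action sets `A` (Player 1) and `B` (Player 2), a transition probability and a payoff. -/
structure StochasticGame (S A B : Type*) [MeasurableSpace S] [MeasurableSpace A]
    [MeasurableSpace B] where
  transition : Kernel (S × A × B) S
  isMarkov : IsMarkovKernel transition
  payoff : S → A → B → ℝ

attribute [instance] StochasticGame.isMarkov

/-- A behavior strategy of a player with action set `D`: for every `n`, given the past states and
actions `(s₁, a₁, b₁), …, (sₙ, aₙ, bₙ)` and the current state `sₙ₊₁`, a probability measure on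
`D` depending measurably on them. -/
structure BehaviorStrategy (S A B D : Type*) [MeasurableSpace S] [MeasurableSpace A]
    [MeasurableSpace B] [MeasurableSpace D] where
  act : (n : ℕ) → Kernel ((Fin n → S × A × B) × S) D
  isMarkov : ∀ n, IsMarkovKernel (act n)

attribute [instance] BehaviorStrategy.isMarkov

namespace StochasticGame

variable {S A B : Type*} [MeasurableSpace S] [MeasurableSpace A] [MeasurableSpace B]

/-- Law of `(s, a, b)` at the stage following `n` completed stages, given the completed stages and
the current state `s`: the two actions are drawn independently. -/
def stageKernel (σ : BehaviorStrategy S A B A) (τ : BehaviorStrategy S A B B) (n : ℕ) :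
    Kernel ((Fin n → S × A × B) × S) (S × A × B) :=
  Kernel.deterministic Prod.snd measurable_snd ×ₖ (σ.act n ×ₖ τ.act n)

instance (σ : BehaviorStrategy S A B A) (τ : BehaviorStrategy S A B B) (n : ℕ) :
    IsMarkovKernel (stageKernel σ τ n) := by
  unfold stageKernel; infer_instance

/-- The history, with stages numbered `0, …, n`, as a tuple indexed by `Fin (n + 1)`. -/
def pastOfIic (n : ℕ) (h : Finset.Iic n → S × A × B) : Fin (n + 1) → S × A × B :=
  fun i => h ⟨i, Finset.mem_Iic.2 (Nat.lt_succ_iff.1 i.2)⟩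

lemma measurable_pastOfIic (n : ℕ) : Measurable (pastOfIic (S := S) (A := A) (B := B) n) :=
  measurable_pi_lambda _ fun _ => measurable_pi_apply _

/-- The last stage `(s, a, b)` of a history. -/
def lastOfIic (n : ℕ) (h : Finset.Iic n → S × A × B) : S × A × B :=
  h ⟨n, Finset.mem_Iic.2 le_rfl⟩

lemma measurable_lastOfIic (n : ℕ) : Measurable (lastOfIic (S := S) (A := A) (B := B) n) :=
  measurable_pi_apply _

/-- Law of the next stage given the history: the new state is drawn from the transition
probability, then both players choose their actions. -/
def stepKernel (G : StochasticGame S A B) (σ : BehaviorStrategy S A B A)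
    (τ : BehaviorStrategy S A B B) (n : ℕ) :
    Kernel (Finset.Iic n → S × A × B) (S × A × B) :=
  stageKernel σ τ (n + 1) ∘ₖ
    (Kernel.deterministic (pastOfIic n) (measurable_pastOfIic n) ×ₖ
      G.transition.comap (lastOfIic n) (measurable_lastOfIic n))

instance (G : StochasticGame S A B) (σ : BehaviorStrategy S A B A)
    (τ : BehaviorStrategy S A B B) (n : ℕ) : IsMarkovKernel (G.stepKernel σ τ n) := by
  unfold stepKernel; infer_instance

/-- The probability measure on infinite histories induced by an initial state and a pair of
behavior strategies. -/
def law (G : StochasticGame S A B) (s : S) (σ : BehaviorStrategy S A B A)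
    (τ : BehaviorStrategy S A B B) : Measure (ℕ → S × A × B) :=
  Kernel.trajMeasure (X := fun _ => S × A × B) (stageKernel σ τ 0 (Fin.elim0, s))
    (G.stepKernel σ τ)

/-- The `lam`-discounted payoff `𝔼 (∑ₘ lam (1 - lam) ^ (m - 1) g(sₘ, aₘ, bₘ))`
(stages are numbered from `0` here). -/
def discountedPayoff (G : StochasticGame S A B) (lam : ℝ) (s : S)
    (σ : BehaviorStrategy S A B A) (τ : BehaviorStrategy S A B B) : ℝ :=
  ∫ h, ∑' m : ℕ, lam * (1 - lam) ^ m * G.payoff (h m).1 (h m).2.1 (h m).2.2 ∂(G.law s σ τ)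

/-- `v` is the value of the `lam`-discounted game with initial state `s`: Player 1 can guarantee
`v` and Player 2 can guarantee `v`, up to any positive error; that is,
`v = sup_σ inf_τ γ = inf_τ sup_σ γ`. -/
def IsDiscountedValue (G : StochasticGame S A B) (lam : ℝ) (s : S) (v : ℝ) : Prop :=
  (∀ δ > 0, ∃ σ, ∀ τ, v - δ ≤ G.discountedPayoff lam s σ τ) ∧
  (∀ δ > 0, ∃ τ, ∀ σ, G.discountedPayoff lam s σ τ ≤ v + δ)

end StochasticGame

/-! ## Stochastic games with incomplete information on both sides -/

/-- A stochastic game with incomplete information on both sides: type sets `K`, `L`, state space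
`Ω`, action sets `I`, `J`, transition `ρ` and payoff `g`. -/
structure IncompleteInfoGame (K L Ω I J : Type*) [Fintype Ω] where
  ρ : Ω → I → J → stdSimplex ℝ Ω
  g : K → L → Ω → I → J → ℝ

/-- Mixed actions of a player with type set `K` and action set `I`: `x k i` is the probability
`x(i|k)` of playing `i` given type `k`. -/
abbrev MixedAction (K I : Type*) [Fintype I] : Type _ := K → stdSimplex ℝ I

section Beliefs

variable {K I : Type*} [Fintype K] [Fintype I]

/-- The probability of action `i` under the belief `p` and the mixed action `x`. -/
def actionProb (p : stdSimplex ℝ K) (x : MixedAction K I) (i : I) : ℝ := ∑ k, p k * x k i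

lemma actionProb_nonneg (p : stdSimplex ℝ K) (x : MixedAction K I) (i : I) :
    0 ≤ actionProb p x i :=
  Finset.sum_nonneg fun k _ => mul_nonneg (p.2.1 k) ((x k).2.1 i)

lemma sum_actionProb (p : stdSimplex ℝ K) (x : MixedAction K I) :
    ∑ i, actionProb p x i = 1 := by
  unfold actionProb
  rw [Finset.sum_comm]
  have h : ∀ k, ∑ i, x k i = 1 := fun k => (x k).2.2
  simp_rw [← Finset.mul_sum, h, mul_one]
  exact p.2.2

open Classical in
/-- The posterior belief given that the mixed action `x` was used and action `i` was realized;
it equals the prior `p` when `i` has probability zero. -/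
def posteriorBelief (p : stdSimplex ℝ K) (x : MixedAction K I) (i : I) : stdSimplex ℝ K :=
  if h : actionProb p x i = 0 then p else
    ⟨fun k => x k i * p k / actionProb p x i,
      fun k => div_nonneg (mul_nonneg ((x k).2.1 i) (p.2.1 k)) (actionProb_nonneg p x i), by
        rw [← Finset.sum_div, div_eq_one_iff_eq h]
        exact Finset.sum_congr rfl fun k _ => mul_comm _ _⟩

lemma measurable_simplex_apply {α ι : Type*} [MeasurableSpace α] [Fintype ι]
    {f : α → stdSimplex ℝ ι} (hf : Measurable f) (i : ι) : Measurable fun a => f a i :=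
  (measurable_pi_apply i).comp (measurable_subtype_coe.comp hf)

variable {α : Type*} [MeasurableSpace α]

lemma measurable_actionProb {p : α → stdSimplex ℝ K} {x : α → MixedAction K I}
    (hp : Measurable p) (hx : Measurable x) (i : I) :
    Measurable fun a => actionProb (p a) (x a) i := by
  unfold actionProb
  exact Finset.measurable_sum _ fun k _ => (measurable_simplex_apply hp k).mul
    (measurable_simplex_apply ((measurable_pi_apply k).comp hx) i)

lemma measurable_posteriorBelief {p : α → stdSimplex ℝ K} {x : α → MixedAction K I}
    (hp : Measurable p) (hx : Measurable x) (i : I) :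
    Measurable fun a => posteriorBelief (p a) (x a) i := by
  have hA := measurable_actionProb hp hx i
  refine Measurable.subtype_mk (p := (· ∈ stdSimplex ℝ K))
    (f := fun a => (posteriorBelief (p a) (x a) i : K → ℝ)) ?_
    (h := fun a => (posteriorBelief (p a) (x a) i).2)
  refine measurable_pi_lambda _ fun k => ?_
  have : (fun a => (posteriorBelief (p a) (x a) i : K → ℝ) k) = fun a =>
      if actionProb (p a) (x a) i = 0 then p a k else
        x a k i * p a k / actionProb (p a) (x a) i := by
    funext a
    unfold posteriorBelief
    split_ifs <;> rfl
  rw [this]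
  exact Measurable.ite (hA (measurableSet_singleton 0)) (measurable_simplex_apply hp k)
    (((measurable_simplex_apply ((measurable_pi_apply k).comp hx) i).mul
      (measurable_simplex_apply hp k)).div hA)

/-- The Euclidean distance between two vectors. -/
def euclideanDist (u v : K → ℝ) : ℝ :=
  dist (WithLp.toLp 2 u : EuclideanSpace ℝ K) (WithLp.toLp 2 v)

end Beliefs

/-! ## Triangulations of a simplex of beliefs -/

/-- A triangulation of `Δ(K)`: a finite (geometric) simplicial complex whose underlying space is
the simplex `Δ(K)`. -/
structure Triangulation (K : Type*) [Fintype K] where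
  complex : Geometry.SimplicialComplex ℝ (K → ℝ)
  finite_faces : complex.faces.Finite
  space_eq : complex.space = stdSimplex ℝ K

namespace Triangulation

variable {K : Type*} [Fintype K] (T : Triangulation K)

/-- The set of vertices of the triangulation. -/
abbrev Vertex : Type _ := T.complex.vertices

lemma finite_vertices : T.complex.vertices.Finite := by
  rw [Geometry.SimplicialComplex.vertices_eq]
  exact T.finite_faces.biUnion fun s _ => s.finite_toSet

instance : Finite T.Vertex := T.finite_vertices

instance : Fintype T.Vertex := Fintype.ofFinite _

/-- A vertex of the triangulation, as a belief. -/
def toBelief (v : T.Vertex) : stdSimplex ℝ K :=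
  ⟨v.1, T.space_eq ▸ Geometry.SimplicialComplex.vertices_subset_space v.2⟩

/-- `w` consists of the barycentric coordinates of `p` in some simplex of the triangulation that
contains `p` (and zeros at all other vertices). -/
def IsSplitting (p : K → ℝ) (w : stdSimplex ℝ T.Vertex) : Prop :=
  (∃ s ∈ T.complex.faces, ∀ v : T.Vertex, v.1 ∉ s → w v = 0) ∧ ∑ v, w v • v.1 = p

lemma sum_vertices_eq {M : Type*} [AddCommMonoid M] {s : Finset (K → ℝ)}
    (hs : s ∈ T.complex.faces) (F : (K → ℝ) → M) (hF : ∀ u ∉ s, F u = 0) :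
    ∑ v : T.Vertex, F v.1 = ∑ u ∈ s, F u := by
  classical
  have hsub : ∀ u ∈ s, u ∈ T.complex.vertices := fun u hu => by
    rw [Geometry.SimplicialComplex.vertices_eq]
    exact Set.mem_biUnion hs hu
  symm
  refine Finset.sum_of_injOn (fun u => if h : u ∈ T.complex.vertices then (⟨u, h⟩ : T.Vertex)
    else Classical.choice ?_) ?_ ?_ ?_ ?_
  · obtain ⟨u, hu⟩ := T.complex.nonempty_of_mem_faces hs
    exact ⟨⟨u, hsub u hu⟩⟩
  · intro u hu u' hu' h
    simpa [hsub u hu, hsub u' hu'] using h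
  · intro u _; simp
  · intro v _ hv
    refine hF _ fun hvs => hv ?_
    exact ⟨v.1, hvs, by simp⟩
  · intro u hu
    simp [hsub u hu]

theorem existsUnique_isSplitting (p : stdSimplex ℝ K) :
    ∃! w : stdSimplex ℝ T.Vertex, T.IsSplitting p w := by
  classical
  have hp : (p : K → ℝ) ∈ T.complex.space := by rw [T.space_eq]; exact p.2
  obtain ⟨s, hs, hps⟩ := Geometry.SimplicialComplex.mem_space_iff.1 hp
  obtain ⟨w, hw0, hw1, hwp⟩ := Finset.mem_convexHull'.1 hps
  let F : (K → ℝ) → ℝ := fun u => if u ∈ s then w u else 0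
  have hF : ∀ u ∉ s, F u = 0 := fun u hu => by simp [F, hu]
  have hFs : ∀ u ∈ s, F u = w u := fun u hu => by simp [F, hu]
  refine existsUnique_of_exists_of_unique ⟨⟨fun v => F v.1, ?_, ?_⟩, ⟨s, hs, ?_⟩, ?_⟩ ?_
  · intro v
    by_cases h : v.1 ∈ s
    · simpa [F, h] using hw0 _ h
    · simp [F, h]
  · rw [T.sum_vertices_eq hs F hF, Finset.sum_congr rfl hFs, hw1]
  · intro v hv
    exact hF _ hv
  · change ∑ v : T.Vertex, F v.1 • v.1 = p
    rw [T.sum_vertices_eq hs (fun u => F u • u) (fun u hu => by simp [hF u hu]), ← hwp]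
    exact Finset.sum_congr rfl fun u hu => by rw [hFs u hu]
  · -- two splittings are carried by the common face of their carriers
    suffices H : ∀ (a : stdSimplex ℝ T.Vertex), T.IsSplitting p a →
        ∀ (b : stdSimplex ℝ T.Vertex), T.IsSplitting p b →
        ∃ c : (K → ℝ) → ℝ, ∀ v : T.Vertex, a v = c v.1 ∧ b v = c v.1 by
      intro a b ha hb
      obtain ⟨c, hc⟩ := H a ha b hb
      refine Subtype.ext (funext fun v => ?_)
      exact (hc v).1.trans (hc v).2.symm
    -- extension of weights by zero
    let ext : stdSimplex ℝ T.Vertex → (K → ℝ) → ℝ := fun a u =>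
      if h : u ∈ T.complex.vertices then a ⟨u, h⟩ else 0
    have hext : ∀ a (v : T.Vertex), ext a v.1 = a v := fun a v => by simp [ext]
    have carried : ∀ (a : stdSimplex ℝ T.Vertex) (t : Finset (K → ℝ)), t ∈ T.complex.faces →
        (∀ v : T.Vertex, v.1 ∉ t → a v = 0) → ∑ v, a v • v.1 = (p : K → ℝ) →
        (∀ u ∉ t, ext a u = 0) ∧ (∑ u ∈ t, ext a u = 1) ∧ (∑ u ∈ t, ext a u • u = (p : K → ℝ)) ∧
          ∀ u, 0 ≤ ext a u := by
      intro a t ht h0 hsum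
      have h0' : ∀ u ∉ t, ext a u = 0 := by
        intro u hu
        by_cases h : u ∈ T.complex.vertices
        · rw [hext a ⟨u, h⟩]; exact h0 _ hu
        · simp [ext, h]
      refine ⟨h0', ?_, ?_, ?_⟩
      · rw [← T.sum_vertices_eq ht (ext a) h0']
        simp_rw [hext]
        exact a.2.2
      · rw [← T.sum_vertices_eq ht (fun u => ext a u • u) (fun u hu => by simp [h0' u hu])]
        simp_rw [hext]
        exact hsum
      · intro u
        by_cases h : u ∈ T.complex.vertices
        · rw [hext a ⟨u, h⟩]; exact a.2.1 _
        · simp [ext, h]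
    rintro a ⟨⟨t, ht, hat⟩, hap⟩ b ⟨⟨t', ht', hbt⟩, hbp⟩
    obtain ⟨a0, a1, a2, a3⟩ := carried a t ht hat hap
    obtain ⟨b0, b1, b2, b3⟩ := carried b t' ht' hbt hbp
    have hpt : (p : K → ℝ) ∈ convexHull ℝ (t : Set (K → ℝ)) :=
      Finset.mem_convexHull'.2 ⟨ext a, fun u _ => a3 u, a1, a2⟩
    have hpt' : (p : K → ℝ) ∈ convexHull ℝ (t' : Set (K → ℝ)) :=
      Finset.mem_convexHull'.2 ⟨ext b, fun u _ => b3 u, b1, b2⟩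
    have hptt : (p : K → ℝ) ∈ convexHull ℝ ((t ∩ t' : Finset (K → ℝ)) : Set (K → ℝ)) := by
      rw [Finset.coe_inter]
      exact T.complex.inter_subset_convexHull ht ht' ⟨hpt, hpt'⟩
    obtain ⟨d, _, d1, d2⟩ := Finset.mem_convexHull'.1 hptt
    let D : (K → ℝ) → ℝ := fun u => if u ∈ t ∩ t' then d u else 0
    have main : ∀ (e : (K → ℝ) → ℝ) (r : Finset (K → ℝ)), r ∈ T.complex.faces → t ∩ t' ⊆ r →
        (∀ u ∉ r, e u = 0) → ∑ u ∈ r, e u = 1 → ∑ u ∈ r, e u • u = (p : K → ℝ) →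
        ∀ u, e u = D u := by
      intro e r hr hsub e0 e1 e2 u
      by_cases hu : u ∈ r
      · refine AffineIndependent.eq_of_sum_eq_sum_subtype (T.complex.indep hr) ?_ ?_ u hu
        · rw [e1, ← d1]
          simp only [D]
          rw [← Finset.sum_filter, Finset.filter_mem_eq_inter, Finset.inter_eq_right.2 hsub]
        · rw [e2, ← d2]
          simp only [D, ite_smul, zero_smul]
          rw [← Finset.sum_filter, Finset.filter_mem_eq_inter, Finset.inter_eq_right.2 hsub]
      · have : u ∉ t ∩ t' := fun h => hu (hsub h)
        rw [e0 u hu]; simp only [D, this, if_false]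
    refine ⟨D, fun v => ⟨?_, ?_⟩⟩
    · rw [← hext a v]
      exact main (ext a) t ht Finset.inter_subset_left a0 a1 a2 v.1
    · rw [← hext b v]
      exact main (ext b) t' ht' Finset.inter_subset_right b0 b1 b2 v.1

/-- The splitting `S[p]` of a belief `p` on the vertices of a simplex containing it: `T.split p v`
is `S[v|p]`. -/
def split (p : stdSimplex ℝ K) : stdSimplex ℝ T.Vertex :=
  (T.existsUnique_isSplitting p).choose

lemma isSplitting_split (p : stdSimplex ℝ K) : T.IsSplitting p (T.split p) :=
  (T.existsUnique_isSplitting p).choose_spec.1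

lemma continuous_split : Continuous T.split := by
  let φ : stdSimplex ℝ T.Vertex → (K → ℝ) := fun w => ∑ v, w v • v.1
  have hc : ∀ v : T.Vertex, Continuous fun w : stdSimplex ℝ T.Vertex => w v := fun v =>
    (continuous_apply v).comp continuous_subtype_val
  have hφ : Continuous φ := by
    refine continuous_finsetSum _ fun v _ => (hc v).smul continuous_const
  let W : Set (stdSimplex ℝ T.Vertex) :=
    ⋃ s ∈ T.complex.faces, {w | ∀ v : T.Vertex, v.1 ∉ s → w v = 0}
  have hW : IsClosed W := by
    refine T.finite_faces.isClosed_biUnion fun s _ => ?_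
    have : {w : stdSimplex ℝ T.Vertex | ∀ v : T.Vertex, v.1 ∉ s → w v = 0} =
        ⋂ v : T.Vertex, ⋂ _ : v.1 ∉ s, {w | w v = 0} := by ext; simp
    rw [this]
    exact isClosed_iInter fun v => isClosed_iInter fun _ => isClosed_eq (hc v) continuous_const
  refine continuous_iff_isClosed.2 fun C hC => ?_
  have key : T.split ⁻¹' C = (fun p : stdSimplex ℝ K => (p : K → ℝ)) ⁻¹' (φ '' (W ∩ C)) := by
    ext p
    constructor
    · intro hp
      obtain ⟨⟨s, hs, h0⟩, h1⟩ := T.isSplitting_split p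
      exact ⟨T.split p, ⟨Set.mem_biUnion hs h0, hp⟩, h1⟩
    · rintro ⟨w, ⟨hwW, hwC⟩, hw⟩
      obtain ⟨s, hs, h0⟩ := Set.mem_iUnion₂.1 hwW
      have : w = T.split p :=
        (T.existsUnique_isSplitting p).unique ⟨⟨s, hs, h0⟩, hw⟩ (T.isSplitting_split p)
      change T.split p ∈ C
      rwa [← this]
  rw [key]
  exact (((hW.inter hC).isCompact.image hφ).isClosed).preimage continuous_subtype_val

/-- The stepsize: the maximal Euclidean distance between two vertices of a common simplex. -/
def stepsize : ℝ :=
  sSup {d | ∃ s ∈ T.complex.faces, ∃ u ∈ s, ∃ v ∈ s, d = euclideanDist u v}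

/-- `T` is an `(α, C)`-triangulation of `Δ(K)`. -/
def IsRegular (α C : ℝ) : Prop :=
  T.stepsize < α ∧
  ∀ (p : stdSimplex ℝ K) (v : T.Vertex), 0 < T.split p v →
    1 - T.split p v ≤ C / T.stepsize * euclideanDist v.1 p

end Triangulation

/-! ## Absorbing games, the belief game and the triangulated game -/

lemma measurable_finsum_dirac {α β ι : Type*} [MeasurableSpace α] [MeasurableSpace β] (s : Finset ι)
    {c : ι → α → ℝ} {f : ι → α → β} (hc : ∀ i, Measurable (c i)) (hf : ∀ i, Measurable (f i)) :
    Measurable fun a => ∑ i ∈ s, ENNReal.ofReal (c i a) • Measure.dirac (f i a) := by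
  refine Measure.measurable_of_measurable_coe _ fun t ht => ?_
  simp only [Measure.coe_finsetSum, Measure.coe_smul, Finset.sum_apply, Pi.smul_apply,
    smul_eq_mul, Measure.dirac_apply' _ ht]
  exact Finset.measurable_sum _ fun i _ => (hc i).ennreal_ofReal.mul
    ((measurable_one.indicator ht).comp (hf i))

lemma isProbabilityMeasure_finsum_dirac {β ι : Type*} [MeasurableSpace β] (s : Finset ι)
    {c : ι → ℝ} {f : ι → β} (h0 : ∀ i, 0 ≤ c i) (h1 : ∑ i ∈ s, c i = 1) :
    IsProbabilityMeasure (∑ i ∈ s, ENNReal.ofReal (c i) • Measure.dirac (f i)) := by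
  constructor
  simp only [Measure.coe_finsetSum, Measure.coe_smul, Finset.sum_apply, Pi.smul_apply,
    smul_eq_mul, measure_univ, mul_one]
  rw [← ENNReal.ofReal_sum_of_nonneg fun i _ => h0 i, h1, ENNReal.ofReal_one]

namespace IncompleteInfoGame

variable {K L Ω I J : Type*} [Fintype K] [Fintype L] [Fintype Ω] [Fintype I] [Fintype J]

/-- A state is absorbing if the game never leaves it and, for every pair of types, its payoff does
not depend on the actions. -/
def IsAbsorbing (Γ : IncompleteInfoGame K L Ω I J) (ω : Ω) : Prop :=
  (∀ k l i j i' j', Γ.g k l ω i j = Γ.g k l ω i' j') ∧ ∀ i j, Γ.ρ ω i j ω = 1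

/-- An absorbing game: exactly one state is non-absorbing. -/
def IsAbsorbingGame (Γ : IncompleteInfoGame K L Ω I J) : Prop :=
  ∃! ω, ¬ Γ.IsAbsorbing ω

open Classical in
/-- There are actions `i₀`, `j₀` and absorbing states `ω₁`, `ω₂`, with constant payoffs `-‖g‖`
and `‖g‖` (sup norm), such that from every non-absorbing state `i₀` alone leads to `ω₁`, `j₀`
alone leads to `ω₂`, and both together lead to either with probability `1/2`. -/
def HasQuittingActions (Γ : IncompleteInfoGame K L Ω I J) : Prop :=
  ∃ (i₀ : I) (j₀ : J) (ω₁ ω₂ : Ω), Γ.IsAbsorbing ω₁ ∧ Γ.IsAbsorbing ω₂ ∧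
    (∀ k l i j, Γ.g k l ω₁ i j = -‖Γ.g‖) ∧ (∀ k l i j, Γ.g k l ω₂ i j = ‖Γ.g‖) ∧
    ∀ ω, ¬ Γ.IsAbsorbing ω →
      (∀ j, j ≠ j₀ → Γ.ρ ω i₀ j = stdSimplex.vertex ω₁) ∧
      (∀ i, i ≠ i₀ → Γ.ρ ω i j₀ = stdSimplex.vertex ω₂) ∧
      ∀ ω', Γ.ρ ω i₀ j₀ ω' =
        1 / 2 * stdSimplex.vertex (S := ℝ) ω₁ ω' + 1 / 2 * stdSimplex.vertex (S := ℝ) ω₂ ω'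

/-- Expected stage payoff `g^e`. -/
def beliefPayoff (Γ : IncompleteInfoGame K L Ω I J) (p : stdSimplex ℝ K) (q : stdSimplex ℝ L)
    (ω : Ω) (x : MixedAction K I) (y : MixedAction L J) : ℝ :=
  ∑ k, ∑ l, ∑ i, ∑ j, p k * q l * x k i * y l j * Γ.g k l ω i j

/-- The probability that `(i, j)` is played and the next state is `ω'`. -/
def outcomeProb (Γ : IncompleteInfoGame K L Ω I J) (p : stdSimplex ℝ K) (q : stdSimplex ℝ L)
    (ω : Ω) (x : MixedAction K I) (y : MixedAction L J) (t : I × J × Ω) : ℝ :=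
  Γ.ρ ω t.1 t.2.1 t.2.2 * actionProb p x t.1 * actionProb q y t.2.1

lemma outcomeProb_nonneg (Γ : IncompleteInfoGame K L Ω I J) (p : stdSimplex ℝ K)
    (q : stdSimplex ℝ L) (ω : Ω) (x : MixedAction K I) (y : MixedAction L J) (t : I × J × Ω) :
    0 ≤ Γ.outcomeProb p q ω x y t :=
  mul_nonneg (mul_nonneg ((Γ.ρ ω t.1 t.2.1).2.1 _) (actionProb_nonneg _ _ _))
    (actionProb_nonneg _ _ _)

lemma sum_outcomeProb (Γ : IncompleteInfoGame K L Ω I J) (p : stdSimplex ℝ K)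
    (q : stdSimplex ℝ L) (ω : Ω) (x : MixedAction K I) (y : MixedAction L J) :
    ∑ t, Γ.outcomeProb p q ω x y t = 1 := by
  have h : ∀ i j, ∑ ω', Γ.ρ ω i j ω' = 1 := fun i j => (Γ.ρ ω i j).2.2
  simp only [outcomeProb, Fintype.sum_prod_type, ← Finset.sum_mul, h, one_mul, ← Finset.mul_sum,
    sum_actionProb, mul_one]

variable [MeasurableSpace Ω] [DiscreteMeasurableSpace Ω]

lemma measurable_outcomeProb {α : Type*} [MeasurableSpace α] (Γ : IncompleteInfoGame K L Ω I J)
    {p : α → stdSimplex ℝ K} {q : α → stdSimplex ℝ L} {ω : α → Ω} {x : α → MixedAction K I}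
    {y : α → MixedAction L J} (hp : Measurable p) (hq : Measurable q) (hω : Measurable ω)
    (hx : Measurable x) (hy : Measurable y) (t : I × J × Ω) :
    Measurable fun a => Γ.outcomeProb (p a) (q a) (ω a) (x a) (y a) t := by
  unfold outcomeProb
  exact (((measurable_of_countable fun o => Γ.ρ o t.1 t.2.1 t.2.2).comp hω).mul
    (measurable_actionProb hp hx _)).mul (measurable_actionProb hq hy _)

/-- The belief game `Γ^e`: states are triples (belief on Player 1's type, belief on Player 2's
type, state). When `(i, j)` is played and `ω'` is drawn, the new state is formed by the two
posteriors and `ω'`. -/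
def beliefGame (Γ : IncompleteInfoGame K L Ω I J) :
    StochasticGame (stdSimplex ℝ K × stdSimplex ℝ L × Ω) (MixedAction K I) (MixedAction L J) where
  transition :=
    { toFun := fun z => ∑ t : I × J × Ω,
        ENNReal.ofReal (Γ.outcomeProb z.1.1 z.1.2.1 z.1.2.2 z.2.1 z.2.2 t) •
          Measure.dirac (posteriorBelief z.1.1 z.2.1 t.1, posteriorBelief z.1.2.1 z.2.2 t.2.1, t.2.2)
      measurable' := measurable_finsum_dirac _
        (fun t => Γ.measurable_outcomeProb (by fun_prop) (by fun_prop) (by fun_prop)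
          (by fun_prop) (by fun_prop) t)
        (fun t => (measurable_posteriorBelief (by fun_prop) (by fun_prop) _).prodMk
          ((measurable_posteriorBelief (by fun_prop) (by fun_prop) _).prodMk measurable_const)) }
  isMarkov := ⟨fun _ => isProbabilityMeasure_finsum_dirac _ (Γ.outcomeProb_nonneg _ _ _ _ _)
    (Γ.sum_outcomeProb _ _ _ _ _)⟩
  payoff := fun s x y => Γ.beliefPayoff s.1 s.2.1 s.2.2 x y

/-- The triangulated game `Γ^f`, with finite state space `P × Q × Ω`: transitions are as in the
belief game, except that the two posteriors are then split independently over the vertices of the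
triangulations. -/
def triangulatedGame (Γ : IncompleteInfoGame K L Ω I J) (P : Triangulation K)
    (Q : Triangulation L) :
    StochasticGame (P.Vertex × Q.Vertex × Ω) (MixedAction K I) (MixedAction L J) where
  transition :=
    { toFun := fun z => ∑ t : (I × J × Ω) × P.Vertex × Q.Vertex,
        ENNReal.ofReal
          (Γ.outcomeProb (P.toBelief z.1.1) (Q.toBelief z.1.2.1) z.1.2.2 z.2.1 z.2.2 t.1 *
            P.split (posteriorBelief (P.toBelief z.1.1) z.2.1 t.1.1) t.2.1 *
            Q.split (posteriorBelief (Q.toBelief z.1.2.1) z.2.2 t.1.2.1) t.2.2) •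
          Measure.dirac (t.2.1, t.2.2, t.1.2.2)
      measurable' := by
        have hP : Measurable P.toBelief := measurable_of_countable _
        have hQ : Measurable Q.toBelief := measurable_of_countable _
        have hSP : Measurable P.split := P.continuous_split.measurable
        have hSQ : Measurable Q.split := Q.continuous_split.measurable
        exact measurable_finsum_dirac _
          (fun t => ((Γ.measurable_outcomeProb (by fun_prop) (by fun_prop) (by fun_prop)
            (by fun_prop) (by fun_prop) t.1).mul
            (measurable_simplex_apply
              (hSP.comp (measurable_posteriorBelief (by fun_prop) (by fun_prop) _)) _)).mul
            (measurable_simplex_apply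
              (hSQ.comp (measurable_posteriorBelief (by fun_prop) (by fun_prop) _)) _))
          (fun t => measurable_const) }
  isMarkov := ⟨fun z => by
    refine isProbabilityMeasure_finsum_dirac _ (fun t => mul_nonneg (mul_nonneg
      (Γ.outcomeProb_nonneg _ _ _ _ _ _) ((P.split _).2.1 _)) ((Q.split _).2.1 _)) ?_
    have hP : ∀ p, ∑ v, P.split p v = 1 := fun p => (P.split p).2.2
    have hQ : ∀ q, ∑ v, Q.split q v = 1 := fun q => (Q.split q).2.2
    rw [Fintype.sum_prod_type]
    simp only [Fintype.sum_prod_type (α₁ := P.Vertex), ← Finset.mul_sum, hP, hQ, mul_one]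
    exact Γ.sum_outcomeProb _ _ _ _ _⟩
  payoff := fun s x y => Γ.beliefPayoff (P.toBelief s.1) (Q.toBelief s.2.1) s.2.2 x y

end IncompleteInfoGame

end

/-! Both values solve Shapley's equation with the same one-shot payoff `oneShot`. In Γ^f the
continuation function is merely replaced by its average `Triangulation.extend` over the splittings
of the two posteriors, so Γ^f is Γ^e with extra noise in the beliefs at every stage. The value v of
Γ^e is concave in p and convex in q (`IsRegularValue`), hence noise in q favours Player 1 and only
noise in p can hurt. It is enough to show v^e ≤ v^f + ε, the other inequality being the same
statement for the game with the players exchanged. The difficulty is uniformity in λ: a loss of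
fixed size per stage could add up to order 1/λ.

The remedy is a function close to v that is a subsolution of Shapley's equation for Γ^f up to λ
times a small constant; `le_add_of_secures_extend` then places it below v^f. This function is
`barrier`: in the non-absorbing state it is the supremum of v(p', q) - Λ|π - c|² over decompositions
p = (1 - β)p' + βπ, plus κ(|p|² - 1) - θ. Its terms have the following roles.

The perturbation π carries the noise. A vertex near z admits a decomposition with the same p' as z,
so that v is not affected by the splitting in p, and the loss is Λ/β² times the variance of the
splitting (`le_barrierExtend`).

The term κ|p|² pays for that variance. Regularity of the triangulation at a vertex p bounds the
variance at z by Cα‖z - p‖₁ (`IsRegular.splitVariance_le_mul`): noise appears only if information is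
revealed. Revelation raises κ|p|² only quadratically in the distance, so posteriors at distance at
most r from the prior are merged first (`exists_merge`); by concavity of v this does not lower the
expected value.

The constant θ pays for the payoff error of order N(r + β) that merging and perturbing cause at
absorption. It is released once, when the state changes for good; errors in the stage payoff carry a
factor λ anyway (`exists_imitation`, `secures_barrier`).

The perturbation must stay in the simplex, so the coordinates of the centre c are 0 or at least T.
Types of prior probability below T are eliminated at the first stage by letting them play i*, which
surely leaves the non-absorbing state and hence does not disturb the beliefs with which the game
goes on (`oneShot_quitOutside_ge`). The constants are fixed in the order T, β = r, κ, and finally α;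
none depends on λ.

Existence of the values: the one-shot games are continuous on compact action spaces and have values
in finitely supported mixed actions (`exists_isMixedValue`), a contraction argument solves Shapley's
equations, and discretizing the states yields measurable nearly optimal stationary strategies. -/

noncomputable section

/-! ## Values of two-player zero-sum games in finitely supported mixed strategies -/

section MixedValue

variable {A B A' B' : Type*}

/-- Some finitely supported mixed action of the maximizer secures the payoff `c`. -/
def Secures (F : A → B → ℝ) (c : ℝ) : Prop :=
  ∃ (ι : Type) (_ : Fintype ι) (w : ι → ℝ) (a : ι → A),
    (∀ t, 0 ≤ w t) ∧ ∑ t, w t = 1 ∧ ∀ b, c ≤ ∑ t, w t * F (a t) b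

/-- `v` is the value of the zero-sum game `F` in finitely supported mixed actions. -/
def IsMixedValue (F : A → B → ℝ) (v : ℝ) : Prop :=
  (∀ δ > 0, Secures F (v - δ)) ∧ ∀ δ > 0, Secures (fun b a => -F a b) (-v - δ)

lemma IsMixedValue.swap {F : A → B → ℝ} {v : ℝ} (h : IsMixedValue F v) :
    IsMixedValue (fun b a => -F a b) (-v) :=
  ⟨h.2, by simpa using h.1⟩

/-- Transfer of strategies: `φ` imitates the maximizer's actions, `ψ` reinterprets the opponent's,
and the error `e` passes through the average unchanged because the weights sum to one. -/
lemma Secures.map {F : A → B → ℝ} {F' : A' → B' → ℝ} {c e : ℝ} (h : Secures F c)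
    (φ : A → A') (ψ : B' → B) (hφ : ∀ a b, F a (ψ b) ≤ F' (φ a) b + e) : Secures F' (c - e) := by
  obtain ⟨ι, _, w, a, hw, hw1, hc⟩ := h
  refine ⟨ι, _, w, fun t => φ (a t), hw, hw1, fun b => ?_⟩
  have h1 : ∑ t, w t * F (a t) (ψ b) ≤ ∑ t, w t * (F' (φ (a t)) b + e) :=
    Finset.sum_le_sum fun t _ => mul_le_mul_of_nonneg_left (hφ _ _) (hw t)
  have h2 : ∑ t, w t * (F' (φ (a t)) b + e) = ∑ t, w t * F' (φ (a t)) b + e := by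
    simp only [mul_add, Finset.sum_add_distrib, ← Finset.sum_mul, hw1, one_mul]
  linarith [hc (ψ b)]

lemma Secures.mono {F : A → B → ℝ} {c d : ℝ} (h : Secures F c) (hd : d ≤ c) : Secures F d := by
  obtain ⟨ι, _, w, a, hw, hw1, hc⟩ := h
  exact ⟨ι, _, w, a, hw, hw1, fun b => hd.trans (hc b)⟩

lemma Secures.of_pure {F : A → B → ℝ} {c : ℝ} (a : A) (h : ∀ b, c ≤ F a b) : Secures F c :=
  ⟨Unit, inferInstance, fun _ => 1, fun _ => a, by simp, by simp, by simpa using h⟩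

lemma sum_mul_add_const {ι : Type*} [Fintype ι] {w : ι → ℝ} (hw : ∑ t, w t = 1) (f : ι → ℝ)
    (c : ℝ) : ∑ t, w t * (f t + c) = ∑ t, w t * f t + c := by
  simp only [mul_add, Finset.sum_add_distrib, ← Finset.sum_mul, hw, one_mul]

/-- Comparison of what the two players secure, up to scaling of the payoffs. -/
lemma Secures.scaled_le {F F' : A → B → ℝ} {c d s t e : ℝ} (h : Secures F c)
    (h' : Secures (fun b a => -F' a b) (-d)) (hs : 0 ≤ s) (ht : 0 ≤ t)
    (hF : ∀ a b, s * F a b ≤ t * F' a b + e) : s * c ≤ t * d + e := by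
  obtain ⟨ι, _, w, a, hw, hw1, hc⟩ := h
  obtain ⟨κ, _, u, b, hu, hu1, hd⟩ := h'
  have e1 : s * c ≤ ∑ j, ∑ i, u j * (w i * (s * F (a i) (b j))) := by
    calc s * c = ∑ j, u j * (s * c) := by rw [← Finset.sum_mul, hu1, one_mul]
      _ ≤ ∑ j, u j * (s * ∑ i, w i * F (a i) (b j)) := Finset.sum_le_sum fun j _ =>
          mul_le_mul_of_nonneg_left (mul_le_mul_of_nonneg_left (hc _) hs) (hu j)
      _ = _ := by
          refine Finset.sum_congr rfl fun j _ => ?_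
          rw [Finset.mul_sum, Finset.mul_sum]
          exact Finset.sum_congr rfl fun i _ => by ring
  have e2 : ∑ j, ∑ i, u j * (w i * (s * F (a i) (b j))) ≤
      ∑ j, ∑ i, u j * (w i * (t * F' (a i) (b j) + e)) :=
    Finset.sum_le_sum fun j _ => Finset.sum_le_sum fun i _ => mul_le_mul_of_nonneg_left
      (mul_le_mul_of_nonneg_left (hF _ _) (hw i)) (hu j)
  have e3 : ∑ j, ∑ i, u j * (w i * (t * F' (a i) (b j) + e)) =
      t * ∑ i, w i * ∑ j, u j * F' (a i) (b j) + e := by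
    simp_rw [← Finset.mul_sum, sum_mul_add_const hw1, sum_mul_add_const hu1, Finset.mul_sum]
    rw [Finset.sum_comm]
    congr 1
    exact Finset.sum_congr rfl fun i _ => Finset.sum_congr rfl fun j _ => by ring
  have e4 : ∑ i, w i * ∑ j, u j * F' (a i) (b j) ≤ d := by
    calc ∑ i, w i * ∑ j, u j * F' (a i) (b j) ≤ ∑ i, w i * d := by
          refine Finset.sum_le_sum fun i _ => mul_le_mul_of_nonneg_left ?_ (hw i)
          have := hd (a i)
          simp only [mul_neg, Finset.sum_neg_distrib] at this
          linarith
      _ = d := by rw [← Finset.sum_mul, hw1, one_mul]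
  nlinarith

lemma Secures.le {F : A → B → ℝ} {c d : ℝ} (h : Secures F c)
    (h' : Secures (fun b a => -F a b) (-d)) : c ≤ d := by
  simpa using h.scaled_le h' zero_le_one zero_le_one (e := 0) (by simp)

lemma IsMixedValue.le_of_secures {F : A → B → ℝ} {c v : ℝ} (hv : IsMixedValue F v)
    (h : Secures F c) : c ≤ v := by
  refine le_of_forall_pos_le_add fun δ hδ => h.le ?_
  convert hv.2 δ hδ using 1
  ring

lemma IsMixedValue.scaled_le {F F' : A → B → ℝ} {v v' s t e : ℝ} (h : IsMixedValue F v)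
    (h' : IsMixedValue F' v') (hs : 0 ≤ s) (ht : 0 ≤ t)
    (hF : ∀ a b, s * F a b ≤ t * F' a b + e) : s * v ≤ t * v' + e := by
  refine le_of_forall_pos_le_add fun δ hδ => ?_
  have hst : 0 < s + t + 1 := by positivity
  have h3 := (h.1 (δ / (s + t + 1)) (by positivity)).scaled_le (d := v' + δ / (s + t + 1))
    (by convert h'.2 (δ / (s + t + 1)) (by positivity) using 1; ring) hs ht hF
  have h4 : (s + t + 1) * (δ / (s + t + 1)) = δ := by field_simp
  have h5 : 0 ≤ δ / (s + t + 1) := by positivity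
  nlinarith

lemma IsMixedValue.le_add {F F' : A → B → ℝ} {v v' e : ℝ} (h : IsMixedValue F v)
    (h' : IsMixedValue F' v') (hF : ∀ a b, F a b ≤ F' a b + e) : v ≤ v' + e := by
  simpa using h.scaled_le h' zero_le_one zero_le_one (e := e) (by simpa using hF)

/-- If the maximizer can merge any two actions of the games `F₁` and `F₂` into one of `F`, the same
holds for the values. -/
lemma IsMixedValue.superadd {F F₁ F₂ : A → B → ℝ} {v v₁ v₂ r s t : ℝ} (h : IsMixedValue F v)
    (h₁ : IsMixedValue F₁ v₁) (h₂ : IsMixedValue F₂ v₂) (hr : 0 < r) (hs : 0 ≤ s) (ht : 0 ≤ t)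
    (hF : ∀ a₁ a₂, ∃ a, ∀ b, s * F₁ a₁ b + t * F₂ a₂ b ≤ r * F a b) :
    s * v₁ + t * v₂ ≤ r * v := by
  refine le_of_forall_pos_le_add fun δ hδ => ?_
  have hst : 0 < s + t + 1 := by positivity
  set η := δ / (s + t + 1) with hη
  have hη0 : 0 < η := by positivity
  have h4 : (s + t + 1) * η = δ := by rw [hη]; field_simp
  obtain ⟨ι, _, w, a₁, hw, hw1, hc⟩ := h₁.1 η hη0
  obtain ⟨κ, _, u, a₂, hu, hu1, hd⟩ := h₂.1 η hη0
  choose φ hφ using hF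
  have key : Secures F ((s * (v₁ - η) + t * (v₂ - η)) / r) := by
    refine ⟨ι × κ, inferInstance, fun z => w z.1 * u z.2, fun z => φ (a₁ z.1) (a₂ z.2),
      fun z => mul_nonneg (hw _) (hu _), ?_, fun b => ?_⟩
    · rw [Fintype.sum_prod_type]
      simp only [← Finset.mul_sum, hu1, mul_one, hw1]
    · rw [div_le_iff₀ hr, Fintype.sum_prod_type]
      have e1 : ∑ i, ∑ j, w i * u j * (s * F₁ (a₁ i) b + t * F₂ (a₂ j) b) ≤
          ∑ i, ∑ j, w i * u j * (r * F (φ (a₁ i) (a₂ j)) b) :=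
        Finset.sum_le_sum fun i _ => Finset.sum_le_sum fun j _ =>
          mul_le_mul_of_nonneg_left (hφ _ _ _) (mul_nonneg (hw _) (hu _))
      have e2 : ∑ i, ∑ j, w i * u j * (s * F₁ (a₁ i) b + t * F₂ (a₂ j) b) =
          s * ∑ i, w i * F₁ (a₁ i) b + t * ∑ j, u j * F₂ (a₂ j) b := by
        have : ∀ i, ∑ j, w i * u j * (s * F₁ (a₁ i) b + t * F₂ (a₂ j) b) =
            w i * (s * F₁ (a₁ i) b + t * ∑ j, u j * F₂ (a₂ j) b) := by
          intro i
          simp only [mul_assoc, ← Finset.mul_sum, mul_add, Finset.sum_add_distrib, ← Finset.sum_mul,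
            hu1, one_mul]
          congr 2
          rw [Finset.mul_sum]
          exact Finset.sum_congr rfl fun j _ => by ring
        simp_rw [this, sum_mul_add_const hw1]
        congr 1
        rw [Finset.mul_sum]
        exact Finset.sum_congr rfl fun i _ => by ring
      have e3 : ∑ i, ∑ j, w i * u j * (r * F (φ (a₁ i) (a₂ j)) b) =
          (∑ i, ∑ j, w i * u j * F (φ (a₁ i) (a₂ j)) b) * r := by
        rw [Finset.sum_mul]
        refine Finset.sum_congr rfl fun i _ => ?_
        rw [Finset.sum_mul]
        exact Finset.sum_congr rfl fun j _ => by ring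
      have := mul_le_mul_of_nonneg_left (hc b) hs
      have := mul_le_mul_of_nonneg_left (hd b) ht
      linarith
  have := h.le_of_secures key
  rw [div_le_iff₀ hr] at this
  nlinarith

/-- Von Neumann's minimax theorem for matrix games. -/
lemma exists_matrix_value {m n : ℕ} [NeZero m] [NeZero n] (M : Fin m → Fin n → ℝ) :
    ∃ (V : ℝ) (x : stdSimplex ℝ (Fin m)) (y : stdSimplex ℝ (Fin n)),
      (∀ j, V ≤ ∑ i, x i * M i j) ∧ ∀ i, ∑ j, y j * M i j ≤ V := by
  classical
  let f : (Fin n → ℝ) → (Fin m → ℝ) → ℝ := fun y x => ∑ i, ∑ j, x i * y j * M i j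
  have hc1 : ∀ x, Continuous fun y => f y x := fun x => by fun_prop
  have hc2 : ∀ y, Continuous fun x => f y x := fun y => by fun_prop
  have hl1 : ∀ (x : Fin m → ℝ) (a b : ℝ) (y y' : Fin n → ℝ),
      f (a • y + b • y') x = a * f y x + b * f y' x := fun x a b y y' => by
    simp only [f, Finset.mul_sum, ← Finset.sum_add_distrib, Pi.add_apply, Pi.smul_apply,
      smul_eq_mul]
    exact Finset.sum_congr rfl fun i _ => Finset.sum_congr rfl fun j _ => by ring
  have hl2 : ∀ (y : Fin n → ℝ) (a b : ℝ) (x x' : Fin m → ℝ),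
      f y (a • x + b • x') = a * f y x + b * f y x' := fun y a b x x' => by
    simp only [f, Finset.mul_sum, ← Finset.sum_add_distrib, Pi.add_apply, Pi.smul_apply,
      smul_eq_mul]
    exact Finset.sum_congr rfl fun i _ => Finset.sum_congr rfl fun j _ => by ring
  -- The minimizer's variable comes first in Sion's theorem, hence the order of arguments of `f`.
  obtain ⟨y, hy, x, hx, hsp⟩ := Sion.exists_isSaddlePointOn (f := f)
    (X := stdSimplex ℝ (Fin n)) (Y := stdSimplex ℝ (Fin m))
    ⟨_, single_mem_stdSimplex ℝ 0⟩ (convex_stdSimplex ℝ _)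
    (isCompact_stdSimplex ℝ _)
    (fun x _ => (hc1 x).lowerSemicontinuous.lowerSemicontinuousOn _)
    (fun x _ => ConvexOn.quasiconvexOn ⟨convex_stdSimplex ℝ _, fun y _ y' _ a b _ _ _ => by
      simp only [hl1, smul_eq_mul, le_refl]⟩)
    (convex_stdSimplex ℝ _) ⟨_, single_mem_stdSimplex ℝ 0⟩ (isCompact_stdSimplex ℝ _)
    (fun y _ => (hc2 y).upperSemicontinuous.upperSemicontinuousOn _)
    (fun y _ => ConcaveOn.quasiconcaveOn ⟨convex_stdSimplex ℝ _, fun x _ x' _ a b _ _ _ => by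
      simp only [hl2, smul_eq_mul, le_refl]⟩)
  refine ⟨f y x, ⟨x, hx⟩, ⟨y, hy⟩, fun j => ?_, fun i => ?_⟩
  · have := hsp _ (single_mem_stdSimplex ℝ j) x hx
    refine this.trans (le_of_eq ?_)
    simp only [f]
    refine Finset.sum_congr rfl fun i _ => ?_
    rw [Finset.sum_eq_single j]
    · simp only [Pi.single_eq_same, mul_one]; rfl
    · intro b _ hb; simp [hb]
    · simp
  · have := hsp y hy _ (single_mem_stdSimplex ℝ i)
    refine le_trans (le_of_eq ?_) this
    simp only [f]
    rw [Finset.sum_eq_single i]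
    · simp only [Pi.single_eq_same, one_mul]; rfl
    · intro b _ hb; simp [hb]
    · simp

/-- Compactness of the domain is used, through preimages of balls, so that the net is indexed by
points of `X`; `NeZero n` is what the matrix game needs. -/
lemma exists_finite_net {X Z : Type*} [TopologicalSpace X] [CompactSpace X] [Nonempty X]
    [PseudoMetricSpace Z] (Φ : X → Z) (hΦ : Continuous Φ) {δ : ℝ} (hδ : 0 < δ) :
    ∃ (n : ℕ) (_ : NeZero n) (a : Fin n → X), ∀ x, ∃ t, dist (Φ x) (Φ (a t)) < δ := by
  obtain ⟨s, hs⟩ := isCompact_univ.elim_finite_subcover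
    (fun x : X => Φ ⁻¹' Metric.ball (Φ x) δ)
    (fun x => Metric.isOpen_ball.preimage hΦ) (fun x _ => Set.mem_iUnion.2 ⟨x, by simp [hδ]⟩)
  have hcov : ∀ x, ∃ y ∈ s, dist (Φ x) (Φ y) < δ := fun x => by
    simpa using hs (Set.mem_univ x)
  have hne : s.card ≠ 0 := by
    obtain ⟨y, hy, _⟩ := hcov (Classical.arbitrary X)
    exact Finset.card_ne_zero_of_mem hy
  refine ⟨s.card, ⟨hne⟩, fun t => (s.equivFin.symm t).1, fun x => ?_⟩
  obtain ⟨y, hy, hd⟩ := hcov x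
  exact ⟨s.equivFin ⟨y, hy⟩, by simpa using hd⟩

/-- A zero-sum game with compact action spaces and continuous payoff has a value. -/
theorem exists_isMixedValue [TopologicalSpace A] [TopologicalSpace B] [CompactSpace A]
    [CompactSpace B] [Nonempty A] [Nonempty B] (F : A → B → ℝ)
    (hF : Continuous fun z : A × B => F z.1 z.2) : ∃ v, IsMixedValue F v := by
  -- Currying sends an action to its payoff function in `C(B, ℝ)`, so that a finite net there is
  -- uniform over the opponent's actions.
  have hA : ∀ δ > 0, ∃ (n : ℕ) (_ : NeZero n) (a : Fin n → A), ∀ x, ∃ t, ∀ b,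
      |F x b - F (a t) b| ≤ δ := by
    intro δ hδ
    obtain ⟨n, hn, a, ha⟩ := exists_finite_net
      (fun x : A => (⟨fun b => F x b, by fun_prop⟩ : C(B, ℝ)))
      (ContinuousMap.curry ⟨fun z : A × B => F z.1 z.2, hF⟩).continuous hδ
    refine ⟨n, hn, a, fun x => ?_⟩
    obtain ⟨t, ht⟩ := ha x
    exact ⟨t, fun b => (ContinuousMap.dist_apply_le_dist b).trans ht.le⟩
  have hB : ∀ δ > 0, ∃ (n : ℕ) (_ : NeZero n) (b : Fin n → B), ∀ y, ∃ t, ∀ a,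
      |F a y - F a (b t)| ≤ δ := by
    intro δ hδ
    have hF' : Continuous fun z : B × A => F z.2 z.1 := hF.comp continuous_swap
    obtain ⟨n, hn, a, ha⟩ := exists_finite_net
      (fun y : B => (⟨fun a => F a y, by fun_prop⟩ : C(A, ℝ)))
      (ContinuousMap.curry ⟨fun z : B × A => F z.2 z.1, hF'⟩).continuous hδ
    refine ⟨n, hn, a, fun x => ?_⟩
    obtain ⟨t, ht⟩ := ha x
    exact ⟨t, fun b => (ContinuousMap.dist_apply_le_dist b).trans ht.le⟩
  -- The value of the matrix game on the two nets is secured by both players up to the mesh of the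
  -- nets.
  have key : ∀ δ > 0, ∃ V, Secures F (V - δ) ∧ Secures (fun b a => -F a b) (-V - δ) := by
    intro δ hδ
    obtain ⟨m, _, a, ha⟩ := hA δ hδ
    obtain ⟨n, _, b, hb⟩ := hB δ hδ
    obtain ⟨V, x, y, hx, hy⟩ := exists_matrix_value fun i j => F (a i) (b j)
    refine ⟨V, ⟨Fin m, inferInstance, x, a, x.2.1, x.2.2, fun z => ?_⟩,
      ⟨Fin n, inferInstance, y, b, y.2.1, y.2.2, fun z => ?_⟩⟩
    · obtain ⟨j, hj⟩ := hb z
      have h1 : ∑ i, x i * F (a i) (b j) ≤ ∑ i, x i * (F (a i) z + δ) :=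
        Finset.sum_le_sum fun i _ => mul_le_mul_of_nonneg_left
          (by linarith [(abs_le.1 (hj (a i))).1]) (x.2.1 i)
      rw [sum_mul_add_const (stdSimplex.sum_eq_one x)] at h1
      linarith [hx j]
    · obtain ⟨i, hi⟩ := ha z
      have h1 : ∑ j, y j * F z (b j) ≤ ∑ j, y j * (F (a i) (b j) + δ) :=
        Finset.sum_le_sum fun j _ => mul_le_mul_of_nonneg_left
          (by linarith [(abs_le.1 (hi (b j))).2]) (y.2.1 j)
      rw [sum_mul_add_const (stdSimplex.sum_eq_one y)] at h1
      simp only [mul_neg, Finset.sum_neg_distrib]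
      linarith [hy i]
  have hbd : BddAbove {c | Secures F c} := by
    obtain ⟨V, -, hV⟩ := key 1 one_pos
    refine ⟨V + 1, fun c hc => hc.le ?_⟩
    convert hV using 1
    ring
  have hne : {c | Secures F c}.Nonempty := by
    obtain ⟨V, hV, -⟩ := key 1 one_pos
    exact ⟨_, hV⟩
  refine ⟨sSup {c | Secures F c}, fun δ hδ => ?_, fun δ hδ => ?_⟩
  · obtain ⟨c, hc, hlt⟩ := exists_lt_of_lt_csSup hne (sub_lt_self _ hδ)
    exact Secures.mono hc hlt.le
  · obtain ⟨V, hV, hV'⟩ := key (δ / 2) (by positivity)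
    refine Secures.mono hV' ?_
    have := le_csSup hbd hV
    linarith

end MixedValue

end

noncomputable section

/-! ## From one-shot games to discounted stochastic games -/

lemma integrable_of_measurable_of_abs_le {α : Type*} [MeasurableSpace α] {μ : Measure α}
    [IsFiniteMeasure μ] {f : α → ℝ} (hf : Measurable f) {R : ℝ} (hR : ∀ x, |f x| ≤ R) :
    Integrable f μ :=
  Integrable.of_bound hf.aestronglyMeasurable R (Filter.Eventually.of_forall hR)

namespace StochasticGame

variable {S A B : Type*} [MeasurableSpace S] [MeasurableSpace A] [MeasurableSpace B]

/-- The payoff of the one-shot game with continuation payoff `v`. -/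
def auxPayoff (G : StochasticGame S A B) (lam : ℝ) (v : S → ℝ) (z : S × A × B) : ℝ :=
  lam * G.payoff z.1 z.2.1 z.2.2 + (1 - lam) * ∫ s, v s ∂(G.transition z)

lemma integral_stageKernel (σ : BehaviorStrategy S A B A) (τ : BehaviorStrategy S A B B) (n : ℕ)
    (y : (Fin n → S × A × B) × S) {f : S × A × B → ℝ} (hf : Measurable f) :
    ∫ z, f z ∂(stageKernel σ τ n y) = ∫ z, f (y.2, z) ∂((σ.act n y).prod (τ.act n y)) := by
  rw [stageKernel, Kernel.prod_apply, Kernel.prod_apply, Kernel.deterministic_apply,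
    Measure.dirac_prod, integral_map (by fun_prop) hf.aestronglyMeasurable]

lemma integral_stepKernel (G : StochasticGame S A B) (σ : BehaviorStrategy S A B A)
    (τ : BehaviorStrategy S A B B) (n : ℕ) (h : Finset.Iic n → S × A × B) {f : S × A × B → ℝ}
    (hf : Measurable f) {R : ℝ} (hR : ∀ z, |f z| ≤ R) :
    ∫ z, f z ∂(G.stepKernel σ τ n h) =
      ∫ s, ∫ z, f z ∂(stageKernel σ τ (n + 1) (pastOfIic n h, s)) ∂(G.transition (lastOfIic n h)) := by
  rw [stepKernel, Kernel.integral_comp (integrable_of_measurable_of_abs_le hf hR),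
    Kernel.prod_apply, Kernel.deterministic_apply, Measure.dirac_prod, Kernel.comap_apply,
    integral_map (by fun_prop)]
  exact (hf.stronglyMeasurable.integral_kernel).aestronglyMeasurable

lemma map_eval_zero_trajMeasure {E : Type*} [MeasurableSpace E]
    (μ : Measure E) [IsProbabilityMeasure μ]
    (κ : (n : ℕ) → Kernel (Finset.Iic n → E) E) [∀ n, IsMarkovKernel (κ n)] :
    (Kernel.trajMeasure (X := fun _ => E) μ κ).map (fun h => h 0) = μ := by
  have h1 : (Kernel.trajMeasure (X := fun _ => E) μ κ).map (Preorder.frestrictLe 0) =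
      μ.map (MeasurableEquiv.piUnique (fun _ : Finset.Iic 0 => E)).symm := by
    rw [Kernel.trajMeasure, Measure.map_comp _ _ (by fun_prop), Kernel.traj_map_frestrictLe,
      Kernel.partialTraj_self, Measure.id_comp]
  have h2 : (fun h : ℕ → E => h 0) = (fun x : Finset.Iic 0 → E => x default) ∘
      (Preorder.frestrictLe (π := fun _ => E) 0) := rfl
  rw [h2, ← Measure.map_map (by fun_prop) (by fun_prop), h1, Measure.map_map (by fun_prop)
    (by fun_prop)]
  exact Measure.map_id

instance (G : StochasticGame S A B) (s : S) (σ : BehaviorStrategy S A B A)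
    (τ : BehaviorStrategy S A B B) : IsProbabilityMeasure (G.law s σ τ) := by
  unfold law; infer_instance

lemma integral_law_zero (G : StochasticGame S A B) (s : S) (σ : BehaviorStrategy S A B A)
    (τ : BehaviorStrategy S A B B) {f : S × A × B → ℝ} (hf : Measurable f) :
    ∫ h, f (h 0) ∂(G.law s σ τ) = ∫ z, f z ∂(stageKernel σ τ 0 (Fin.elim0, s)) := by
  have := map_eval_zero_trajMeasure (stageKernel σ τ 0 (Fin.elim0, s)) (G.stepKernel σ τ)
  conv_rhs => rw [← this]
  rw [integral_map (measurable_pi_apply 0).aemeasurable hf.aestronglyMeasurable]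
  rfl

lemma integral_law_succ (G : StochasticGame S A B) (s : S) (σ : BehaviorStrategy S A B A)
    (τ : BehaviorStrategy S A B B) (n : ℕ) {f : S × A × B → ℝ} (hf : Measurable f) {R : ℝ}
    (hR : ∀ z, |f z| ≤ R) :
    ∫ h, f (h (n + 1)) ∂(G.law s σ τ) =
      ∫ h, ∫ z, f z ∂(G.stepKernel σ τ n (Preorder.frestrictLe n h)) ∂(G.law s σ τ) := by
  have key := Kernel.map_frestrictLe_trajMeasure_compProd_eq_map_trajMeasure
    (X := fun _ => S × A × B) (μ₀ := stageKernel σ τ 0 (Fin.elim0, s)) (κ := G.stepKernel σ τ)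
    (a := n)
  have h1 : ∫ x, f x.2 ∂((G.law s σ τ).map
      (fun x ↦ (Preorder.frestrictLe (π := fun _ => S × A × B) n x, x (n + 1)))) =
        ∫ h, f (h (n + 1)) ∂(G.law s σ τ) := by
    have hm : Measurable fun x : ℕ → S × A × B =>
        (Preorder.frestrictLe (π := fun _ => S × A × B) n x, x (n + 1)) :=
      (Preorder.measurable_frestrictLe n).prodMk (measurable_pi_apply _)
    exact integral_map hm.aemeasurable (hf.comp measurable_snd).aestronglyMeasurable
  rw [← h1]
  unfold law
  have := Measure.isProbabilityMeasure_map (μ := Kernel.trajMeasure (X := fun _ => S × A × B)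
    (stageKernel σ τ 0 (Fin.elim0, s)) (G.stepKernel σ τ))
    (Preorder.measurable_frestrictLe (X := fun _ => S × A × B) n).aemeasurable
  rw [← key, Measure.integral_compProd (f := fun x => f x.2)
    (integrable_of_measurable_of_abs_le (hf.comp measurable_snd) fun z => hR _)]
  exact integral_map (Preorder.measurable_frestrictLe n).aemeasurable
    (hf.stronglyMeasurable.integral_kernel).aestronglyMeasurable

lemma abs_integral_le {α : Type*} [MeasurableSpace α] (μ : Measure α) [IsProbabilityMeasure μ]
    {f : α → ℝ} {R : ℝ} (hR : ∀ x, |f x| ≤ R) : |∫ x, f x ∂μ| ≤ R := by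
  have := norm_integral_le_of_norm_le_const (μ := μ) (f := f) (C := R)
    (Filter.Eventually.of_forall hR)
  simpa using this

/-- If at every history the one-shot game with continuation payoff `v` yields at least `v - η`,
then the discounted payoff is at least `v - η / lam`. -/
theorem le_discountedPayoff (G : StochasticGame S A B) {lam : ℝ} (hlam : lam ∈ Set.Ioc (0 : ℝ) 1)
    (hg : Measurable fun z : S × A × B => G.payoff z.1 z.2.1 z.2.2) {R : ℝ}
    (hgR : ∀ z : S × A × B, |G.payoff z.1 z.2.1 z.2.2| ≤ R) {v : S → ℝ} (hv : Measurable v)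
    (hvR : ∀ s, |v s| ≤ R) (σ : BehaviorStrategy S A B A) (τ : BehaviorStrategy S A B B) {η : ℝ}
    (h : ∀ n (y : (Fin n → S × A × B) × S),
      v y.2 - η ≤ ∫ z, G.auxPayoff lam v (y.2, z) ∂((σ.act n y).prod (τ.act n y))) (s : S) :
    v s - η / lam ≤ G.discountedPayoff lam s σ τ := by
  obtain ⟨hl0, hl1⟩ := hlam
  set P := G.law s σ τ
  set g : S × A × B → ℝ := fun z => G.payoff z.1 z.2.1 z.2.2
  have hT : Measurable fun z : S × A × B => ∫ s, v s ∂(G.transition z) :=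
    (hv.stronglyMeasurable.integral_kernel).measurable
  have hTR : ∀ z : S × A × B, |∫ s, v s ∂(G.transition z)| ≤ R := fun z => abs_integral_le _ hvR
  have hR0 : 0 ≤ R := (abs_nonneg _).trans (hvR s)
  have hφ : Measurable (G.auxPayoff lam v) := (hg.const_mul _).add (hT.const_mul _)
  have hφR : ∀ z, |G.auxPayoff lam v z| ≤ R := fun z => by
    have h1 := abs_le.1 (hgR z)
    have h2 := abs_le.1 (hTR z)
    unfold auxPayoff
    rw [abs_le]
    constructor <;> nlinarith
  have stage : ∀ n y, v y.2 - η ≤ ∫ z, G.auxPayoff lam v z ∂(stageKernel σ τ n y) := fun n y => by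
    rw [integral_stageKernel σ τ n y hφ]
    exact h n y
  -- The state component of a stage is a Dirac mass at the current state, whatever the actions.
  have stage' : ∀ n (y : (Fin n → S × A × B) × S), ∫ z, v z.1 ∂(stageKernel σ τ n y) = v y.2 :=
    fun n y => by
      rw [integral_stageKernel σ τ n y (f := fun z => v z.1) (hv.comp measurable_fst)]
      simp
  have hvm : Measurable fun z : S × A × B => v z.1 := hv.comp measurable_fst
  have intv : ∀ n, Integrable (fun h : ℕ → S × A × B => v (h n).1) P := fun n =>
    integrable_of_measurable_of_abs_le (f := fun h : ℕ → S × A × B => v (h n).1)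
      (hvm.comp (measurable_pi_apply n)) fun _ => hvR _
  have intg : ∀ n, Integrable (fun h : ℕ → S × A × B => g (h n)) P := fun n =>
    integrable_of_measurable_of_abs_le (f := fun h : ℕ → S × A × B => g (h n))
      (hg.comp (measurable_pi_apply n)) fun _ => hgR _
  have intT : ∀ n, Integrable (fun h : ℕ → S × A × B => ∫ s, v s ∂(G.transition (h n))) P := fun n =>
    integrable_of_measurable_of_abs_le
      (f := fun h : ℕ → S × A × B => ∫ s, v s ∂(G.transition (h n)))
      (hT.comp (measurable_pi_apply n)) fun _ => hTR _
  have next : ∀ n, ∫ h, v (h (n + 1)).1 ∂P = ∫ h, ∫ s, v s ∂(G.transition (h n)) ∂P := fun n => by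
    rw [integral_law_succ G s σ τ n hvm fun _ => hvR _]
    refine integral_congr_ae (Filter.Eventually.of_forall fun h => ?_)
    simp only
    rw [integral_stepKernel G σ τ n _ hvm fun _ => hvR _]
    simp only [stage']
    rfl
  have now : ∀ n, ∫ h, v (h n).1 ∂P - η ≤ ∫ h, G.auxPayoff lam v (h n) ∂P := fun n => by
    cases n with
    | zero =>
      rw [integral_law_zero G s σ τ hvm, integral_law_zero G s σ τ hφ, stage']
      exact stage 0 _
    | succ n =>
      rw [integral_law_succ G s σ τ n hvm fun _ => hvR _, integral_law_succ G s σ τ n hφ hφR]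
      have i1 : Integrable (fun h : ℕ → S × A × B => ∫ z, v z.1
          ∂(G.stepKernel σ τ n (Preorder.frestrictLe n h))) P :=
        integrable_of_measurable_of_abs_le
          ((hvm.stronglyMeasurable.integral_kernel (κ := G.stepKernel σ τ n)).measurable.comp
            (Preorder.measurable_frestrictLe n)) fun _ => abs_integral_le _ fun _ => hvR _
      have i2 : Integrable (fun h : ℕ → S × A × B => ∫ z, G.auxPayoff lam v z
          ∂(G.stepKernel σ τ n (Preorder.frestrictLe n h))) P :=
        integrable_of_measurable_of_abs_le
          ((hφ.stronglyMeasurable.integral_kernel (κ := G.stepKernel σ τ n)).measurable.comp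
            (Preorder.measurable_frestrictLe n)) fun _ => abs_integral_le _ hφR
      have : ∫ h, ∫ z, v z.1 ∂(G.stepKernel σ τ n (Preorder.frestrictLe n h)) ∂P - η =
          ∫ h, (∫ z, v z.1 ∂(G.stepKernel σ τ n (Preorder.frestrictLe n h)) - η) ∂P := by
        rw [integral_sub i1 (integrable_const _)]
        simp
      rw [this]
      refine integral_mono (i1.sub (integrable_const _)) i2 fun h => ?_
      simp only
      rw [integral_stepKernel G σ τ n _ hvm fun _ => hvR _,
        integral_stepKernel G σ τ n _ hφ hφR]
      simp only [stage']
      have m1 : Measurable fun s => ∫ z, G.auxPayoff lam v z ∂(stageKernel σ τ (n + 1)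
          (pastOfIic n (Preorder.frestrictLe (π := fun _ => S × A × B) n h), s)) :=
        (hφ.stronglyMeasurable.integral_kernel (κ := stageKernel σ τ (n + 1))).measurable.comp
          (by fun_prop)
      calc _ = ∫ s, (v s - η) ∂(G.transition (lastOfIic n (Preorder.frestrictLe n h))) := by
            rw [integral_sub (integrable_of_measurable_of_abs_le hv hvR) (integrable_const _)]
            simp
        _ ≤ _ := integral_mono
            ((integrable_of_measurable_of_abs_le hv hvR).sub (integrable_const _))
            (integrable_of_measurable_of_abs_le m1 fun _ => abs_integral_le _ hφR)
            fun s' => stage (n + 1) (pastOfIic n (Preorder.frestrictLe n h), s')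
  have step : ∀ n, ∫ h, v (h n).1 ∂P - η ≤
      lam * ∫ h, g (h n) ∂P + (1 - lam) * ∫ h, v (h (n + 1)).1 ∂P := fun n => by
    refine (now n).trans (le_of_eq ?_)
    unfold auxPayoff
    rw [integral_add ((intg n).const_mul _) ((intT n).const_mul _), integral_const_mul,
      integral_const_mul, next n]
  have init : ∫ h, v (h 0).1 ∂P = v s := by
    rw [integral_law_zero G s σ τ hvm, stage']
  -- The constant `η / lam` is the one for which the errors telescope, because `η / lam = η + (1 -
  -- lam) * (η / lam)`.
  have tele : ∀ n, v s - η / lam ≤ ∑ m ∈ Finset.range n, lam * (1 - lam) ^ m * ∫ h, g (h m) ∂P +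
      (1 - lam) ^ n * (∫ h, v (h n).1 ∂P - η / lam) := fun n => by
    induction n with
    | zero => simp [init]
    | succ n ih =>
      rw [Finset.sum_range_succ]
      have h1 : 0 ≤ (1 - lam) ^ n := pow_nonneg (by linarith) n
      have h2 := mul_le_mul_of_nonneg_left (step n) h1
      have h3 : lam * (η / lam) = η := by field_simp
      rw [pow_succ]
      nlinarith
  -- Sum and expectation are exchanged thanks to the geometric bound.
  have hsum : HasSum (fun m : ℕ => lam * (1 - lam) ^ m * ∫ h, g (h m) ∂P)
      (G.discountedPayoff lam s σ τ) := by
    have hbd : ∀ m (h : ℕ → S × A × B), ‖lam * (1 - lam) ^ m * g (h m)‖ ≤ lam * (1 - lam) ^ m * R := by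
      intro m h
      rw [norm_mul, Real.norm_of_nonneg (mul_nonneg hl0.le (pow_nonneg (by linarith) m))]
      exact mul_le_mul_of_nonneg_left (hgR _) (mul_nonneg hl0.le (pow_nonneg (by linarith) m))
    have hgeo : Summable fun m : ℕ => lam * (1 - lam) ^ m * R :=
      ((summable_geometric_of_lt_one (by linarith) (by linarith)).mul_left _).mul_right _
    have := hasSum_integral_of_summable_integral_norm (μ := P)
      (F := fun m h => lam * (1 - lam) ^ m * g (h m)) (fun m => (intg m).const_mul _) ?_
    · simp only [integral_const_mul] at this
      exact this
    · refine Summable.of_nonneg_of_le (fun m => integral_nonneg fun _ => norm_nonneg _)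
        (fun m => ?_) hgeo
      refine (integral_mono ((intg m).const_mul _).norm (integrable_const _) (hbd m)).trans ?_
      simp
  have lim1 : Filter.Tendsto (fun n : ℕ => (1 - lam) ^ n * (∫ h, v (h n).1 ∂P - η / lam))
      Filter.atTop (nhds 0) := by
    refine Filter.Tendsto.zero_mul_isBoundedUnder_le
      (tendsto_pow_atTop_nhds_zero_of_lt_one (by linarith) (by linarith)) ?_
    refine ⟨R + |η / lam|, Filter.eventually_map.2 (Filter.Eventually.of_forall fun n => ?_)⟩
    have : |∫ h, v (h n).1 ∂P| ≤ R := abs_integral_le P fun _ => hvR _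
    simp only [Function.comp, Real.norm_eq_abs]
    exact (abs_sub _ _).trans (by linarith)
  have := ge_of_tendsto' (hsum.tendsto_sum_nat.add lim1) tele
  simpa using this

/-- The game with opposite payoffs, for the same players. -/
def negPayoff (G : StochasticGame S A B) : StochasticGame S A B where
  transition := G.transition
  isMarkov := G.isMarkov
  payoff := fun s a b => -G.payoff s a b

lemma discountedPayoff_negPayoff (G : StochasticGame S A B) (lam : ℝ) (s : S)
    (σ : BehaviorStrategy S A B A) (τ : BehaviorStrategy S A B B) :
    G.negPayoff.discountedPayoff lam s σ τ = -G.discountedPayoff lam s σ τ := by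
  have : G.negPayoff.law s σ τ = G.law s σ τ := rfl
  unfold discountedPayoff
  rw [this, ← integral_neg]
  simp only [negPayoff, mul_neg, tsum_neg]

lemma auxPayoff_negPayoff (G : StochasticGame S A B) (lam : ℝ) (v : S → ℝ) (z : S × A × B) :
    G.negPayoff.auxPayoff lam (fun s => -v s) z = -G.auxPayoff lam v z := by
  simp only [auxPayoff, negPayoff, integral_neg]
  ring

/-- The strategy that plays according to the current state only. -/
def stationary {D : Type*} [MeasurableSpace D] (μ : Kernel S D) [IsMarkovKernel μ] :
    BehaviorStrategy S A B D where
  act _ := μ.comap Prod.snd measurable_snd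
  isMarkov _ := inferInstance

/-- A solution of Shapley's equation for which both players have nearly optimal measurable
stationary strategies is the value. -/
theorem isDiscountedValue_of_kernels (G : StochasticGame S A B) {lam : ℝ}
    (hlam : lam ∈ Set.Ioc (0 : ℝ) 1)
    (hg : Measurable fun z : S × A × B => G.payoff z.1 z.2.1 z.2.2) {R : ℝ}
    (hgR : ∀ z : S × A × B, |G.payoff z.1 z.2.1 z.2.2| ≤ R) {v : S → ℝ} (hv : Measurable v)
    (hvR : ∀ s, |v s| ≤ R)
    (h₁ : ∀ δ > 0, ∃ (μ : Kernel S A) (_ : IsMarkovKernel μ), ∀ s b,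
      v s - δ ≤ ∫ a, G.auxPayoff lam v (s, a, b) ∂(μ s))
    (h₂ : ∀ δ > 0, ∃ (ν : Kernel S B) (_ : IsMarkovKernel ν), ∀ s a,
      ∫ b, G.auxPayoff lam v (s, a, b) ∂(ν s) ≤ v s + δ) (s : S) :
    G.IsDiscountedValue lam s (v s) := by
  have hl0 := hlam.1
  have hl1 := hlam.2
  have hT : Measurable fun z : S × A × B => ∫ s, v s ∂(G.transition z) :=
    (hv.stronglyMeasurable.integral_kernel).measurable
  have hTR : ∀ z : S × A × B, |∫ s, v s ∂(G.transition z)| ≤ R := fun z => abs_integral_le _ hvR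
  have hφ : Measurable (G.auxPayoff lam v) := (hg.const_mul _).add (hT.const_mul _)
  have hφR : ∀ z, |G.auxPayoff lam v z| ≤ R := fun z => by
    have h1 := abs_le.1 (hgR z)
    have h2 := abs_le.1 (hTR z)
    unfold auxPayoff
    rw [abs_le]
    constructor <;> nlinarith
  have hφs : ∀ s, Measurable fun z : A × B => G.auxPayoff lam v (s, z) := fun s =>
    hφ.comp measurable_prodMk_left
  constructor
  · intro δ hδ
    -- An error per stage is divided by `lam` in the discounted payoff, hence the accuracy `δ *
    -- lam`.
    obtain ⟨μ, _, hμ⟩ := h₁ (δ * lam) (by positivity)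
    refine ⟨stationary μ, fun τ => ?_⟩
    have := le_discountedPayoff G hlam hg hgR hv hvR (stationary μ) τ (η := δ * lam) ?_ s
    · rwa [mul_div_assoc, div_self hl0.ne', mul_one] at this
    · intro n y
      rw [integral_prod_symm _ (integrable_of_measurable_of_abs_le (hφs _) fun _ => hφR _)]
      have hm : Measurable fun b => ∫ a, G.auxPayoff lam v (y.2, a, b) ∂((stationary
          (A := A) (B := B) μ).act n y) :=
        (hφs y.2).stronglyMeasurable.integral_prod_left.measurable
      calc v y.2 - δ * lam = ∫ _, (v y.2 - δ * lam) ∂(τ.act n y) := by simp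
        _ ≤ _ := integral_mono (integrable_const _)
            (integrable_of_measurable_of_abs_le hm fun b => abs_integral_le _ fun _ => hφR _)
            fun b => hμ y.2 b
  · intro δ hδ
    obtain ⟨ν, _, hν⟩ := h₂ (δ * lam) (by positivity)
    refine ⟨stationary ν, fun σ => ?_⟩
    -- The lower bound concerns a fixed pair of strategies, so negating the payoff gives Player 2's
    -- guarantee without exchanging the players.
    have := le_discountedPayoff G.negPayoff hlam (v := fun s => -v s) (R := R) hg.neg
      (fun z => by simpa [negPayoff] using hgR z) hv.neg (fun z => by simpa using hvR z) σ
      (stationary ν) (η := δ * lam) ?_ s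
    · rw [mul_div_assoc, div_self hl0.ne', mul_one, discountedPayoff_negPayoff] at this
      linarith
    · intro n y
      simp only [auxPayoff_negPayoff]
      rw [integral_neg, integral_prod _ (integrable_of_measurable_of_abs_le (hφs _) fun _ => hφR _)]
      have hm : Measurable fun a => ∫ b, G.auxPayoff lam v (y.2, a, b) ∂((stationary
          (A := A) (B := B) ν).act n y) :=
        (hφs y.2).stronglyMeasurable.integral_prod_right.measurable
      have : ∫ a, ∫ b, G.auxPayoff lam v (y.2, a, b) ∂((stationary (A := A) (B := B) ν).act n y)
          ∂(σ.act n y) ≤ ∫ _, (v y.2 + δ * lam) ∂(σ.act n y) :=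
        integral_mono
            (integrable_of_measurable_of_abs_le hm fun b => abs_integral_le _ fun _ => hφR _)
            (integrable_const _) fun a => hν y.2 a
      simp only [integral_const, probReal_univ, one_smul] at this
      linarith

end StochasticGame

end

/-! ### Measurable nearly optimal strategies and fixed points of contractions. -/

noncomputable section

lemma integral_finsum_dirac {β ι : Type*} [MeasurableSpace β] [MeasurableSingletonClass β]
    (s : Finset ι) {c : ι → ℝ} (f : ι → β) (h0 : ∀ i, 0 ≤ c i) (φ : β → ℝ) :
    ∫ z, φ z ∂(∑ i ∈ s, ENNReal.ofReal (c i) • Measure.dirac (f i)) = ∑ i ∈ s, c i * φ (f i) := by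
  rw [integral_finsetSum_measure fun i _ =>
    (integrable_dirac (by simp)).smul_measure ENNReal.ofReal_ne_top]
  refine Finset.sum_congr rfl fun i _ => ?_
  rw [integral_smul_measure, integral_dirac, ENNReal.toReal_ofReal (h0 i), smul_eq_mul]

lemma Secures.exists_measure {A B : Type*} [MeasurableSpace A] [MeasurableSingletonClass A]
    {F : A → B → ℝ} {c : ℝ} (h : Secures F c) :
    ∃ μ : Measure A, IsProbabilityMeasure μ ∧ ∀ b, c ≤ ∫ a, F a b ∂μ := by
  obtain ⟨ι, _, w, a, hw, hw1, hc⟩ := h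
  refine ⟨∑ t, ENNReal.ofReal (w t) • Measure.dirac (a t),
    isProbabilityMeasure_finsum_dirac _ hw hw1, fun b => ?_⟩
  rw [integral_finsum_dirac _ _ hw]
  exact hc b

/-- Nearly optimal mixed actions can be chosen measurably when the one-shot games are well
approximated by those over a discrete set of states. -/
lemma exists_kernel_of_secures {S A B T : Type*} [MeasurableSpace S] [MeasurableSpace A]
    [MeasurableSingletonClass A] [MeasurableSpace T] [DiscreteMeasurableSpace T] (F : S → A → B → ℝ) (v : S → ℝ)
    (hF : ∀ s, ∀ δ > 0, Secures (F s) (v s - δ))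
    (happ : ∀ δ > 0, ∃ (ι : S → T) (e : T → S), Measurable ι ∧
      ∀ s, |v s - v (e (ι s))| ≤ δ ∧ ∀ a b, |F s a b - F (e (ι s)) a b| ≤ δ)
    (hint : ∀ s b (μ : Measure A) [IsProbabilityMeasure μ], Integrable (fun a => F s a b) μ)
    {δ : ℝ} (hδ : 0 < δ) :
    ∃ (μ : Kernel S A) (_ : IsMarkovKernel μ), ∀ s b, v s - δ ≤ ∫ a, F s a b ∂(μ s) := by
  -- The three thirds are the change of `v` between a state and its representative, the
  -- suboptimality at the representative, and the change of the payoff.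
  obtain ⟨ι, e, hι, h⟩ := happ (δ / 3) (by positivity)
  choose μ hμ hsec using fun s => (hF s (δ / 3) (by positivity)).exists_measure
  -- The choice of `μ` is arbitrary, but it is used only through an index in a discrete space.
  have hm : Measurable fun s => μ (e (ι s)) :=
    (Measurable.of_discrete (f := fun n => μ (e n))).comp hι
  refine ⟨⟨fun s => μ (e (ι s)), hm⟩, ⟨fun s => hμ _⟩, fun s b => ?_⟩
  have h1 := hsec (e (ι s)) b
  have h2 := abs_le.1 (h s).1
  have h3 : ∫ a, F (e (ι s)) a b ∂(μ (e (ι s))) ≤ ∫ a, (F s a b + δ / 3) ∂(μ (e (ι s))) :=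
    integral_mono (hint _ _ _) ((hint _ _ _).add (integrable_const _)) fun a => by
      have := abs_le.1 ((h s).2 a b)
      simp only
      linarith
  rw [integral_add (hint _ _ _) (integrable_const _)] at h3
  simp only [integral_const, probReal_univ, one_smul] at h3
  change v s - δ ≤ ∫ a, F s a b ∂(μ (e (ι s)))
  linarith

namespace StochasticGame

variable {S A B : Type*} [MeasurableSpace S] [MeasurableSpace A] [MeasurableSpace B]
  [MeasurableSingletonClass A] [MeasurableSingletonClass B]

/-- A bounded measurable solution of Shapley's equation is the value of the discounted game,
provided the one-shot games are well approximated by those over a discrete set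
of states. -/
theorem isDiscountedValue_of_isMixedValue {T : Type*} [MeasurableSpace T]
    [DiscreteMeasurableSpace T] (G : StochasticGame S A B) {lam : ℝ}
    (hlam : lam ∈ Set.Ioc (0 : ℝ) 1)
    (hg : Measurable fun z : S × A × B => G.payoff z.1 z.2.1 z.2.2) {R : ℝ}
    (hgR : ∀ z : S × A × B, |G.payoff z.1 z.2.1 z.2.2| ≤ R) {v : S → ℝ} (hv : Measurable v)
    (hvR : ∀ s, |v s| ≤ R)
    (hval : ∀ s, IsMixedValue (fun a b => G.auxPayoff lam v (s, a, b)) (v s))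
    (happ : ∀ δ > 0, ∃ (ι : S → T) (e : T → S), Measurable ι ∧
      ∀ s, |v s - v (e (ι s))| ≤ δ ∧
        ∀ a b, |G.auxPayoff lam v (s, a, b) - G.auxPayoff lam v (e (ι s), a, b)| ≤ δ) (s : S) :
    G.IsDiscountedValue lam s (v s) := by
  have hT : Measurable fun z : S × A × B => ∫ s, v s ∂(G.transition z) :=
    (hv.stronglyMeasurable.integral_kernel).measurable
  have hTR : ∀ z : S × A × B, |∫ s, v s ∂(G.transition z)| ≤ R := fun z => abs_integral_le _ hvR
  have hφ : Measurable (G.auxPayoff lam v) := (hg.const_mul _).add (hT.const_mul _)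
  have hφR : ∀ z, |G.auxPayoff lam v z| ≤ R := fun z => by
    have h1 := abs_le.1 (hgR z)
    have h2 := abs_le.1 (hTR z)
    have hl0 := hlam.1
    have hl1 := hlam.2
    unfold auxPayoff
    rw [abs_le]
    constructor <;> nlinarith
  refine G.isDiscountedValue_of_kernels hlam hg hgR hv hvR (fun δ hδ => ?_) (fun δ hδ => ?_) s
  · refine exists_kernel_of_secures (fun s a b => G.auxPayoff lam v (s, a, b)) v
      (fun s => (hval s).1) happ (fun s b μ _ => ?_) hδ
    exact integrable_of_measurable_of_abs_le (hφ.comp (by fun_prop)) fun _ => hφR _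
  · have happ' : ∀ δ > 0, ∃ (ι : S → T) (e : T → S), Measurable ι ∧
        ∀ s, |-v s - -v (e (ι s))| ≤ δ ∧
          ∀ b a, |-G.auxPayoff lam v (s, a, b) - -G.auxPayoff lam v (e (ι s), a, b)| ≤ δ := by
      intro δ hδ
      obtain ⟨ι, e, hι, h⟩ := happ δ hδ
      refine ⟨ι, e, hι, fun s => ⟨?_, fun b a => ?_⟩⟩
      · rw [neg_sub_neg, abs_sub_comm]
        exact (h s).1
      · rw [neg_sub_neg, abs_sub_comm]
        exact (h s).2 a b
    obtain ⟨ν, hν, h⟩ := exists_kernel_of_secures (fun s b a => -G.auxPayoff lam v (s, a, b))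
      (fun s => -v s) (fun s => (hval s).2) happ' (fun s a ν _ =>
        (integrable_of_measurable_of_abs_le (hφ.comp (by fun_prop)) fun _ => hφR _).neg) hδ
    refine ⟨ν, hν, fun s a => ?_⟩
    have := h s a
    rw [integral_neg] at this
    linarith

end StochasticGame

/-- Banach's fixed point theorem for operators that contract the supremum distance on a class of
uniformly bounded functions closed under pointwise limits. -/
lemma exists_fixedPoint_of_contraction {X : Type*} (C : Set (X → ℝ)) (T : (X → ℝ) → X → ℝ)
    {R c : ℝ} (hc0 : 0 ≤ c) (hc1 : c < 1) (hne : C.Nonempty) (hbd : ∀ f ∈ C, ∀ x, |f x| ≤ R)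
    (hclosed : ∀ (u : ℕ → X → ℝ) (f : X → ℝ), (∀ n, u n ∈ C) →
      (∀ x, Filter.Tendsto (fun n => u n x) Filter.atTop (nhds (f x))) → f ∈ C)
    (hT : ∀ f ∈ C, T f ∈ C)
    (hcontr : ∀ f ∈ C, ∀ g ∈ C, ∀ d, (∀ x, |f x - g x| ≤ d) → ∀ x, |T f x - T g x| ≤ c * d) :
    ∃ f ∈ C, T f = f := by
  obtain ⟨f₀, hf₀⟩ := hne
  let u : ℕ → X → ℝ := fun n => T^[n] f₀
  have hu : ∀ n, u n ∈ C := fun n => by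
    induction n with
    | zero => exact hf₀
    | succ n ih => simp only [u, Function.iterate_succ_apply']; exact hT _ ih
  have husucc : ∀ n, u (n + 1) = T (u n) := fun n => by
    simp only [u, Function.iterate_succ_apply']
  have hstep : ∀ n x, |u n x - u (n + 1) x| ≤ 2 * R * c ^ n := fun n => by
    induction n with
    | zero =>
      intro x
      have h1 := abs_le.1 (hbd _ (hu 0) x)
      have h2 := abs_le.1 (hbd _ (hu 1) x)
      rw [abs_le]
      constructor <;> simp only [pow_zero, mul_one, zero_add] <;> linarith
    | succ n ih =>
      intro x
      rw [husucc n, husucc (n + 1)]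
      refine (hcontr _ (hu n) _ (hu (n + 1)) _ ih x).trans (le_of_eq ?_)
      ring
  have hcau : ∀ x, CauchySeq fun n => u n x := fun x =>
    cauchySeq_of_le_geometric c (2 * R) hc1 fun n => hstep n x
  choose f hf using fun x => cauchySeq_tendsto_of_complete (hcau x)
  have hfC : f ∈ C := hclosed u f hu hf
  have hdist : ∀ n x, |u n x - f x| ≤ 2 * R * c ^ n / (1 - c) := fun n x =>
    dist_le_of_le_geometric_of_tendsto c (2 * R) hc1 (fun n => hstep n x) (hf x) n
  refine ⟨f, hfC, funext fun x => ?_⟩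
  -- The iterates, shifted by one, also converge to `T f`, since `T` contracts their distance to
  -- `f`.
  refine tendsto_nhds_unique ?_ (hf x)
  rw [← Filter.tendsto_add_atTop_iff_nat 1]
  have hlim : Filter.Tendsto (fun n : ℕ => c * (2 * R * c ^ n / (1 - c))) Filter.atTop (nhds 0) := by
    have := ((((tendsto_pow_atTop_nhds_zero_of_lt_one hc0 hc1).const_mul (2 * R)).div_const
      (1 - c)).const_mul c)
    simpa using this
  rw [tendsto_iff_dist_tendsto_zero]
  refine squeeze_zero (fun _ => dist_nonneg) (fun n => ?_) hlim
  rw [husucc]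
  exact hcontr _ (hu n) _ hfC _ (hdist n) x

end

noncomputable section

set_option linter.unusedSectionVars false

/-! ## The one-shot games of the belief game and of the triangulated game -/

section Beliefs

variable {K I : Type*} [Fintype K] [Fintype I]

/-- The unnormalized posterior is the joint law of type and action. As the identity survives at
probability zero, the conventional posterior at null actions plays no role in what is derived from
it. -/
lemma actionProb_mul_posteriorBelief (p : stdSimplex ℝ K) (x : MixedAction K I) (i : I) (k : K) :
    actionProb p x i * posteriorBelief p x i k = p k * x k i := by
  by_cases h : actionProb p x i = 0
  · rw [h, zero_mul]
    exact ((Finset.sum_eq_zero_iff_of_nonneg fun k _ => mul_nonneg (p.2.1 k) ((x k).2.1 i)).1 h k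
      (Finset.mem_univ k)).symm
  · have : posteriorBelief p x i k = x k i * p k / actionProb p x i := by
      unfold posteriorBelief
      rw [dif_neg h]
      rfl
    rw [this]
    field_simp

lemma posteriorBelief_eq_of_mul_eq {p r : stdSimplex ℝ K} {x : MixedAction K I} {i : I}
    (h : actionProb p x i ≠ 0) (hr : ∀ k, actionProb p x i * r k = p k * x k i) :
    posteriorBelief p x i = r := by
  refine stdSimplex.ext (funext fun k => mul_left_cancel₀ h ?_)
  rw [actionProb_mul_posteriorBelief, hr]

lemma sum_actionProb_mul_posteriorBelief (p : stdSimplex ℝ K) (x : MixedAction K I) (k : K) :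
    ∑ i, actionProb p x i * posteriorBelief p x i k = p k := by
  simp_rw [actionProb_mul_posteriorBelief, ← Finset.mul_sum, stdSimplex.sum_eq_one, mul_one]

lemma continuous_stdSimplex_apply (k : K) : Continuous fun p : stdSimplex ℝ K => p k :=
  (continuous_apply k).comp continuous_subtype_val

lemma continuous_actionProb (i : I) :
    Continuous fun z : stdSimplex ℝ K × MixedAction K I => actionProb z.1 z.2 i := by
  unfold actionProb
  refine continuous_finsetSum _ fun k _ => ?_
  exact ((continuous_stdSimplex_apply k).comp continuous_fst).mul
    ((continuous_stdSimplex_apply i).comp ((continuous_apply k).comp continuous_snd))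

lemma continuousAt_posteriorBelief (i : I) {z : stdSimplex ℝ K × MixedAction K I}
    (hz : actionProb z.1 z.2 i ≠ 0) :
    ContinuousAt (fun z : stdSimplex ℝ K × MixedAction K I => posteriorBelief z.1 z.2 i) z := by
  rw [Topology.IsInducing.subtypeVal.continuousAt_iff, continuousAt_pi]
  intro k
  have h1 : ∀ᶠ z' in nhds z, actionProb z'.1 z'.2 i ≠ 0 :=
    (continuous_actionProb i).continuousAt.eventually_ne hz
  have h2 : ContinuousAt (fun z : stdSimplex ℝ K × MixedAction K I =>
      z.1 k * z.2 k i / actionProb z.1 z.2 i) z :=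
    ((((continuous_stdSimplex_apply k).comp continuous_fst).mul
      ((continuous_stdSimplex_apply i).comp
        ((continuous_apply k).comp continuous_snd))).continuousAt).div
      (continuous_actionProb i).continuousAt hz
  refine h2.congr (h1.mono fun z' hz' => ?_)
  simp only
  rw [← actionProb_mul_posteriorBelief, mul_div_cancel_left₀ _ hz']
  rfl

end Beliefs

namespace IncompleteInfoGame

variable {K L Ω I J : Type*} [Fintype K] [Fintype L] [Fintype Ω] [Fintype I] [Fintype J]

/-- The payoff of the one-shot game with continuation payoff `f`. -/
def oneShot (Γ : IncompleteInfoGame K L Ω I J) (lam : ℝ)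
    (f : stdSimplex ℝ K → stdSimplex ℝ L → Ω → ℝ) (p : stdSimplex ℝ K) (q : stdSimplex ℝ L) (ω : Ω)
    (x : MixedAction K I) (y : MixedAction L J) : ℝ :=
  lam * Γ.beliefPayoff p q ω x y + (1 - lam) * ∑ t, Γ.outcomeProb p q ω x y t *
    f (posteriorBelief p x t.1) (posteriorBelief q y t.2.1) t.2.2

lemma sum_outcomeProb_mul (Γ : IncompleteInfoGame K L Ω I J) (p : stdSimplex ℝ K)
    (q : stdSimplex ℝ L) (ω : Ω) (x : MixedAction K I) (y : MixedAction L J) (F : I → J → Ω → ℝ) :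
    ∑ t, Γ.outcomeProb p q ω x y t * F t.1 t.2.1 t.2.2 =
      ∑ j, actionProb q y j * ∑ i, actionProb p x i * ∑ ω', Γ.ρ ω i j ω' * F i j ω' := by
  simp only [outcomeProb, Fintype.sum_prod_type, Finset.mul_sum]
  rw [Finset.sum_comm]
  exact Finset.sum_congr rfl fun j _ => Finset.sum_congr rfl fun i _ =>
    Finset.sum_congr rfl fun ω' _ => by ring

lemma oneShot_eq (Γ : IncompleteInfoGame K L Ω I J) (lam : ℝ)
    (f : stdSimplex ℝ K → stdSimplex ℝ L → Ω → ℝ) (p : stdSimplex ℝ K) (q : stdSimplex ℝ L) (ω : Ω)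
    (x : MixedAction K I) (y : MixedAction L J) :
    Γ.oneShot lam f p q ω x y = lam * Γ.beliefPayoff p q ω x y + (1 - lam) *
      ∑ j, actionProb q y j * ∑ i, actionProb p x i * ∑ ω', Γ.ρ ω i j ω' *
        f (posteriorBelief p x i) (posteriorBelief q y j) ω' := by
  rw [oneShot, Γ.sum_outcomeProb_mul p q ω x y
    fun i j ω' => f (posteriorBelief p x i) (posteriorBelief q y j) ω']

lemma oneShot_le_add (Γ : IncompleteInfoGame K L Ω I J) {lam : ℝ} (h1 : lam ≤ 1)
    {f f' : stdSimplex ℝ K → stdSimplex ℝ L → Ω → ℝ} {d : ℝ} (h : ∀ p q ω, f p q ω ≤ f' p q ω + d)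
    (p : stdSimplex ℝ K) (q : stdSimplex ℝ L) (ω : Ω) (x : MixedAction K I) (y : MixedAction L J) :
    Γ.oneShot lam f p q ω x y ≤ Γ.oneShot lam f' p q ω x y + (1 - lam) * d := by
  have : ∑ t, Γ.outcomeProb p q ω x y t *
      f (posteriorBelief p x t.1) (posteriorBelief q y t.2.1) t.2.2 ≤ ∑ t, Γ.outcomeProb p q ω x y t *
      (f' (posteriorBelief p x t.1) (posteriorBelief q y t.2.1) t.2.2 + d) :=
    Finset.sum_le_sum fun t _ => mul_le_mul_of_nonneg_left (h _ _ _)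
      (Γ.outcomeProb_nonneg p q ω x y t)
  rw [sum_mul_add_const (Γ.sum_outcomeProb p q ω x y)] at this
  unfold oneShot
  nlinarith

lemma beliefPayoff_eq (Γ : IncompleteInfoGame K L Ω I J) (p : stdSimplex ℝ K)
    (q : stdSimplex ℝ L) (ω : Ω) (x : MixedAction K I) (y : MixedAction L J) :
    Γ.beliefPayoff p q ω x y =
      ∑ k, ∑ i, p k * x k i * ∑ l, ∑ j, q l * y l j * Γ.g k l ω i j := by
  unfold beliefPayoff
  refine Finset.sum_congr rfl fun k _ => ?_
  rw [Finset.sum_comm]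
  refine Finset.sum_congr rfl fun i _ => ?_
  rw [Finset.mul_sum]
  refine Finset.sum_congr rfl fun l _ => ?_
  rw [Finset.mul_sum]
  exact Finset.sum_congr rfl fun j _ => by ring

lemma abs_sum_mul_le {ι : Type*} [Fintype ι] {w f : ι → ℝ} {N : ℝ} (hw : ∀ i, 0 ≤ w i)
    (hw1 : ∑ i, w i = 1) (hf : ∀ i, |f i| ≤ N) : |∑ i, w i * f i| ≤ N := by
  refine (Finset.abs_sum_le_sum_abs _ _).trans ?_
  calc ∑ i, |w i * f i| ≤ ∑ i, w i * N := Finset.sum_le_sum fun i _ => by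
        rw [abs_mul, abs_of_nonneg (hw i)]
        exact mul_le_mul_of_nonneg_left (hf i) (hw i)
    _ = N := by rw [← Finset.sum_mul, hw1, one_mul]

/-- The expected payoff given the type and action of Player 1. -/
lemma abs_innerPayoff_le (Γ : IncompleteInfoGame K L Ω I J) {N : ℝ}
    (hN : ∀ k l ω i j, |Γ.g k l ω i j| ≤ N) (q : stdSimplex ℝ L) (ω : Ω) (y : MixedAction L J) (k : K)
    (i : I) : |∑ l, ∑ j, q l * y l j * Γ.g k l ω i j| ≤ N := by
  have : ∑ l, ∑ j, q l * y l j * Γ.g k l ω i j = ∑ l, q l * ∑ j, y l j * Γ.g k l ω i j := by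
    simp only [Finset.mul_sum, mul_assoc]
  rw [this]
  exact abs_sum_mul_le q.2.1 q.2.2 fun l => abs_sum_mul_le (y l).2.1 (y l).2.2 fun j => hN _ _ _ _ _

lemma abs_beliefPayoff_le (Γ : IncompleteInfoGame K L Ω I J) {N : ℝ}
    (hN : ∀ k l ω i j, |Γ.g k l ω i j| ≤ N) (p : stdSimplex ℝ K) (q : stdSimplex ℝ L) (ω : Ω)
    (x : MixedAction K I) (y : MixedAction L J) : |Γ.beliefPayoff p q ω x y| ≤ N := by
  rw [beliefPayoff_eq]
  simp only [mul_assoc, ← Finset.mul_sum]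
  exact abs_sum_mul_le p.2.1 p.2.2 fun k => abs_sum_mul_le (x k).2.1 (x k).2.2 fun i => by
    simpa only [mul_assoc, Finset.mul_sum] using Γ.abs_innerPayoff_le hN q ω y k i

lemma sum_sum_mul_sub_le {ι κ : Type*} [Fintype ι] [Fintype κ] {a a' b : ι → κ → ℝ} {N : ℝ}
    (hb : ∀ i j, |b i j| ≤ N) (s t : ℝ) :
    s * ∑ i, ∑ j, a i j * b i j - t * ∑ i, ∑ j, a' i j * b i j ≤
      N * ∑ i, ∑ j, |s * a i j - t * a' i j| := by
  simp only [Finset.mul_sum, ← Finset.sum_sub_distrib]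
  refine Finset.sum_le_sum fun i _ => Finset.sum_le_sum fun j _ => ?_
  calc _ = (s * a i j - t * a' i j) * b i j := by ring
    _ ≤ |(s * a i j - t * a' i j) * b i j| := le_abs_self _
    _ ≤ _ := by
      rw [abs_mul, mul_comm N]
      exact mul_le_mul_of_nonneg_left (hb _ _) (abs_nonneg _)

/-- Comparison of stage payoffs for two joint laws of the type and action of Player 1. -/
lemma beliefPayoff_sub_le (Γ : IncompleteInfoGame K L Ω I J) {N : ℝ}
    (hN : ∀ k l ω i j, |Γ.g k l ω i j| ≤ N) (p p' : stdSimplex ℝ K) (q : stdSimplex ℝ L) (ω : Ω)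
    (x x' : MixedAction K I) (y : MixedAction L J) (s t : ℝ) :
    s * Γ.beliefPayoff p q ω x y - t * Γ.beliefPayoff p' q ω x' y ≤
      N * ∑ k, ∑ i, |s * (p k * x k i) - t * (p' k * x' k i)| := by
  rw [beliefPayoff_eq, beliefPayoff_eq]
  exact sum_sum_mul_sub_le (fun k i => Γ.abs_innerPayoff_le hN q ω y k i) s t

/-- The same game with the roles of the players exchanged. -/
def swap (Γ : IncompleteInfoGame K L Ω I J) : IncompleteInfoGame L K Ω J I where
  ρ ω j i := Γ.ρ ω i j
  g l k ω j i := -Γ.g k l ω i j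

/-- A payoff function seen from the other player. -/
def swapFun (f : stdSimplex ℝ K → stdSimplex ℝ L → Ω → ℝ) :
    stdSimplex ℝ L → stdSimplex ℝ K → Ω → ℝ := fun q p ω => -f p q ω

lemma beliefPayoff_swap (Γ : IncompleteInfoGame K L Ω I J) (p : stdSimplex ℝ K)
    (q : stdSimplex ℝ L) (ω : Ω) (x : MixedAction K I) (y : MixedAction L J) :
    Γ.swap.beliefPayoff q p ω y x = -Γ.beliefPayoff p q ω x y := by
  simp only [beliefPayoff, swap, ← Finset.sum_neg_distrib]
  rw [Finset.sum_comm]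
  refine Finset.sum_congr rfl fun k _ => Finset.sum_congr rfl fun l _ => ?_
  rw [Finset.sum_comm]
  exact Finset.sum_congr rfl fun i _ => Finset.sum_congr rfl fun j _ => by ring

lemma oneShot_swap (Γ : IncompleteInfoGame K L Ω I J) (lam : ℝ)
    (f : stdSimplex ℝ K → stdSimplex ℝ L → Ω → ℝ) (p : stdSimplex ℝ K) (q : stdSimplex ℝ L) (ω : Ω)
    (x : MixedAction K I) (y : MixedAction L J) :
    Γ.swap.oneShot lam (swapFun f) q p ω y x = -Γ.oneShot lam f p q ω x y := by
  rw [oneShot_eq, oneShot_eq, beliefPayoff_swap]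
  have : ∑ i, actionProb p x i * ∑ j, actionProb q y j * ∑ ω', Γ.swap.ρ ω j i ω' *
        swapFun f (posteriorBelief q y j) (posteriorBelief p x i) ω' =
      -∑ j, actionProb q y j * ∑ i, actionProb p x i * ∑ ω', Γ.ρ ω i j ω' *
        f (posteriorBelief p x i) (posteriorBelief q y j) ω' := by
    simp only [Finset.mul_sum, ← Finset.sum_neg_distrib]
    rw [Finset.sum_comm]
    refine Finset.sum_congr rfl fun j _ => Finset.sum_congr rfl fun i _ =>
      Finset.sum_congr rfl fun ω' _ => ?_
    simp only [swap, swapFun]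
    ring
  rw [this]
  ring

lemma IsAbsorbing.swap {Γ : IncompleteInfoGame K L Ω I J} {ω : Ω} (h : Γ.IsAbsorbing ω) :
    Γ.swap.IsAbsorbing ω :=
  ⟨fun l k j i j' i' => by simp only [IncompleteInfoGame.swap, h.1 k l i j i' j'],
    fun j i => h.2 i j⟩

/-- The expected payoff when the actions `i` and `j` are played irrespective of the types. -/
def constPayoff (Γ : IncompleteInfoGame K L Ω I J) (i : I) (j : J) (p : stdSimplex ℝ K)
    (q : stdSimplex ℝ L) (ω : Ω) : ℝ :=
  ∑ k, p k * ∑ l, q l * Γ.g k l ω i j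

lemma constPayoff_swap (Γ : IncompleteInfoGame K L Ω I J) (i : I) (j : J) (p : stdSimplex ℝ K)
    (q : stdSimplex ℝ L) (ω : Ω) :
    Γ.swap.constPayoff j i q p ω = -Γ.constPayoff i j p q ω := by
  simp only [constPayoff, swap, ← Finset.sum_neg_distrib, Finset.mul_sum]
  rw [Finset.sum_comm]
  exact Finset.sum_congr rfl fun k _ => Finset.sum_congr rfl fun l _ => by ring

lemma constPayoff_sub_le (Γ : IncompleteInfoGame K L Ω I J) {N : ℝ}
    (hN : ∀ k l ω i j, |Γ.g k l ω i j| ≤ N) (i : I) (j : J) (p p' : stdSimplex ℝ K)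
    (q : stdSimplex ℝ L) (ω : Ω) (s t : ℝ) :
    s * Γ.constPayoff i j p q ω - t * Γ.constPayoff i j p' q ω ≤ N * ∑ k, |s * p k - t * p' k| := by
  simp only [constPayoff, Finset.mul_sum (a := s), Finset.mul_sum (a := t),
    ← Finset.sum_sub_distrib, Finset.mul_sum (a := N)]
  refine Finset.sum_le_sum fun k _ => ?_
  calc _ = (s * p k - t * p' k) * ∑ l, q l * Γ.g k l ω i j := by ring
    _ ≤ |(s * p k - t * p' k) * ∑ l, q l * Γ.g k l ω i j| := le_abs_self _
    _ ≤ _ := by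
      rw [abs_mul, mul_comm N]
      exact mul_le_mul_of_nonneg_left (abs_sum_mul_le q.2.1 q.2.2 fun _ => hN _ _ _ _ _)
        (abs_nonneg _)

/-- `constPayoff` is linear in each belief, so it depends only on the barycentre of weighted
beliefs. -/
lemma sum_mul_constPayoff_left (Γ : IncompleteInfoGame K L Ω I J) (i : I) (j : J) {ι : Type*}
    [Fintype ι] (c : ι → ℝ) (P : ι → stdSimplex ℝ K) (r : ℝ) (p : stdSimplex ℝ K)
    (h : ∀ k, ∑ t, c t * P t k = r * p k) (q : stdSimplex ℝ L) (ω : Ω) :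
    ∑ t, c t * Γ.constPayoff i j (P t) q ω = r * Γ.constPayoff i j p q ω := by
  simp only [constPayoff, Finset.mul_sum (a := r), ← mul_assoc, ← h, Finset.sum_mul,
    Finset.mul_sum (s := Finset.univ (α := K))]
  rw [Finset.sum_comm]

lemma sum_mul_constPayoff_right (Γ : IncompleteInfoGame K L Ω I J) (i : I) (j : J) {ι : Type*}
    [Fintype ι] (c : ι → ℝ) (Q : ι → stdSimplex ℝ L) (r : ℝ) (q : stdSimplex ℝ L)
    (h : ∀ l, ∑ t, c t * Q t l = r * q l) (p : stdSimplex ℝ K) (ω : Ω) :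
    ∑ t, c t * Γ.constPayoff i j p (Q t) ω = r * Γ.constPayoff i j p q ω := by
  have := Γ.swap.sum_mul_constPayoff_left j i c Q r q h p ω
  simpa only [constPayoff_swap, mul_neg, Finset.sum_neg_distrib, neg_inj] using this

lemma IsAbsorbing.beliefPayoff_eq_constPayoff {Γ : IncompleteInfoGame K L Ω I J} {ω : Ω}
    (h : Γ.IsAbsorbing ω) (i₀ : I) (j₀ : J) (p : stdSimplex ℝ K) (q : stdSimplex ℝ L)
    (x : MixedAction K I) (y : MixedAction L J) :
    Γ.beliefPayoff p q ω x y = Γ.constPayoff i₀ j₀ p q ω := by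
  rw [beliefPayoff_eq, constPayoff]
  refine Finset.sum_congr rfl fun k _ => ?_
  have : ∀ i, ∑ l, ∑ j, q l * y l j * Γ.g k l ω i j = ∑ l, q l * Γ.g k l ω i₀ j₀ := fun i =>
    Finset.sum_congr rfl fun l _ => by
      simp only [h.1 k l i _ i₀ j₀, mul_assoc, ← Finset.mul_sum, ← Finset.sum_mul,
        stdSimplex.sum_eq_one, one_mul]
  simp only [this]
  rw [← Finset.sum_mul, ← Finset.mul_sum, stdSimplex.sum_eq_one, mul_one]

lemma IsAbsorbing.ρ_eq_zero {Γ : IncompleteInfoGame K L Ω I J} {ω ω' : Ω}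
    (h : Γ.IsAbsorbing ω) (i : I) (j : J) (hne : ω' ≠ ω) : Γ.ρ ω i j ω' = 0 := by
  classical
  have h1 := stdSimplex.sum_eq_one (Γ.ρ ω i j)
  rw [← Finset.add_sum_erase _ _ (Finset.mem_univ ω), h.2 i j] at h1
  have h2 : ∑ z ∈ Finset.univ.erase ω, Γ.ρ ω i j z = 0 := by linarith
  exact (Finset.sum_eq_zero_iff_of_nonneg fun z _ => (Γ.ρ ω i j).2.1 z).1 h2 ω' (by simp [hne])

/-- Posteriors average to the prior and the absorbing payoff is bilinear in the beliefs: it is a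
martingale, and it solves Shapley's equation whatever is played. -/
lemma IsAbsorbing.oneShot_eq_constPayoff {Γ : IncompleteInfoGame K L Ω I J} {ω : Ω}
    (h : Γ.IsAbsorbing ω) (i₀ : I) (j₀ : J) (lam : ℝ) {f : stdSimplex ℝ K → stdSimplex ℝ L → Ω → ℝ}
    (hf : ∀ p q, f p q ω = Γ.constPayoff i₀ j₀ p q ω) (p : stdSimplex ℝ K) (q : stdSimplex ℝ L)
    (x : MixedAction K I) (y : MixedAction L J) :
    Γ.oneShot lam f p q ω x y = Γ.constPayoff i₀ j₀ p q ω := by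
  rw [oneShot_eq, h.beliefPayoff_eq_constPayoff i₀ j₀]
  have h1 : ∀ i j, ∑ ω', Γ.ρ ω i j ω' * f (posteriorBelief p x i) (posteriorBelief q y j) ω' =
      Γ.constPayoff i₀ j₀ (posteriorBelief p x i) (posteriorBelief q y j) ω := fun i j => by
    rw [Finset.sum_eq_single ω, h.2 i j, one_mul, hf]
    · intro ω' _ hne
      rw [h.ρ_eq_zero i j hne, zero_mul]
    · simp
  simp only [h1]
  have h2 : ∀ j, ∑ i, actionProb p x i * Γ.constPayoff i₀ j₀ (posteriorBelief p x i)
      (posteriorBelief q y j) ω = 1 * Γ.constPayoff i₀ j₀ p (posteriorBelief q y j) ω := fun j =>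
    Γ.sum_mul_constPayoff_left i₀ j₀ _ _ 1 p
      (fun k => by rw [one_mul, sum_actionProb_mul_posteriorBelief]) _ _
  simp only [h2, one_mul]
  have h3 := Γ.sum_mul_constPayoff_right i₀ j₀ (actionProb q y) (posteriorBelief q y) 1 q
      (fun k => by rw [one_mul, sum_actionProb_mul_posteriorBelief]) p ω
  rw [h3]
  ring

end IncompleteInfoGame

end

/-! ### Continuity of the one-shot games and regularity of their values. -/

noncomputable section

set_option linter.unusedSectionVars false

section Beliefs

variable {K I : Type*} [Fintype K] [Fintype I]

/-- A joint law of types and actions is induced by a mixed action. -/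
lemma exists_mixedAction_of_joint [Nonempty I] (p : stdSimplex ℝ K) (M : I → K → ℝ)
    (h0 : ∀ i k, 0 ≤ M i k) (hM : ∀ k, ∑ i, M i k = p k) :
    ∃ x : MixedAction K I, ∀ k i, p k * x k i = M i k := by
  classical
  have : ∀ k, ∃ y : stdSimplex ℝ I, ∀ i, p k * y i = M i k := by
    intro k
    by_cases hk : p k = 0
    · refine ⟨Classical.arbitrary _, fun i => ?_⟩
      have := hM k
      rw [hk, Finset.sum_eq_zero_iff_of_nonneg fun i _ => h0 i k] at this
      rw [hk, zero_mul, this i (Finset.mem_univ i)]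
    · refine ⟨⟨fun i => M i k / p k, fun i => div_nonneg (h0 i k) (p.2.1 k), ?_⟩, fun i => ?_⟩
      · rw [← Finset.sum_div, hM, div_self hk]
      · change p k * (M i k / p k) = M i k
        field_simp
  choose x hx using this
  exact ⟨x, hx⟩

end Beliefs

namespace IncompleteInfoGame

variable {K L Ω I J : Type*} [Fintype K] [Fintype L] [Fintype Ω] [Fintype I] [Fintype J]

/-- A posterior may jump where its action has probability zero, but there the weight tends to zero
while `f` stays bounded. -/
lemma continuous_actionProb_mul (i : I) (j : J) {f : stdSimplex ℝ K → stdSimplex ℝ L → ℝ}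
    (hf : Continuous fun z : stdSimplex ℝ K × stdSimplex ℝ L => f z.1 z.2) :
    Continuous fun z : (stdSimplex ℝ K × stdSimplex ℝ L) × (MixedAction K I × MixedAction L J) =>
      actionProb z.1.1 z.2.1 i * actionProb z.1.2 z.2.2 j *
        f (posteriorBelief z.1.1 z.2.1 i) (posteriorBelief z.1.2 z.2.2 j) := by
  obtain ⟨R, hR⟩ : ∃ R, ∀ p q, |f p q| ≤ R := by
    obtain ⟨R, hR⟩ := isCompact_univ.exists_bound_of_continuousOn hf.continuousOn
    exact ⟨R, fun p q => hR (p, q) trivial⟩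
  have ca : Continuous fun z : (stdSimplex ℝ K × stdSimplex ℝ L) × (MixedAction K I × MixedAction L J)
      => actionProb z.1.1 z.2.1 i * actionProb z.1.2 z.2.2 j :=
    ((continuous_actionProb i).comp (f := fun z : (stdSimplex ℝ K × stdSimplex ℝ L) ×
      (MixedAction K I × MixedAction L J) => (z.1.1, z.2.1)) (by fun_prop)).mul
      ((continuous_actionProb j).comp (f := fun z : (stdSimplex ℝ K × stdSimplex ℝ L) ×
      (MixedAction K I × MixedAction L J) => (z.1.2, z.2.2)) (by fun_prop))
  rw [continuous_iff_continuousAt]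
  intro z
  by_cases hz : actionProb z.1.1 z.2.1 i * actionProb z.1.2 z.2.2 j = 0
  · change Filter.Tendsto _ _ (nhds (actionProb z.1.1 z.2.1 i * actionProb z.1.2 z.2.2 j *
      f (posteriorBelief z.1.1 z.2.1 i) (posteriorBelief z.1.2 z.2.2 j)))
    rw [hz, zero_mul]
    have h0 : Filter.Tendsto (fun z : (stdSimplex ℝ K × stdSimplex ℝ L) ×
        (MixedAction K I × MixedAction L J) => actionProb z.1.1 z.2.1 i * actionProb z.1.2 z.2.2 j)
        (nhds z) (nhds 0) := by
      have := ca.tendsto z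
      rwa [hz] at this
    exact h0.zero_mul_isBoundedUnder_le
      ⟨R, Filter.eventually_map.2 (Filter.Eventually.of_forall fun _ => hR _ _)⟩
  · have h1 := left_ne_zero_of_mul hz
    have h2 := right_ne_zero_of_mul hz
    refine ca.continuousAt.mul ?_
    have c1 : ContinuousAt (fun z : (stdSimplex ℝ K × stdSimplex ℝ L) ×
        (MixedAction K I × MixedAction L J) => posteriorBelief z.1.1 z.2.1 i) z :=
      ContinuousAt.comp (f := fun z : (stdSimplex ℝ K × stdSimplex ℝ L) ×
        (MixedAction K I × MixedAction L J) => (z.1.1, z.2.1))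
        (continuousAt_posteriorBelief i h1) (by fun_prop)
    have c2 : ContinuousAt (fun z : (stdSimplex ℝ K × stdSimplex ℝ L) ×
        (MixedAction K I × MixedAction L J) => posteriorBelief z.1.2 z.2.2 j) z :=
      ContinuousAt.comp (f := fun z : (stdSimplex ℝ K × stdSimplex ℝ L) ×
        (MixedAction K I × MixedAction L J) => (z.1.2, z.2.2))
        (continuousAt_posteriorBelief j h2) (by fun_prop)
    exact ContinuousAt.comp (g := fun z : stdSimplex ℝ K × stdSimplex ℝ L => f z.1 z.2)
      hf.continuousAt (c1.prodMk c2)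

lemma continuous_beliefPayoff (Γ : IncompleteInfoGame K L Ω I J) (ω : Ω) :
    Continuous fun z : (stdSimplex ℝ K × stdSimplex ℝ L) × (MixedAction K I × MixedAction L J) =>
      Γ.beliefPayoff z.1.1 z.1.2 ω z.2.1 z.2.2 := by
  unfold beliefPayoff
  refine continuous_finsetSum _ fun k _ => continuous_finsetSum _ fun l _ =>
    continuous_finsetSum _ fun i _ => continuous_finsetSum _ fun j _ => ?_
  have h1 := (continuous_stdSimplex_apply k).comp (f := fun z : (stdSimplex ℝ K × stdSimplex ℝ L) ×
      (MixedAction K I × MixedAction L J) => z.1.1) (by fun_prop)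
  have h2 := (continuous_stdSimplex_apply l).comp (f := fun z : (stdSimplex ℝ K × stdSimplex ℝ L) ×
      (MixedAction K I × MixedAction L J) => z.1.2) (by fun_prop)
  have h3 := (continuous_stdSimplex_apply i).comp (f := fun z : (stdSimplex ℝ K × stdSimplex ℝ L) ×
      (MixedAction K I × MixedAction L J) => z.2.1 k) (by fun_prop)
  have h4 := (continuous_stdSimplex_apply j).comp (f := fun z : (stdSimplex ℝ K × stdSimplex ℝ L) ×
      (MixedAction K I × MixedAction L J) => z.2.2 l) (by fun_prop)
  exact (((h1.mul h2).mul h3).mul h4).mul continuous_const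

lemma continuous_oneShot (Γ : IncompleteInfoGame K L Ω I J) (lam : ℝ)
    {f : stdSimplex ℝ K → stdSimplex ℝ L → Ω → ℝ}
    (hf : ∀ ω, Continuous fun z : stdSimplex ℝ K × stdSimplex ℝ L => f z.1 z.2 ω) (ω : Ω) :
    Continuous fun z : (stdSimplex ℝ K × stdSimplex ℝ L) × (MixedAction K I × MixedAction L J) =>
      Γ.oneShot lam f z.1.1 z.1.2 ω z.2.1 z.2.2 := by
  unfold oneShot
  refine ((Γ.continuous_beliefPayoff ω).const_mul _).add (Continuous.const_mul ?_ _)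
  refine continuous_finsetSum _ fun t _ => ?_
  have := (continuous_actionProb_mul (f := fun p q => f p q t.2.2) t.1 t.2.1 (hf t.2.2)).const_mul (Γ.ρ ω t.1 t.2.1 t.2.2)
  refine this.congr fun z => ?_
  simp only [outcomeProb]
  ring

lemma exists_isMixedValue_oneShot [Nonempty I] [Nonempty J] (Γ : IncompleteInfoGame K L Ω I J)
    (lam : ℝ) {f : stdSimplex ℝ K → stdSimplex ℝ L → Ω → ℝ}
    (hf : ∀ ω, Continuous fun z : stdSimplex ℝ K × stdSimplex ℝ L => f z.1 z.2 ω)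
    (p : stdSimplex ℝ K) (q : stdSimplex ℝ L) (ω : Ω) :
    ∃ v, IsMixedValue (Γ.oneShot lam f p q ω) v :=
  exists_isMixedValue _ ((Γ.continuous_oneShot lam hf ω).comp (f := fun z => ((p, q), z))
    (by fun_prop))

/-- Lipschitz continuity of the homogeneous extension of `f` in the first belief. -/
def ConicLipschitz (N : ℝ) (f : stdSimplex ℝ K → stdSimplex ℝ L → Ω → ℝ) : Prop :=
  ∀ ω q p p' s t, 0 ≤ s → 0 ≤ t → s * f p q ω - t * f p' q ω ≤ N * ∑ k, |s * p k - t * p' k|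

/-- Superadditivity of the homogeneous extension of `f` in the first belief. -/
def ConicConcave (f : stdSimplex ℝ K → stdSimplex ℝ L → Ω → ℝ) : Prop :=
  ∀ ω q p₁ p₂ p r s t, 0 ≤ r → 0 ≤ s → 0 ≤ t → (∀ k, s * p₁ k + t * p₂ k = r * p k) →
    s * f p₁ q ω + t * f p₂ q ω ≤ r * f p q ω

/-- Player 2's action and the new state are averaged out, so a bound for each action of Player 1,
along possible transitions only, is sufficient. -/
lemma sum_ρ_le (Γ : IncompleteInfoGame K L Ω I J) (q : stdSimplex ℝ L) (y : MixedAction L J) (ω : Ω)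
    (a : I → J → Ω → ℝ) (D : I → ℝ) (h : ∀ i j ω', Γ.ρ ω i j ω' ≠ 0 → a i j ω' ≤ D i) :
    ∑ j, actionProb q y j * ∑ i, ∑ ω', Γ.ρ ω i j ω' * a i j ω' ≤ ∑ i, D i := by
  have h1 : ∀ i j, ∑ ω', Γ.ρ ω i j ω' * a i j ω' ≤ D i := fun i j => by
    calc _ ≤ ∑ ω', Γ.ρ ω i j ω' * D i := Finset.sum_le_sum fun ω' _ => by
          by_cases h0 : Γ.ρ ω i j ω' = 0
          · rw [h0, zero_mul, zero_mul]
          · exact mul_le_mul_of_nonneg_left (h i j ω' h0) (stdSimplex.zero_le _ _)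
      _ = D i := by rw [← Finset.sum_mul, stdSimplex.sum_eq_one, one_mul]
  calc _ ≤ ∑ j, actionProb q y j * ∑ i, D i := Finset.sum_le_sum fun j _ =>
        mul_le_mul_of_nonneg_left (Finset.sum_le_sum fun i _ => h1 i j) (actionProb_nonneg _ _ _)
    _ = _ := by rw [← Finset.sum_mul, sum_actionProb, one_mul]

/-- The same action is played at both beliefs. Unnormalized posteriors after action `i` then differ
by `|s * p k - t * p' k| * x k i`, which sums over `i` to the initial difference. The homogeneous
form makes the constant `N` reproduce itself exactly: stage and continuation enter with weights
`lam` and `1 - lam`. -/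
lemma ConicLipschitz.of_isMixedValue {Γ : IncompleteInfoGame K L Ω I J} {N lam : ℝ}
    (hlam : lam ∈ Set.Ioc (0 : ℝ) 1) (hN : ∀ k l ω i j, |Γ.g k l ω i j| ≤ N)
    {f v : stdSimplex ℝ K → stdSimplex ℝ L → Ω → ℝ} (hf : ConicLipschitz N f)
    (hv : ∀ p q ω, IsMixedValue (Γ.oneShot lam f p q ω) (v p q ω)) : ConicLipschitz N v := by
  intro ω q p p' s t hs ht
  have hl0 := hlam.1
  have hl1 := hlam.2
  suffices s * v p q ω ≤ t * v p' q ω + N * ∑ k, |s * p k - t * p' k| by linarith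
  refine (hv p q ω).scaled_le (hv p' q ω) hs ht fun x y => ?_
  have e0 : ∀ k i, |s * (p k * x k i) - t * (p' k * x k i)| = |s * p k - t * p' k| * x k i :=
    fun k i => by
      rw [show s * (p k * x k i) - t * (p' k * x k i) = (s * p k - t * p' k) * x k i by ring,
        abs_mul, abs_of_nonneg (stdSimplex.zero_le (x k) i)]
  have h1 := Γ.beliefPayoff_sub_le hN p p' q ω x x y s t
  simp only [e0, ← Finset.mul_sum, stdSimplex.sum_eq_one, mul_one] at h1
  have h2 := Γ.sum_ρ_le q y ω (fun i j ω' =>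
      s * actionProb p x i * f (posteriorBelief p x i) (posteriorBelief q y j) ω' -
      t * actionProb p' x i * f (posteriorBelief p' x i) (posteriorBelief q y j) ω')
      (fun i => N * ∑ k, |s * p k - t * p' k| * x k i) fun i j ω' _ => by
    refine (hf ω' _ _ _ _ _ (mul_nonneg hs (actionProb_nonneg _ _ _))
      (mul_nonneg ht (actionProb_nonneg _ _ _))).trans (le_of_eq ?_)
    congr 1
    refine Finset.sum_congr rfl fun k _ => ?_
    rw [mul_assoc, mul_assoc, actionProb_mul_posteriorBelief, actionProb_mul_posteriorBelief, e0]
  rw [← Finset.mul_sum, Finset.sum_comm] at h2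
  simp only [← Finset.mul_sum, stdSimplex.sum_eq_one, mul_one] at h2
  have h3 : ∑ j, actionProb q y j * ∑ i, ∑ ω', Γ.ρ ω i j ω' *
      (s * actionProb p x i * f (posteriorBelief p x i) (posteriorBelief q y j) ω' -
      t * actionProb p' x i * f (posteriorBelief p' x i) (posteriorBelief q y j) ω') =
      s * ∑ j, actionProb q y j * ∑ i, actionProb p x i * ∑ ω', Γ.ρ ω i j ω' *
        f (posteriorBelief p x i) (posteriorBelief q y j) ω' -
      t * ∑ j, actionProb q y j * ∑ i, actionProb p' x i * ∑ ω', Γ.ρ ω i j ω' *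
        f (posteriorBelief p' x i) (posteriorBelief q y j) ω' := by
    simp only [Finset.mul_sum, ← Finset.sum_sub_distrib]
    exact Finset.sum_congr rfl fun j _ => Finset.sum_congr rfl fun i _ =>
      Finset.sum_congr rfl fun ω' _ => by ring
  rw [h3] at h2
  rw [oneShot_eq, oneShot_eq]
  nlinarith

/-- Splitting argument: the mixture of the two joint laws of type and action is itself induced by an
action at the mixed belief, stage payoffs are linear in the joint law, and continuation payoffs are
superadditive by assumption. -/
lemma ConicConcave.of_isMixedValue [Nonempty I] {Γ : IncompleteInfoGame K L Ω I J} {lam : ℝ}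
    (hlam : lam ∈ Set.Ioc (0 : ℝ) 1)
    {f v : stdSimplex ℝ K → stdSimplex ℝ L → Ω → ℝ} (hf : ConicConcave f)
    (hv : ∀ p q ω, IsMixedValue (Γ.oneShot lam f p q ω) (v p q ω)) : ConicConcave v := by
  intro ω q p₁ p₂ p r s t hr hs ht h
  have hl1 := hlam.2
  have hrst : s + t = r := by
    have := Finset.sum_congr (rfl : (Finset.univ : Finset K) = _) fun k _ => h k
    rw [Finset.sum_add_distrib] at this
    simpa only [← Finset.mul_sum, stdSimplex.sum_eq_one, mul_one] using this
  rcases hr.eq_or_lt with hr0 | hr0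
  · have hs0 : s = 0 := by linarith
    have ht0 : t = 0 := by linarith
    simp [← hr0, hs0, ht0]
  refine (hv p q ω).superadd (hv p₁ q ω) (hv p₂ q ω) hr0 hs ht fun x₁ x₂ => ?_
  obtain ⟨x, hx⟩ := exists_mixedAction_of_joint p
    (fun i k => (s * (p₁ k * x₁ k i) + t * (p₂ k * x₂ k i)) / r)
    (fun i k => div_nonneg (add_nonneg (mul_nonneg hs (mul_nonneg (p₁.2.1 k) ((x₁ k).2.1 i)))
      (mul_nonneg ht (mul_nonneg (p₂.2.1 k) ((x₂ k).2.1 i)))) hr)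
    (fun k => by
      rw [← Finset.sum_div, Finset.sum_add_distrib]
      simp only [← Finset.mul_sum, stdSimplex.sum_eq_one, mul_one]
      rw [h k, mul_div_cancel_left₀ _ hr0.ne'])
  have hx' : ∀ k i, r * (p k * x k i) = s * (p₁ k * x₁ k i) + t * (p₂ k * x₂ k i) := fun k i => by
    rw [hx]
    field_simp
  refine ⟨x, fun y => ?_⟩
  have h1 : r * Γ.beliefPayoff p q ω x y =
      s * Γ.beliefPayoff p₁ q ω x₁ y + t * Γ.beliefPayoff p₂ q ω x₂ y := by
    rw [beliefPayoff_eq, beliefPayoff_eq, beliefPayoff_eq]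
    simp only [Finset.mul_sum, ← Finset.sum_add_distrib]
    refine Finset.sum_congr rfl fun k _ => Finset.sum_congr rfl fun i _ =>
      Finset.sum_congr rfl fun l _ => Finset.sum_congr rfl fun j _ => ?_
    linear_combination (q l * y l j * Γ.g k l ω i j) * hx' k i
  have h2 := Γ.sum_ρ_le q y ω (fun i j ω' =>
      s * actionProb p₁ x₁ i * f (posteriorBelief p₁ x₁ i) (posteriorBelief q y j) ω' +
      t * actionProb p₂ x₂ i * f (posteriorBelief p₂ x₂ i) (posteriorBelief q y j) ω' -
      r * actionProb p x i * f (posteriorBelief p x i) (posteriorBelief q y j) ω')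
      (fun _ => 0) fun i j ω' _ => by
    have := hf ω' (posteriorBelief q y j) (posteriorBelief p₁ x₁ i) (posteriorBelief p₂ x₂ i)
      (posteriorBelief p x i) (r * actionProb p x i) (s * actionProb p₁ x₁ i)
      (t * actionProb p₂ x₂ i) (mul_nonneg hr (actionProb_nonneg _ _ _))
      (mul_nonneg hs (actionProb_nonneg _ _ _)) (mul_nonneg ht (actionProb_nonneg _ _ _))
      fun k => by
        simp only [mul_assoc, actionProb_mul_posteriorBelief, hx']
    linarith
  have h3 : ∑ j, actionProb q y j * ∑ i, ∑ ω', Γ.ρ ω i j ω' *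
      (s * actionProb p₁ x₁ i * f (posteriorBelief p₁ x₁ i) (posteriorBelief q y j) ω' +
      t * actionProb p₂ x₂ i * f (posteriorBelief p₂ x₂ i) (posteriorBelief q y j) ω' -
      r * actionProb p x i * f (posteriorBelief p x i) (posteriorBelief q y j) ω') =
      s * ∑ j, actionProb q y j * ∑ i, actionProb p₁ x₁ i * ∑ ω', Γ.ρ ω i j ω' *
        f (posteriorBelief p₁ x₁ i) (posteriorBelief q y j) ω' +
      t * ∑ j, actionProb q y j * ∑ i, actionProb p₂ x₂ i * ∑ ω', Γ.ρ ω i j ω' *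
        f (posteriorBelief p₂ x₂ i) (posteriorBelief q y j) ω' -
      r * ∑ j, actionProb q y j * ∑ i, actionProb p x i * ∑ ω', Γ.ρ ω i j ω' *
        f (posteriorBelief p x i) (posteriorBelief q y j) ω' := by
    simp only [Finset.mul_sum, ← Finset.sum_sub_distrib, ← Finset.sum_add_distrib]
    exact Finset.sum_congr rfl fun j _ => Finset.sum_congr rfl fun i _ =>
      Finset.sum_congr rfl fun ω' _ => by ring
  rw [h3, Finset.sum_const_zero] at h2
  simp only [oneShot_eq]
  nlinarith

/-- The regularity properties of the value of the belief game. -/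
structure IsRegularValue (Γ : IncompleteInfoGame K L Ω I J) (N : ℝ) (i₀ : I) (j₀ : J)
    (f : stdSimplex ℝ K → stdSimplex ℝ L → Ω → ℝ) : Prop where
  lipschitz_left : ConicLipschitz N f
  lipschitz_right : ConicLipschitz N (swapFun f)
  concave : ConicConcave f
  convex : ConicConcave (swapFun f)
  absorbing : ∀ ω, Γ.IsAbsorbing ω → ∀ p q, f p q ω = Γ.constPayoff i₀ j₀ p q ω

lemma swapFun_swapFun (f : stdSimplex ℝ K → stdSimplex ℝ L → Ω → ℝ) : swapFun (swapFun f) = f := by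
  funext p q ω
  simp [swapFun]

lemma IsRegularValue.swap {Γ : IncompleteInfoGame K L Ω I J} {N : ℝ} {i₀ : I} {j₀ : J}
    {f : stdSimplex ℝ K → stdSimplex ℝ L → Ω → ℝ} (h : Γ.IsRegularValue N i₀ j₀ f) :
    Γ.swap.IsRegularValue N j₀ i₀ (swapFun f) where
  lipschitz_left := h.lipschitz_right
  lipschitz_right := by rw [swapFun_swapFun]; exact h.lipschitz_left
  concave := h.convex
  convex := by rw [swapFun_swapFun]; exact h.concave
  absorbing ω hω q p := by
    have hω' : Γ.IsAbsorbing ω := ⟨fun k l i j i' j' => neg_injective (hω.1 l k j i j' i'),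
      fun i j => hω.2 j i⟩
    rw [constPayoff_swap, ← h.absorbing ω hω']
    rfl

lemma isMixedValue_swap {Γ : IncompleteInfoGame K L Ω I J} {lam : ℝ}
    {f : stdSimplex ℝ K → stdSimplex ℝ L → Ω → ℝ} {p : stdSimplex ℝ K} {q : stdSimplex ℝ L} {ω : Ω}
    {v : ℝ} (h : IsMixedValue (Γ.oneShot lam f p q ω) v) :
    IsMixedValue (Γ.swap.oneShot lam (swapFun f) q p ω) (-v) := by
  convert h.swap using 3
  exact Γ.oneShot_swap lam f p q ω _ _

/-- Shapley's operator preserves regularity, which lets the fixed point be sought among regular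
functions; the properties in the second belief come from the game with the players exchanged. -/
lemma IsRegularValue.of_isMixedValue [Nonempty I] [Nonempty J] {Γ : IncompleteInfoGame K L Ω I J}
    {N lam : ℝ} {i₀ : I} {j₀ : J}
    (hlam : lam ∈ Set.Ioc (0 : ℝ) 1) (hN : ∀ k l ω i j, |Γ.g k l ω i j| ≤ N)
    {f v : stdSimplex ℝ K → stdSimplex ℝ L → Ω → ℝ} (hf : Γ.IsRegularValue N i₀ j₀ f)
    (hv : ∀ p q ω, IsMixedValue (Γ.oneShot lam f p q ω) (v p q ω)) :
    Γ.IsRegularValue N i₀ j₀ v where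
  lipschitz_left := hf.lipschitz_left.of_isMixedValue hlam hN hv
  lipschitz_right := hf.lipschitz_right.of_isMixedValue hlam (Γ := Γ.swap)
    (fun l k ω j i => by simpa [IncompleteInfoGame.swap] using hN k l ω i j)
    fun q p ω => isMixedValue_swap (hv p q ω)
  concave := hf.concave.of_isMixedValue hlam hv
  convex := hf.convex.of_isMixedValue hlam (Γ := Γ.swap) fun q p ω => isMixedValue_swap (hv p q ω)
  absorbing ω hω p q := by
    have h1 := fun x y => hω.oneShot_eq_constPayoff i₀ j₀ lam (hf.absorbing ω hω) p q x y
    obtain ⟨x⟩ : Nonempty (MixedAction K I) := inferInstance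
    obtain ⟨y⟩ : Nonempty (MixedAction L J) := inferInstance
    refine le_antisymm ?_ ?_
    · have h2 : Secures (fun y x => -Γ.oneShot lam f p q ω x y) (-Γ.constPayoff i₀ j₀ p q ω) :=
        Secures.of_pure y fun x => by rw [h1]
      have := (hv p q ω).swap.le_of_secures h2
      linarith
    · exact (hv p q ω).le_of_secures (Secures.of_pure x fun y => by rw [h1])

lemma conicConcave_constPayoff (Γ : IncompleteInfoGame K L Ω I J) (i₀ : I) (j₀ : J) :
    ConicConcave (Γ.constPayoff i₀ j₀) := by
  intro ω q p₁ p₂ p r s t _ _ _ h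
  have := Γ.sum_mul_constPayoff_left i₀ j₀ ![s, t] ![p₁, p₂] r p
    (fun k => by simpa using h k) q ω
  simp only [Fin.sum_univ_two, Matrix.cons_val_zero, Matrix.cons_val_one] at this
  exact this.le

lemma isRegularValue_constPayoff (Γ : IncompleteInfoGame K L Ω I J) {N : ℝ}
    (hN : ∀ k l ω i j, |Γ.g k l ω i j| ≤ N) (i₀ : I) (j₀ : J) :
    Γ.IsRegularValue N i₀ j₀ (Γ.constPayoff i₀ j₀) := by
  have hs : swapFun (Γ.constPayoff i₀ j₀) = Γ.swap.constPayoff j₀ i₀ := by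
    funext q p ω
    rw [constPayoff_swap]
    rfl
  have hN' : ∀ l k ω j i, |Γ.swap.g l k ω j i| ≤ N := fun l k ω j i => by
    simpa [IncompleteInfoGame.swap] using hN k l ω i j
  refine ⟨fun ω q p p' s t _ _ => Γ.constPayoff_sub_le hN i₀ j₀ p p' q ω s t, ?_,
    Γ.conicConcave_constPayoff i₀ j₀, ?_, fun _ _ _ _ => rfl⟩
  · rw [hs]
    exact fun ω q p p' s t _ _ => Γ.swap.constPayoff_sub_le hN' j₀ i₀ p p' q ω s t
  · rw [hs]
    exact Γ.swap.conicConcave_constPayoff j₀ i₀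

namespace IsRegularValue

variable {Γ : IncompleteInfoGame K L Ω I J} {N : ℝ} {i₀ : I} {j₀ : J}
  {f : stdSimplex ℝ K → stdSimplex ℝ L → Ω → ℝ}

/-- Setting one of the two weights in the homogeneous Lipschitz inequality to zero compares `f` with
zero. -/
lemma abs_le (h : Γ.IsRegularValue N i₀ j₀ f) (p : stdSimplex ℝ K) (q : stdSimplex ℝ L) (ω : Ω) :
    |f p q ω| ≤ N := by
  have h1 : ∑ k, |p k| = 1 := by
    simp only [abs_of_nonneg (stdSimplex.zero_le p _), stdSimplex.sum_eq_one]
  have h2 := h.lipschitz_left ω q p p 1 0 zero_le_one le_rfl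
  have h3 := h.lipschitz_left ω q p p 0 1 le_rfl zero_le_one
  simp only [one_mul, zero_mul, sub_zero, zero_sub, abs_neg] at h2 h3
  rw [_root_.abs_le]
  rw [h1] at h2 h3
  constructor <;> linarith

lemma abs_sub_left_le (h : Γ.IsRegularValue N i₀ j₀ f) (p p' : stdSimplex ℝ K) (q : stdSimplex ℝ L)
    (ω : Ω) : |f p q ω - f p' q ω| ≤ N * ∑ k, |p k - p' k| := by
  have h2 := h.lipschitz_left ω q p p' 1 1 zero_le_one zero_le_one
  have h3 := h.lipschitz_left ω q p' p 1 1 zero_le_one zero_le_one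
  simp only [one_mul] at h2 h3
  simp only [abs_sub_comm (p' _)] at h3
  rw [_root_.abs_le]
  constructor <;> linarith

lemma continuous (h : Γ.IsRegularValue N i₀ j₀ f) (ω : Ω) :
    Continuous fun z : stdSimplex ℝ K × stdSimplex ℝ L => f z.1 z.2 ω := by
  rw [continuous_iff_continuousAt]
  intro z
  unfold ContinuousAt
  rw [tendsto_iff_dist_tendsto_zero]
  have hb : ∀ z' : stdSimplex ℝ K × stdSimplex ℝ L, dist (f z'.1 z'.2 ω) (f z.1 z.2 ω) ≤
      N * ∑ k, |z'.1 k - z.1 k| + N * ∑ l, |z'.2 l - z.2 l| := fun z' => by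
    have h1 := h.abs_sub_left_le z'.1 z.1 z'.2 ω
    have h2 := h.swap.abs_sub_left_le z'.2 z.2 z.1 ω
    simp only [swapFun, neg_sub_neg] at h2
    rw [abs_sub_comm] at h2
    rw [Real.dist_eq]
    calc _ = |(f z'.1 z'.2 ω - f z.1 z'.2 ω) + (f z.1 z'.2 ω - f z.1 z.2 ω)| := by ring_nf
      _ ≤ _ := (abs_add_le _ _).trans (add_le_add h1 h2)
  refine squeeze_zero (fun _ => dist_nonneg) hb ?_
  have hc : Continuous fun z' : stdSimplex ℝ K × stdSimplex ℝ L =>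
      N * ∑ k, |z'.1 k - z.1 k| + N * ∑ l, |z'.2 l - z.2 l| := by
    refine ((continuous_finsetSum _ fun k _ => ?_).const_mul _).add
      ((continuous_finsetSum _ fun l _ => ?_).const_mul _)
    · exact (((continuous_stdSimplex_apply k).comp continuous_fst).sub continuous_const).abs
    · exact (((continuous_stdSimplex_apply l).comp continuous_snd).sub continuous_const).abs
  simpa using hc.tendsto z

end IsRegularValue

end IncompleteInfoGame

end

/-! ### Shapley's equations for the belief game and the triangulated game. -/

noncomputable section

set_option linter.unusedSectionVars false

/-- In a separable space, points can be measurably replaced by points of a sequence without changing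
the value of a continuous map by more than `δ`. -/
lemma exists_measurable_index {X Z : Type*} [TopologicalSpace X] [TopologicalSpace.SeparableSpace X]
    [Nonempty X] [MeasurableSpace X] [OpensMeasurableSpace X] [PseudoMetricSpace Z] (Φ : X → Z)
    (hΦ : Continuous Φ) {δ : ℝ} (hδ : 0 < δ) :
    ∃ (ι : X → ℕ) (e : ℕ → X), Measurable ι ∧ ∀ x, dist (Φ x) (Φ (e (ι x))) < δ := by
  classical
  let e := TopologicalSpace.denseSeq X
  have hex : ∀ x, ∃ n, dist (Φ x) (Φ (e n)) < δ := fun x => by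
    have ho : IsOpen {y | dist (Φ x) (Φ y) < δ} :=
      isOpen_lt (continuous_const.dist hΦ) continuous_const
    obtain ⟨y, hy, n, rfl⟩ := (TopologicalSpace.denseRange_denseSeq X).inter_open_nonempty _ ho
      ⟨x, by simpa using hδ⟩
    exact ⟨n, hy⟩
  refine ⟨fun x => Nat.find (hex x), e, measurable_find hex fun n => ?_,
    fun x => Nat.find_spec (hex x)⟩
  exact (isOpen_lt (hΦ.dist continuous_const) continuous_const).measurableSet

namespace Triangulation

variable {K L Ω : Type*} [Fintype K] [Fintype L]

lemma sum_split_mul_toBelief (P : Triangulation K) (p : stdSimplex ℝ K) (k : K) :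
    ∑ u, P.split p u * P.toBelief u k = p k := by
  have := congrFun (P.isSplitting_split p).2 k
  rw [Finset.sum_apply] at this
  exact this

/-- The average of a function of the vertices over the splittings of two beliefs. -/
def extend (P : Triangulation K) (Q : Triangulation L) (w : P.Vertex → Q.Vertex → Ω → ℝ) :
    stdSimplex ℝ K → stdSimplex ℝ L → Ω → ℝ := fun p q ω =>
  ∑ u, P.split p u * ∑ v, Q.split q v * w u v ω

lemma extend_le_add (P : Triangulation K) (Q : Triangulation L)
    {w w' : P.Vertex → Q.Vertex → Ω → ℝ} {d : ℝ} (h : ∀ u v ω, w u v ω ≤ w' u v ω + d)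
    (p : stdSimplex ℝ K) (q : stdSimplex ℝ L) (ω : Ω) :
    P.extend Q w p q ω ≤ P.extend Q w' p q ω + d := by
  unfold extend
  rw [← sum_mul_add_const (stdSimplex.sum_eq_one (P.split p))]
  refine Finset.sum_le_sum fun u _ => mul_le_mul_of_nonneg_left ?_ ((P.split p).2.1 u)
  rw [← sum_mul_add_const (stdSimplex.sum_eq_one (Q.split q))]
  exact Finset.sum_le_sum fun v _ => mul_le_mul_of_nonneg_left (h u v ω) ((Q.split q).2.1 v)

lemma abs_extend_le (P : Triangulation K) (Q : Triangulation L)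
    {w : P.Vertex → Q.Vertex → Ω → ℝ} {R : ℝ} (h : ∀ u v ω, |w u v ω| ≤ R)
    (p : stdSimplex ℝ K) (q : stdSimplex ℝ L) (ω : Ω) : |P.extend Q w p q ω| ≤ R :=
  IncompleteInfoGame.abs_sum_mul_le (P.split p).2.1 (P.split p).2.2 fun u =>
    IncompleteInfoGame.abs_sum_mul_le (Q.split q).2.1 (Q.split q).2.2 fun v => h u v ω

lemma continuous_extend (P : Triangulation K) (Q : Triangulation L)
    (w : P.Vertex → Q.Vertex → Ω → ℝ) (ω : Ω) :
    Continuous fun z : stdSimplex ℝ K × stdSimplex ℝ L => P.extend Q w z.1 z.2 ω := by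
  unfold extend
  refine continuous_finsetSum _ fun u _ => Continuous.mul ?_
    (continuous_finsetSum _ fun v _ => Continuous.mul ?_ continuous_const)
  · exact (continuous_stdSimplex_apply u).comp (P.continuous_split.comp continuous_fst)
  · exact (continuous_stdSimplex_apply v).comp (Q.continuous_split.comp continuous_snd)

end Triangulation

namespace IncompleteInfoGame

variable {K L Ω I J : Type*} [Fintype K] [Fintype L] [Fintype Ω] [Fintype I] [Fintype J]

/-- Splittings preserve the mean and `constPayoff` is bilinear, so triangulating costs nothing in
absorbing states. -/
lemma extend_constPayoff (Γ : IncompleteInfoGame K L Ω I J) (P : Triangulation K)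
    (Q : Triangulation L) (i₀ : I) (j₀ : J) {w : P.Vertex → Q.Vertex → Ω → ℝ} {ω : Ω}
    (hw : ∀ u v, w u v ω = Γ.constPayoff i₀ j₀ (P.toBelief u) (Q.toBelief v) ω)
    (p : stdSimplex ℝ K) (q : stdSimplex ℝ L) :
    P.extend Q w p q ω = Γ.constPayoff i₀ j₀ p q ω := by
  simp only [Triangulation.extend, hw]
  have h1 : ∀ u, ∑ v, Q.split q v * Γ.constPayoff i₀ j₀ (P.toBelief u) (Q.toBelief v) ω =
      1 * Γ.constPayoff i₀ j₀ (P.toBelief u) q ω := fun u =>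
    Γ.sum_mul_constPayoff_right i₀ j₀ _ _ 1 q
      (fun l => by rw [one_mul, Q.sum_split_mul_toBelief]) _ ω
  simp only [h1, one_mul]
  rw [Γ.sum_mul_constPayoff_left i₀ j₀ _ _ 1 p
      (fun l => by rw [one_mul, P.sum_split_mul_toBelief]) _ ω, one_mul]

lemma abs_oneShot_le (Γ : IncompleteInfoGame K L Ω I J) {lam N : ℝ}
    (hlam : lam ∈ Set.Ioc (0 : ℝ) 1) (hN : ∀ k l ω i j, |Γ.g k l ω i j| ≤ N)
    {f : stdSimplex ℝ K → stdSimplex ℝ L → Ω → ℝ} (hf : ∀ p q ω, |f p q ω| ≤ N)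
    (p : stdSimplex ℝ K) (q : stdSimplex ℝ L) (ω : Ω) (x : MixedAction K I) (y : MixedAction L J) :
    |Γ.oneShot lam f p q ω x y| ≤ N := by
  have hl0 := hlam.1
  have hl1 := hlam.2
  have h1 := abs_le.1 (Γ.abs_beliefPayoff_le hN p q ω x y)
  have h2 := abs_le.1 (abs_sum_mul_le (Γ.outcomeProb_nonneg p q ω x y) (Γ.sum_outcomeProb _ _ _ _ _)
    (f := fun t => f (posteriorBelief p x t.1) (posteriorBelief q y t.2.1) t.2.2)
    fun t => hf _ _ _)
  unfold oneShot
  rw [abs_le]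
  constructor <;> nlinarith

variable [MeasurableSpace Ω] [DiscreteMeasurableSpace Ω]

lemma auxPayoff_beliefGame (Γ : IncompleteInfoGame K L Ω I J) (lam : ℝ)
    (f : stdSimplex ℝ K → stdSimplex ℝ L → Ω → ℝ) (s : stdSimplex ℝ K × stdSimplex ℝ L × Ω)
    (x : MixedAction K I) (y : MixedAction L J) :
    Γ.beliefGame.auxPayoff lam (fun s => f s.1 s.2.1 s.2.2) (s, x, y) =
      Γ.oneShot lam f s.1 s.2.1 s.2.2 x y := by
  unfold StochasticGame.auxPayoff oneShot
  congr 2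
  exact integral_finsum_dirac _ _ (Γ.outcomeProb_nonneg _ _ _ _ _) _

lemma auxPayoff_triangulatedGame (Γ : IncompleteInfoGame K L Ω I J) (P : Triangulation K)
    (Q : Triangulation L) (lam : ℝ) (w : P.Vertex → Q.Vertex → Ω → ℝ) (s : P.Vertex × Q.Vertex × Ω)
    (x : MixedAction K I) (y : MixedAction L J) :
    (Γ.triangulatedGame P Q).auxPayoff lam (fun s => w s.1 s.2.1 s.2.2) (s, x, y) =
      Γ.oneShot lam (P.extend Q w) (P.toBelief s.1) (Q.toBelief s.2.1) s.2.2 x y := by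
  unfold StochasticGame.auxPayoff oneShot
  congr 2
  refine (integral_finsum_dirac (ι := (I × J × Ω) × P.Vertex × Q.Vertex) _ _
    (fun t => mul_nonneg (mul_nonneg (Γ.outcomeProb_nonneg _ _ _ _ _ _) ((P.split _).2.1 _))
      ((Q.split _).2.1 _)) _).trans ?_
  rw [Fintype.sum_prod_type]
  refine Finset.sum_congr rfl fun t _ => ?_
  rw [Fintype.sum_prod_type, Triangulation.extend, Finset.mul_sum]
  refine Finset.sum_congr rfl fun u _ => ?_
  rw [Finset.mul_sum, Finset.mul_sum]
  refine Finset.sum_congr rfl fun v _ => ?_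
  simp only [mul_assoc]
  rfl

lemma abs_oneShot_sub_le (Γ : IncompleteInfoGame K L Ω I J) {lam : ℝ} (h1 : lam ≤ 1)
    {f f' : stdSimplex ℝ K → stdSimplex ℝ L → Ω → ℝ} {d : ℝ} (h : ∀ p q ω, |f p q ω - f' p q ω| ≤ d)
    {p : stdSimplex ℝ K} {q : stdSimplex ℝ L} {ω : Ω} {v v' : ℝ}
    (hv : IsMixedValue (Γ.oneShot lam f p q ω) v) (hv' : IsMixedValue (Γ.oneShot lam f' p q ω) v') :
    |v - v'| ≤ (1 - lam) * d := by
  have e1 := hv.le_add hv' fun x y => Γ.oneShot_le_add h1 (d := d)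
    (fun p q ω => by linarith [(abs_le.1 (h p q ω)).2]) p q ω x y
  have e2 := hv'.le_add hv fun x y => Γ.oneShot_le_add h1 (d := d)
    (fun p q ω => by linarith [(abs_le.1 (h p q ω)).1]) p q ω x y
  rw [abs_le]
  constructor <;> linarith

/-- Shapley's equation for the belief game. -/
theorem exists_oneShot_fixedPoint [Nonempty I] [Nonempty J] (Γ : IncompleteInfoGame K L Ω I J)
    {lam N : ℝ} (hlam : lam ∈ Set.Ioc (0 : ℝ) 1) (hN : ∀ k l ω i j, |Γ.g k l ω i j| ≤ N) (i₀ : I)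
    (j₀ : J) :
    ∃ v, Γ.IsRegularValue N i₀ j₀ v ∧ ∀ p q ω, IsMixedValue (Γ.oneShot lam v p q ω) (v p q ω) := by
  classical
  have hl0 := hlam.1
  have hl1 := hlam.2
  let X := stdSimplex ℝ K × stdSimplex ℝ L × Ω
  let cur : (X → ℝ) → stdSimplex ℝ K → stdSimplex ℝ L → Ω → ℝ := fun f p q ω => f (p, q, ω)
  -- The default `0` is never met on `C`, whose members are continuous and so give one-shot games
  -- with a value.
  let T : (X → ℝ) → X → ℝ := fun f s =>
    if h : ∃ v, IsMixedValue (Γ.oneShot lam (cur f) s.1 s.2.1 s.2.2) v then h.choose else 0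
  let C : Set (X → ℝ) := {f | Γ.IsRegularValue N i₀ j₀ (cur f)}
  have hTval : ∀ f ∈ C, ∀ s : X, IsMixedValue (Γ.oneShot lam (cur f) s.1 s.2.1 s.2.2) (T f s) := by
    intro f hf s
    have h := Γ.exists_isMixedValue_oneShot lam hf.continuous s.1 s.2.1 s.2.2
    simp only [T, dif_pos h]
    exact h.choose_spec
  have hclosed : ∀ (u : ℕ → X → ℝ) (f : X → ℝ), (∀ n, u n ∈ C) →
      (∀ x, Filter.Tendsto (fun n => u n x) Filter.atTop (nhds (f x))) → f ∈ C := by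
    intro u f hu hlim
    refine ⟨fun ω q p p' s t hs ht => ?_, fun ω q p p' s t hs ht => ?_,
      fun ω q p₁ p₂ p r s t hr hs ht h => ?_, fun ω q p₁ p₂ p r s t hr hs ht h => ?_,
      fun ω hω p q => ?_⟩
    · exact le_of_tendsto' (((hlim _).const_mul _).sub ((hlim _).const_mul _)) fun n =>
        (hu n).lipschitz_left ω q p p' s t hs ht
    · exact le_of_tendsto' (((hlim _).neg.const_mul _).sub ((hlim _).neg.const_mul _)) fun n =>
        (hu n).lipschitz_right ω q p p' s t hs ht
    · exact le_of_tendsto_of_tendsto' (((hlim _).const_mul _).add ((hlim _).const_mul _))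
        ((hlim _).const_mul _) fun n => (hu n).concave ω q p₁ p₂ p r s t hr hs ht h
    · exact le_of_tendsto_of_tendsto' (((hlim _).neg.const_mul _).add ((hlim _).neg.const_mul _))
        ((hlim _).neg.const_mul _) fun n => (hu n).convex ω q p₁ p₂ p r s t hr hs ht h
    · exact tendsto_nhds_unique (hlim (p, q, ω))
        (tendsto_const_nhds.congr fun n => ((hu n).absorbing ω hω p q).symm)
  obtain ⟨f, hf, hfix⟩ := exists_fixedPoint_of_contraction C T (R := N) (c := 1 - lam)
    (by linarith) (by linarith)
    ⟨fun s => Γ.constPayoff i₀ j₀ s.1 s.2.1 s.2.2, Γ.isRegularValue_constPayoff hN i₀ j₀⟩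
    (fun f hf s => hf.abs_le s.1 s.2.1 s.2.2) hclosed
    (fun f hf => IsRegularValue.of_isMixedValue hlam hN hf fun p q ω => hTval f hf (p, q, ω))
    (fun f hf g hg d hd s => Γ.abs_oneShot_sub_le hl1 (fun p q ω => hd (p, q, ω))
      (hTval f hf s) (hTval g hg s))
  refine ⟨cur f, hf, fun p q ω => ?_⟩
  have := hTval f hf (p, q, ω)
  rwa [hfix] at this

lemma measurable_beliefPayoff (Γ : IncompleteInfoGame K L Ω I J) {α : Type*} [MeasurableSpace α]
    {p : α → stdSimplex ℝ K} {q : α → stdSimplex ℝ L} {ω : α → Ω} {x : α → MixedAction K I}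
    {y : α → MixedAction L J} (hp : Measurable p) (hq : Measurable q) (hω : Measurable ω)
    (hx : Measurable x) (hy : Measurable y) :
    Measurable fun a => Γ.beliefPayoff (p a) (q a) (ω a) (x a) (y a) := by
  unfold beliefPayoff
  refine Finset.measurable_sum _ fun k _ => Finset.measurable_sum _ fun l _ =>
    Finset.measurable_sum _ fun i _ => Finset.measurable_sum _ fun j _ => ?_
  exact ((((measurable_simplex_apply hp k).mul (measurable_simplex_apply hq l)).mul
    (measurable_simplex_apply ((measurable_pi_apply k).comp hx) i)).mul
    (measurable_simplex_apply ((measurable_pi_apply l).comp hy) j)).mul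
    ((measurable_of_countable fun o => Γ.g k l o i j).comp hω)

/-- A regular solution of Shapley's equation is the value of the belief game. -/
theorem isDiscountedValue_beliefGame (Γ : IncompleteInfoGame K L Ω I J)
    {lam N : ℝ} (hlam : lam ∈ Set.Ioc (0 : ℝ) 1) (hN : ∀ k l ω i j, |Γ.g k l ω i j| ≤ N) {i₀ : I}
    {j₀ : J} {v : stdSimplex ℝ K → stdSimplex ℝ L → Ω → ℝ} (hv : Γ.IsRegularValue N i₀ j₀ v)
    (hval : ∀ p q ω, IsMixedValue (Γ.oneShot lam v p q ω) (v p q ω)) (p : stdSimplex ℝ K)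
    (q : stdSimplex ℝ L) (ω : Ω) : Γ.beliefGame.IsDiscountedValue lam (p, q, ω) (v p q ω) := by
  have hvm : Measurable fun s : stdSimplex ℝ K × stdSimplex ℝ L × Ω => v s.1 s.2.1 s.2.2 := by
    have : Measurable fun s : Ω × (stdSimplex ℝ K × stdSimplex ℝ L) => v s.2.1 s.2.2 s.1 :=
      measurable_from_prod_countable_right fun ω => (hv.continuous ω).measurable
    exact this.comp (f := fun s : stdSimplex ℝ K × stdSimplex ℝ L × Ω => (s.2.2, s.1, s.2.1))
      (by fun_prop)
  refine Γ.beliefGame.isDiscountedValue_of_isMixedValue (T := ℕ × Ω) hlam (R := N)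
    (v := fun s => v s.1 s.2.1 s.2.2) ?_ ?_ hvm (fun s => hv.abs_le _ _ _) ?_ ?_ (p, q, ω)
  · exact Γ.measurable_beliefPayoff (by fun_prop) (by fun_prop) (by fun_prop) (by fun_prop)
      (by fun_prop)
  · exact fun z => Γ.abs_beliefPayoff_le hN _ _ _ _ _
  · intro s
    simp only [Γ.auxPayoff_beliefGame lam v]
    exact hval _ _ _
  · intro δ hδ
    have : Nonempty (stdSimplex ℝ K × stdSimplex ℝ L) := ⟨(p, q)⟩
    -- Recording the value and the whole one-shot payoff function for every `ω` lets a single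
    -- countable index control all pairs of actions uniformly.
    let Φ : stdSimplex ℝ K × stdSimplex ℝ L → Ω → ℝ × C(MixedAction K I × MixedAction L J, ℝ) :=
      fun z ω => (v z.1 z.2 ω, (ContinuousMap.curry ⟨_, Γ.continuous_oneShot lam hv.continuous ω⟩) z)
    have hΦ : Continuous Φ := continuous_pi fun ω => (hv.continuous ω).prodMk
      (ContinuousMap.curry ⟨_, Γ.continuous_oneShot lam hv.continuous ω⟩).continuous
    obtain ⟨ι, e, hι, h⟩ := exists_measurable_index Φ hΦ hδ
    refine ⟨fun s => (ι (s.1, s.2.1), s.2.2), fun t => ((e t.1).1, (e t.1).2, t.2), ?_, fun s => ?_⟩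
    · exact (hι.comp (by fun_prop)).prodMk (by fun_prop)
    · have h1 := (dist_le_pi_dist (Φ (s.1, s.2.1)) (Φ (e (ι (s.1, s.2.1)))) s.2.2).trans
        (h (s.1, s.2.1)).le
      rw [Prod.dist_eq, max_le_iff] at h1
      refine ⟨h1.1, fun x y => ?_⟩
      rw [Γ.auxPayoff_beliefGame lam v, Γ.auxPayoff_beliefGame lam v]
      exact (ContinuousMap.dist_apply_le_dist (x, y)).trans h1.2

/-- Shapley's equation for the triangulated game. -/
theorem exists_extend_fixedPoint [Nonempty I] [Nonempty J] (Γ : IncompleteInfoGame K L Ω I J)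
    (P : Triangulation K) (Q : Triangulation L)
    {lam N : ℝ} (hlam : lam ∈ Set.Ioc (0 : ℝ) 1) (hN : ∀ k l ω i j, |Γ.g k l ω i j| ≤ N)
    (hN0 : 0 ≤ N) :
    ∃ w : P.Vertex → Q.Vertex → Ω → ℝ, (∀ u v ω, |w u v ω| ≤ N) ∧ ∀ u v ω, IsMixedValue
      (Γ.oneShot lam (P.extend Q w) (P.toBelief u) (Q.toBelief v) ω) (w u v ω) := by
  have hl0 := hlam.1
  have hl1 := hlam.2
  let X := P.Vertex × Q.Vertex × Ω
  let cur : (X → ℝ) → P.Vertex → Q.Vertex → Ω → ℝ := fun f p q ω => f (p, q, ω)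
  have hex : ∀ (f : X → ℝ) (s : X), ∃ v, IsMixedValue (Γ.oneShot lam (P.extend Q (cur f))
      (P.toBelief s.1) (Q.toBelief s.2.1) s.2.2) v := fun f s =>
    Γ.exists_isMixedValue_oneShot lam (P.continuous_extend Q _) _ _ _
  choose T hT using hex
  have hmaps : ∀ f ∈ {f : X → ℝ | ∀ s, |f s| ≤ N}, T f ∈ {f : X → ℝ | ∀ s, |f s| ≤ N} := by
    intro f hf s
    have hb := Γ.abs_oneShot_le hlam hN (fun p q ω => P.abs_extend_le Q (fun u v ω => hf (u, v, ω))
      p q ω) (P.toBelief s.1) (Q.toBelief s.2.1) s.2.2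
    obtain ⟨x⟩ : Nonempty (MixedAction K I) := inferInstance
    obtain ⟨y⟩ : Nonempty (MixedAction L J) := inferInstance
    have h1 := (hT f s).le_of_secures (c := -N)
      (Secures.of_pure x fun y => (abs_le.1 (hb x y)).1)
    have h2 := (hT f s).swap.le_of_secures (c := -N)
      (Secures.of_pure y fun x => neg_le_neg (abs_le.1 (hb x y)).2)
    rw [abs_le]
    constructor <;> linarith
  have hcontr : ∀ f ∈ {f : X → ℝ | ∀ s, |f s| ≤ N}, ∀ g ∈ {f : X → ℝ | ∀ s, |f s| ≤ N}, ∀ d,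
      (∀ x, |f x - g x| ≤ d) → ∀ x, |T f x - T g x| ≤ (1 - lam) * d := by
    intro f hf g hg d hd s
    refine Γ.abs_oneShot_sub_le hl1 (fun p q ω => ?_) (hT f s) (hT g s)
    have e1 := P.extend_le_add Q (w := cur f) (w' := cur g) (d := d)
      (fun u v ω => by linarith [(abs_le.1 (hd (u, v, ω))).2]) p q ω
    have e2 := P.extend_le_add Q (w := cur g) (w' := cur f) (d := d)
      (fun u v ω => by linarith [(abs_le.1 (hd (u, v, ω))).1]) p q ω
    rw [abs_le]
    constructor <;> linarith
  obtain ⟨f, hf, hfix⟩ := exists_fixedPoint_of_contraction {f : X → ℝ | ∀ s, |f s| ≤ N} T (R := N)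
    (c := 1 - lam) (by linarith) (by linarith) ⟨fun _ => 0, fun _ => by simpa using hN0⟩
    (fun f hf s => hf s) (fun u f hu hlim s => le_of_tendsto' (hlim s).abs fun n => hu n s)
    hmaps hcontr
  refine ⟨cur f, fun u v ω => hf _, fun u v ω => ?_⟩
  have := hT f (u, v, ω)
  rwa [hfix] at this

theorem isDiscountedValue_triangulatedGame (Γ : IncompleteInfoGame K L Ω I J)
    (P : Triangulation K) (Q : Triangulation L)
    {lam N : ℝ} (hlam : lam ∈ Set.Ioc (0 : ℝ) 1) (hN : ∀ k l ω i j, |Γ.g k l ω i j| ≤ N)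
    {w : P.Vertex → Q.Vertex → Ω → ℝ} (hw : ∀ u v ω, |w u v ω| ≤ N)
    (hval : ∀ u v ω, IsMixedValue
      (Γ.oneShot lam (P.extend Q w) (P.toBelief u) (Q.toBelief v) ω) (w u v ω))
    (u : P.Vertex) (v : Q.Vertex) (ω : Ω) :
    (Γ.triangulatedGame P Q).IsDiscountedValue lam (u, v, ω) (w u v ω) := by
  refine (Γ.triangulatedGame P Q).isDiscountedValue_of_isMixedValue
    (T := P.Vertex × Q.Vertex × Ω) hlam (R := N)
    (v := fun s => w s.1 s.2.1 s.2.2) ?_ ?_ (measurable_of_countable _) (fun s => hw _ _ _) ?_ ?_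
    (u, v, ω)
  · have hP : Measurable P.toBelief := measurable_of_countable _
    have hQ : Measurable Q.toBelief := measurable_of_countable _
    exact Γ.measurable_beliefPayoff (by fun_prop) (by fun_prop) (by fun_prop) (by fun_prop)
      (by fun_prop)
  · exact fun z => Γ.abs_beliefPayoff_le hN _ _ _ _ _
  · intro s
    simp only [Γ.auxPayoff_triangulatedGame P Q lam w]
    exact hval _ _ _
  · exact fun δ hδ => ⟨id, id, measurable_id, fun s => by simp [hδ.le]⟩

end IncompleteInfoGame

end

/-! ### Variance of barycentric splittings. -/

noncomputable section

set_option linter.unusedSectionVars false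

section EuclideanDist

variable {K : Type*} [Fintype K]

lemma euclideanDist_eq_sqrt (u v : K → ℝ) : euclideanDist u v = √(∑ k, (u k - v k) ^ 2) := by
  simp [euclideanDist, EuclideanSpace.dist_eq, Real.dist_eq]

lemma euclideanDist_nonneg (u v : K → ℝ) : 0 ≤ euclideanDist u v := dist_nonneg

lemma sq_euclideanDist (u v : K → ℝ) : euclideanDist u v ^ 2 = ∑ k, (u k - v k) ^ 2 := by
  rw [euclideanDist_eq_sqrt, Real.sq_sqrt (Finset.sum_nonneg fun k _ => sq_nonneg _)]

lemma abs_sub_le_euclideanDist (u v : K → ℝ) (k : K) : |u k - v k| ≤ euclideanDist u v := by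
  refine abs_le_of_sq_le_sq ?_ (euclideanDist_nonneg u v)
  rw [sq_euclideanDist]
  exact Finset.single_le_sum (f := fun k => (u k - v k) ^ 2) (fun k _ => sq_nonneg _)
    (Finset.mem_univ k)

lemma euclideanDist_le_sum (u v : K → ℝ) : euclideanDist u v ≤ ∑ k, |u k - v k| := by
  refine le_of_sq_le_sq ?_ (Finset.sum_nonneg fun k _ => abs_nonneg _)
  rw [sq_euclideanDist]
  simp only [← sq_abs (u _ - v _)]
  exact Finset.sum_sq_le_sq_sum_of_nonneg fun k _ => abs_nonneg _

end EuclideanDist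

namespace Triangulation

variable {K : Type*} [Fintype K] (P : Triangulation K)

lemma euclideanDist_le_stepsize {s : Finset (K → ℝ)} (hs : s ∈ P.complex.faces) {u v : K → ℝ}
    (hu : u ∈ s) (hv : v ∈ s) : euclideanDist u v ≤ P.stepsize := by
  refine le_csSup (Set.Finite.bddAbove ?_) ⟨s, hs, u, hu, v, hv, rfl⟩
  refine (P.finite_faces.biUnion fun s _ =>
    ((s ×ˢ s).finite_toSet.image fun z => euclideanDist z.1 z.2)).subset ?_
  rintro d ⟨s, hs, u, hu, v, hv, rfl⟩
  exact Set.mem_biUnion hs ⟨(u, v), by simp [hu, hv], rfl⟩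

lemma euclideanDist_le_of_split_ne_zero {p : stdSimplex ℝ K} {u v : P.Vertex}
    (hu : P.split p u ≠ 0) (hv : P.split p v ≠ 0) : euclideanDist u.1 v.1 ≤ P.stepsize := by
  obtain ⟨⟨s, hs, h⟩, -⟩ := P.isSplitting_split p
  exact P.euclideanDist_le_stepsize hs (by_contra fun hc => hu (h u hc))
    (by_contra fun hc => hv (h v hc))

lemma exists_split_ne_zero (p : stdSimplex ℝ K) : ∃ u, P.split p u ≠ 0 := by
  by_contra! h
  have := stdSimplex.sum_eq_one (P.split p)
  simp [h] at this

lemma stepsize_nonneg (p : stdSimplex ℝ K) : 0 ≤ P.stepsize := by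
  obtain ⟨u, hu⟩ := P.exists_split_ne_zero p
  exact (euclideanDist_nonneg _ _).trans (P.euclideanDist_le_of_split_ne_zero hu hu)

lemma abs_toBelief_sub_le {p : stdSimplex ℝ K} {u : P.Vertex} (hu : P.split p u ≠ 0) (k : K) :
    |P.toBelief u k - p k| ≤ P.stepsize := by
  have h1 : P.toBelief u k - p k = ∑ v, P.split p v * (P.toBelief u k - P.toBelief v k) := by
    simp only [mul_sub, Finset.sum_sub_distrib, ← Finset.sum_mul, stdSimplex.sum_eq_one, one_mul,
      P.sum_split_mul_toBelief]
  rw [h1]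
  refine (Finset.abs_sum_le_sum_abs _ _).trans ?_
  calc _ ≤ ∑ v, P.split p v * P.stepsize := Finset.sum_le_sum fun v _ => by
        rw [abs_mul, abs_of_nonneg (stdSimplex.zero_le (P.split p) v)]
        by_cases hv : P.split p v = 0
        · rw [hv, zero_mul, zero_mul]
        · exact mul_le_mul_of_nonneg_left ((abs_sub_le_euclideanDist u.1 v.1 k).trans
            (P.euclideanDist_le_of_split_ne_zero hu hv)) (stdSimplex.zero_le _ _)
    _ = P.stepsize := by rw [← Finset.sum_mul, stdSimplex.sum_eq_one, one_mul]

/-- The variance of the splitting of a belief. -/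
def splitVariance (p : stdSimplex ℝ K) : ℝ :=
  ∑ v, P.split p v * ∑ k, (P.toBelief v k - p k) ^ 2

/-- The second moment is least about the mean, which for the splitting of `p` is `p`. -/
lemma splitVariance_le (p : stdSimplex ℝ K) (c : K → ℝ) :
    P.splitVariance p ≤ ∑ v, P.split p v * ∑ k, (P.toBelief v k - c k) ^ 2 := by
  have h : ∀ k, ∑ v, P.split p v * (P.toBelief v k - p k) ^ 2 ≤
      ∑ v, P.split p v * (P.toBelief v k - c k) ^ 2 := fun k => by
    have h1 : ∑ v, P.split p v * (P.toBelief v k - c k) ^ 2 =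
        ∑ v, P.split p v * (P.toBelief v k - p k) ^ 2 +
          2 * (p k - c k) * (∑ v, P.split p v * P.toBelief v k - p k * ∑ v, P.split p v) +
          (p k - c k) ^ 2 * ∑ v, P.split p v := by
      rw [Finset.mul_sum, ← Finset.sum_sub_distrib, Finset.mul_sum, Finset.mul_sum,
        ← Finset.sum_add_distrib, ← Finset.sum_add_distrib]
      exact Finset.sum_congr rfl fun v _ => by ring
    rw [h1, P.sum_split_mul_toBelief, stdSimplex.sum_eq_one]
    nlinarith [sq_nonneg (p k - c k)]
  unfold splitVariance
  simp only [Finset.mul_sum]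
  rw [Finset.sum_comm, Finset.sum_comm (f := fun v k => P.split p v * (P.toBelief v k - c k) ^ 2)]
  exact Finset.sum_le_sum fun k _ => h k

/-- Second moment about `u`: this vertex contributes nothing and the others that carry weight lie
within the stepsize. If `u` has weight zero, any vertex with positive weight serves as centre
instead. -/
lemma splitVariance_le_one_sub_mul (p : stdSimplex ℝ K) (u : P.Vertex) :
    P.splitVariance p ≤ (1 - P.split p u) * P.stepsize ^ 2 := by
  classical
  have key : ∀ u' v : P.Vertex, P.split p u' ≠ 0 → P.split p v * ∑ k,
      (P.toBelief v k - P.toBelief u' k) ^ 2 ≤ P.split p v * P.stepsize ^ 2 := by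
    intro u' v hu'
    by_cases hv : P.split p v = 0
    · rw [hv, zero_mul, zero_mul]
    · refine mul_le_mul_of_nonneg_left ?_ (stdSimplex.zero_le _ _)
      calc _ = euclideanDist v.1 u'.1 ^ 2 := (sq_euclideanDist _ _).symm
        _ ≤ _ := pow_le_pow_left₀ (euclideanDist_nonneg _ _)
            (P.euclideanDist_le_of_split_ne_zero hv hu') 2
  by_cases hu : P.split p u = 0
  · obtain ⟨u', hu'⟩ := P.exists_split_ne_zero p
    refine (P.splitVariance_le p (P.toBelief u')).trans ?_
    refine (Finset.sum_le_sum fun v _ => key u' v hu').trans ?_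
    rw [← Finset.sum_mul, stdSimplex.sum_eq_one, hu, sub_zero]
  · refine (P.splitVariance_le p (P.toBelief u)).trans ?_
    have h1 : 1 - P.split p u = ∑ v ∈ Finset.univ.erase u, P.split p v := by
      rw [← stdSimplex.sum_eq_one (P.split p), ← Finset.add_sum_erase _ _ (Finset.mem_univ u)]
      ring
    rw [h1, Finset.sum_mul, ← Finset.add_sum_erase _ _ (Finset.mem_univ u)]
    simp only [sub_self, ne_eq, OfNat.ofNat_ne_zero, not_false_eq_true, zero_pow,
      Finset.sum_const_zero, mul_zero, zero_add]
    exact Finset.sum_le_sum fun v _ => key u v hu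

lemma split_toBelief_self (u : P.Vertex) : P.split (P.toBelief u) u = 1 := by
  classical
  let w : stdSimplex ℝ P.Vertex := ⟨Pi.single u 1, single_mem_stdSimplex ℝ u⟩
  have hw : ∀ v, w v = if v = u then 1 else 0 := fun v => Pi.single_apply u (1 : ℝ) v
  have : P.IsSplitting (P.toBelief u) w := by
    refine ⟨⟨{u.1}, u.2, fun v hv => ?_⟩, ?_⟩
    · rw [hw, if_neg]
      rintro rfl
      simp at hv
    · rw [Finset.sum_eq_single u]
      · rw [hw, if_pos rfl, one_smul]
        rfl
      · intro v _ hv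
        rw [hw, if_neg hv, zero_smul]
      · simp
  rw [(P.existsUnique_isSplitting _).unique (P.isSplitting_split _) this, hw, if_pos rfl]

variable {P}

/-- Regularity is assumed only at vertices of positive weight. Continuity of the splitting along the
segment from `u` to `p` extends it to all vertices. -/
lemma IsRegular.one_sub_split_le {α C : ℝ} (hP : P.IsRegular α C) (hC : 0 ≤ C) (u : P.Vertex)
    (p : stdSimplex ℝ K) : 1 - P.split p u ≤ C / P.stepsize * ∑ k, |p k - P.toBelief u k| := by
  have hCs : 0 ≤ C / P.stepsize := div_nonneg hC (P.stepsize_nonneg p)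
  have bound : ∀ r : stdSimplex ℝ K, 0 < P.split r u →
      1 - P.split r u ≤ C / P.stepsize * ∑ k, |r k - P.toBelief u k| := fun r hr => by
    refine (hP.2 r u hr).trans (mul_le_mul_of_nonneg_left ?_ hCs)
    refine (euclideanDist_le_sum _ _).trans (le_of_eq ?_)
    exact Finset.sum_congr rfl fun k _ => abs_sub_comm _ _
  rcases (stdSimplex.zero_le (P.split p) u).eq_or_lt with h0 | h0
  swap
  · exact bound p h0
  have hmem : ∀ t : unitInterval, (fun k => (1 - t : ℝ) * P.toBelief u k + t * p k) ∈
      stdSimplex ℝ K := fun t => convex_stdSimplex ℝ K (P.toBelief u).2 p.2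
        (sub_nonneg.2 t.2.2) t.2.1 (by ring)
  let γ : unitInterval → stdSimplex ℝ K := fun t => ⟨_, hmem t⟩
  have hγ : Continuous γ := by
    refine Continuous.subtype_mk (continuous_pi fun k => ?_) _
    fun_prop
  have hγ0 : γ 0 = P.toBelief u := by
    refine stdSimplex.ext (funext fun k => ?_)
    change (1 - ((0 : unitInterval) : ℝ)) * P.toBelief u k + ((0 : unitInterval) : ℝ) * p k = _
    simp
  have hγ1 : γ 1 = p := by
    refine stdSimplex.ext (funext fun k => ?_)
    change (1 - ((1 : unitInterval) : ℝ)) * P.toBelief u k + ((1 : unitInterval) : ℝ) * p k = _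
    simp
  have hφ : Continuous fun t => P.split (γ t) u :=
    (continuous_stdSimplex_apply u).comp (P.continuous_split.comp hγ)
  rw [← h0, sub_zero]
  -- The weight of `u` falls continuously from 1 to 0 along the segment, so it takes any small value
  -- `c` at a point no farther from `u` than `p` is.
  refine le_of_forall_pos_le_add fun c hc => ?_
  rcases le_or_gt 1 c with h1 | h1
  · exact h1.trans (le_add_of_nonneg_left (mul_nonneg hCs (Finset.sum_nonneg fun _ _ => abs_nonneg _)))
  obtain ⟨t, ht⟩ : ∃ t, P.split (γ t) u = c := by
    refine mem_range_of_exists_le_of_exists_ge hφ ⟨1, ?_⟩ ⟨0, ?_⟩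
    · rw [hγ1, ← h0]
      exact hc.le
    · rw [hγ0, P.split_toBelief_self]
      exact h1.le
  have h2 := bound (γ t) (by rw [ht]; exact hc)
  rw [ht] at h2
  have h3 : ∑ k, |γ t k - P.toBelief u k| ≤ ∑ k, |p k - P.toBelief u k| := by
    refine Finset.sum_le_sum fun k _ => ?_
    have : γ t k - P.toBelief u k = t * (p k - P.toBelief u k) := by
      change (1 - (t : ℝ)) * P.toBelief u k + t * p k - _ = _
      ring
    rw [this, abs_mul, abs_of_nonneg t.2.1]
    exact mul_le_of_le_one_left (abs_nonneg _) t.2.2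
  have h4 := mul_le_mul_of_nonneg_left h3 hCs
  linarith

/-- Here regularity of the triangulation takes effect: one factor of the squared stepsize cancels
the denominator, the other is below `α`. The noise thus vanishes linearly as the posterior `p`
approaches the current vertex `u`. -/
lemma IsRegular.splitVariance_le_mul {α C : ℝ} (hP : P.IsRegular α C) (hC : 0 ≤ C) (u : P.Vertex)
    (p : stdSimplex ℝ K) : P.splitVariance p ≤ C * α * ∑ k, |p k - P.toBelief u k| := by
  have hs := P.stepsize_nonneg p
  have hnn : 0 ≤ ∑ k, |p k - P.toBelief u k| := Finset.sum_nonneg fun _ _ => abs_nonneg _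
  refine (P.splitVariance_le_one_sub_mul p u).trans ?_
  rcases hs.eq_or_lt with h0 | h0
  · rw [← h0]
    simp only [ne_eq, OfNat.ofNat_ne_zero, not_false_eq_true, zero_pow, mul_zero]
    exact mul_nonneg (mul_nonneg hC (hs.trans hP.1.le)) hnn
  · calc _ ≤ C / P.stepsize * (∑ k, |p k - P.toBelief u k|) * P.stepsize ^ 2 :=
          mul_le_mul_of_nonneg_right (hP.one_sub_split_le hC u p) (sq_nonneg _)
      _ = C * P.stepsize * ∑ k, |p k - P.toBelief u k| := by field_simp
      _ ≤ _ := mul_le_mul_of_nonneg_right (mul_le_mul_of_nonneg_left hP.1.le hC) hnn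

lemma IsRegular.splitVariance_le_sq {α C : ℝ} (hP : P.IsRegular α C) (p : stdSimplex ℝ K) :
    P.splitVariance p ≤ α ^ 2 := by
  have hs := P.stepsize_nonneg p
  obtain ⟨u, -⟩ := P.exists_split_ne_zero p
  refine (P.splitVariance_le_one_sub_mul p u).trans ?_
  calc _ ≤ 1 * P.stepsize ^ 2 := mul_le_mul_of_nonneg_right
        (by linarith [stdSimplex.zero_le (P.split p) u]) (sq_nonneg _)
    _ ≤ _ := by rw [one_mul]; exact pow_le_pow_left₀ hs hP.1.le 2

end Triangulation

end

/-! ### Averages of beliefs and merging of nearby posteriors. -/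

noncomputable section

set_option linter.unusedSectionVars false

section Averages

variable {K I : Type*} [Fintype K] [Fintype I]

lemma sum_abs_sub_le_two (p p' : stdSimplex ℝ K) : ∑ k, |p k - p' k| ≤ 2 := by
  calc _ ≤ ∑ k, (p k + p' k) := Finset.sum_le_sum fun k _ => by
        have h1 := stdSimplex.zero_le p k
        have h2 := stdSimplex.zero_le p' k
        rw [abs_le]
        constructor <;> linarith
    _ = 2 := by
        rw [Finset.sum_add_distrib, stdSimplex.sum_eq_one, stdSimplex.sum_eq_one]
        norm_num

lemma sum_sq_le_one (p : stdSimplex ℝ K) : ∑ k, p k ^ 2 ≤ 1 := by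
  rw [← stdSimplex.sum_eq_one p]
  exact Finset.sum_le_sum fun k _ => by
    have h1 := stdSimplex.zero_le p k
    have h2 : p k ≤ 1 := by
      rw [← stdSimplex.sum_eq_one p]
      exact Finset.single_le_sum (f := fun k => p k) (fun k _ => stdSimplex.zero_le p k)
        (Finset.mem_univ k)
    nlinarith

/-- Decomposition of a second moment into variance and squared bias. -/
lemma sum_mul_sum_sq_sub {w : I → ℝ} (hw : ∑ i, w i = 1) (z : I → K → ℝ) {m : K → ℝ}
    (hm : ∀ k, ∑ i, w i * z i k = m k) (c : K → ℝ) :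
    ∑ i, w i * ∑ k, (z i k - c k) ^ 2 =
      ∑ i, w i * ∑ k, (z i k - m k) ^ 2 + ∑ k, (m k - c k) ^ 2 := by
  have h : ∀ k, ∑ i, w i * (z i k - c k) ^ 2 =
      ∑ i, w i * (z i k - m k) ^ 2 + (m k - c k) ^ 2 := fun k => by
    have h1 : ∑ i, w i * (z i k - c k) ^ 2 = ∑ i, w i * (z i k - m k) ^ 2 +
        2 * (m k - c k) * (∑ i, w i * z i k - m k * ∑ i, w i) +
          (m k - c k) ^ 2 * ∑ i, w i := by
      rw [Finset.mul_sum, ← Finset.sum_sub_distrib, Finset.mul_sum, Finset.mul_sum,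
        ← Finset.sum_add_distrib, ← Finset.sum_add_distrib]
      exact Finset.sum_congr rfl fun v _ => by ring
    rw [h1, hm, hw]
    ring
  simp only [Finset.mul_sum]
  rw [Finset.sum_comm, Finset.sum_comm (f := fun i k => w i * (z i k - m k) ^ 2),
    ← Finset.sum_add_distrib]
  exact Finset.sum_congr rfl fun k _ => h k

/-- The belief `p` is only a default for the case of total weight zero. -/
lemma exists_mean (s : Finset I) {w : I → ℝ} (hw : ∀ i, 0 ≤ w i) (z : I → stdSimplex ℝ K)
    (p : stdSimplex ℝ K) :
    ∃ m : stdSimplex ℝ K, ∀ k, ∑ i ∈ s, w i * z i k = (∑ i ∈ s, w i) * m k := by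
  by_cases h : ∑ i ∈ s, w i = 0
  · refine ⟨p, fun k => ?_⟩
    rw [h, zero_mul]
    rw [Finset.sum_eq_zero_iff_of_nonneg fun i _ => hw i] at h
    exact Finset.sum_eq_zero fun i hi => by rw [h i hi, zero_mul]
  · refine ⟨⟨fun k => (∑ i ∈ s, w i * z i k) / ∑ i ∈ s, w i, fun k => div_nonneg
      (Finset.sum_nonneg fun i _ => mul_nonneg (hw i) (stdSimplex.zero_le (z i) k))
      (Finset.sum_nonneg fun i _ => hw i), ?_⟩, fun k => ?_⟩
    · rw [← Finset.sum_div, Finset.sum_comm]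
      simp only [← Finset.mul_sum, stdSimplex.sum_eq_one, mul_one]
      exact div_self h
    · change _ = (∑ i ∈ s, w i) * ((∑ i ∈ s, w i * z i k) / ∑ i ∈ s, w i)
      field_simp

/-- Superadditivity of the homogeneous extension of a function on a simplex. -/
def SimplexConcave (f : stdSimplex ℝ K → ℝ) : Prop :=
  ∀ p₁ p₂ p r s t, 0 ≤ r → 0 ≤ s → 0 ≤ t → (∀ k, s * p₁ k + t * p₂ k = r * p k) →
    s * f p₁ + t * f p₂ ≤ r * f p

/-- Jensen's inequality. -/
lemma SimplexConcave.sum_le {f : stdSimplex ℝ K → ℝ} (hf : SimplexConcave f) {w : I → ℝ}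
    (hw : ∀ i, 0 ≤ w i) (z : I → stdSimplex ℝ K) (s : Finset I) :
    ∀ (r : ℝ) (p : stdSimplex ℝ K), 0 ≤ r → (∀ k, ∑ i ∈ s, w i * z i k = r * p k) →
      ∑ i ∈ s, w i * f (z i) ≤ r * f p := by
  classical
  induction s using Finset.induction_on with
  | empty =>
    intro r p hr h
    have : r = 0 := by
      have := Finset.sum_congr (rfl : (Finset.univ : Finset K) = _) fun k _ => h k
      simpa only [Finset.sum_empty, Finset.sum_const_zero, ← Finset.mul_sum,
        stdSimplex.sum_eq_one, mul_one, eq_comm] using this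
    simp [this]
  | insert a s ha ih =>
    intro r p hr h
    obtain ⟨m, hm⟩ := exists_mean s hw z p
    have hs : 0 ≤ ∑ i ∈ s, w i := Finset.sum_nonneg fun i _ => hw i
    have h1 := ih _ m hs hm
    have h2 := hf (z a) m p r (w a) _ hr (hw a) hs fun k => by
      rw [← hm, ← h, Finset.sum_insert ha]
    rw [Finset.sum_insert ha]
    linarith

/-- The points of a decomposition of `z̄` that are close to `z̄` can be merged. -/
lemma exists_merge {w : I → ℝ} (hw : ∀ i, 0 ≤ w i) (hw1 : ∑ i, w i = 1) (z : I → stdSimplex ℝ K)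
    (m : stdSimplex ℝ K) (hm : ∀ k, ∑ i, w i * z i k = m k) {r : ℝ} (hr : 0 < r) :
    ∃ z' : I → stdSimplex ℝ K, (∀ k, ∑ i, w i * z' i k = m k) ∧
      (∀ i, w i ≠ 0 → ∑ k, |z' i k - z i k| ≤ 2 * r) ∧
      (r * ∑ i, w i * ∑ k, |z' i k - m k| ≤ 2 * ∑ i, w i * (∑ k, |z' i k - m k|) ^ 2) ∧
      ∀ f, SimplexConcave f → ∑ i, w i * f (z i) ≤ ∑ i, w i * f (z' i) := by
  classical
  -- All points within `r` of the mean are replaced by their own average.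
  let S : Finset I := Finset.univ.filter fun i => ∑ k, |z i k - m k| ≤ r
  obtain ⟨μ, hμ⟩ := exists_mean S hw z m
  let z' : I → stdSimplex ℝ K := fun i => if i ∈ S then μ else z i
  have hS : ∀ i ∈ S, z' i = μ := fun i hi => if_pos hi
  have hSc : ∀ i ∈ Sᶜ, z' i = z i := fun i hi => if_neg (Finset.mem_compl.1 hi)
  have split : ∀ F : I → ℝ, ∑ i, F i = ∑ i ∈ S, F i + ∑ i ∈ Sᶜ, F i := fun F =>
    (Finset.sum_add_sum_compl S F).symm
  have hsum : ∀ G : stdSimplex ℝ K → ℝ, ∑ i, w i * G (z' i) =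
      (∑ i ∈ S, w i) * G μ + ∑ i ∈ Sᶜ, w i * G (z i) := fun G => by
    rw [split, Finset.sum_mul]
    exact congrArg₂ _ (Finset.sum_congr rfl fun i hi => by rw [hS i hi])
      (Finset.sum_congr rfl fun i hi => by rw [hSc i hi])
  have hW : 0 ≤ ∑ i ∈ S, w i := Finset.sum_nonneg fun i _ => hw i
  have hmean : ∀ k, ∑ i, w i * z' i k = m k := fun k => by
    rw [← hm, hsum fun q => q k, split fun i => w i * z i k, hμ]
  have hdev : ∀ (s : Finset I) k, |∑ i ∈ s, w i * (z i k - m k)| ≤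
      ∑ i ∈ s, w i * |z i k - m k| := fun s k => (Finset.abs_sum_le_sum_abs _ _).trans
    (le_of_eq (Finset.sum_congr rfl fun i _ => by rw [abs_mul, abs_of_nonneg (hw i)]))
  have hdev' : ∀ s : Finset I, ∑ k, |∑ i ∈ s, w i * (z i k - m k)| ≤
      ∑ i ∈ s, w i * ∑ k, |z i k - m k| := fun s => by
    refine (Finset.sum_le_sum fun k _ => hdev s k).trans (le_of_eq ?_)
    rw [Finset.sum_comm]
    simp only [Finset.mul_sum]
  have hμm : ∀ k, (∑ i ∈ S, w i) * (μ k - m k) = ∑ i ∈ S, w i * (z i k - m k) := fun k => by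
    simp only [mul_sub, Finset.sum_sub_distrib, hμ, Finset.sum_mul]
  have hμabs : (∑ i ∈ S, w i) * ∑ k, |μ k - m k| = ∑ k, |∑ i ∈ S, w i * (z i k - m k)| := by
    rw [Finset.mul_sum]
    exact Finset.sum_congr rfl fun k _ => by rw [← hμm, abs_mul, abs_of_nonneg hW]
  refine ⟨z', hmean, fun i hi => ?_, ?_, fun f hf => ?_⟩
  · by_cases hiS : i ∈ S
    · have hpos : 0 < ∑ i ∈ S, w i := Finset.sum_pos' (fun i _ => hw i)
        ⟨i, hiS, (hw i).lt_of_ne' hi⟩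
      have h1 : ∑ k, |μ k - m k| ≤ r := by
        have h2 : ∑ i ∈ S, w i * ∑ k, |z i k - m k| ≤ ∑ i ∈ S, w i * r :=
          Finset.sum_le_sum fun i hi =>
            mul_le_mul_of_nonneg_left (Finset.mem_filter.1 hi).2 (hw i)
        rw [← Finset.sum_mul] at h2
        exact le_of_mul_le_mul_left ((hμabs.trans_le (hdev' S)).trans h2) hpos
      have h3 := (Finset.mem_filter.1 hiS).2
      rw [hS i hiS]
      calc _ ≤ ∑ k, (|μ k - m k| + |z i k - m k|) := Finset.sum_le_sum fun k _ => by
            rw [abs_sub_comm (z i k)]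
            exact abs_sub_le _ _ _
        _ ≤ _ := by rw [Finset.sum_add_distrib]; linarith
    · rw [hSc i (Finset.mem_compl.2 hiS)]
      simp [hr.le]
  -- Outside `S` distances exceed `r`, so `r` times the distance is at most its square. The
  -- deviation of the merged point balances the total deviation outside `S`, which accounts for the
  -- factor 2.
  · have hbig : r * ∑ i ∈ Sᶜ, w i * ∑ k, |z i k - m k| ≤
        ∑ i ∈ Sᶜ, w i * (∑ k, |z i k - m k|) ^ 2 := by
      rw [Finset.mul_sum]
      refine Finset.sum_le_sum fun i hi => ?_
      have h1 : r < ∑ k, |z i k - m k| := by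
        by_contra! h
        exact Finset.mem_compl.1 hi (Finset.mem_filter.2 ⟨Finset.mem_univ i, h⟩)
      rw [mul_left_comm]
      exact mul_le_mul_of_nonneg_left (by nlinarith) (hw i)
    have hsmall : (∑ i ∈ S, w i) * ∑ k, |μ k - m k| ≤ ∑ i ∈ Sᶜ, w i * ∑ k, |z i k - m k| := by
      rw [hμabs]
      refine le_trans (le_of_eq ?_) (hdev' Sᶜ)
      refine Finset.sum_congr rfl fun k _ => ?_
      have : ∑ i, w i * (z i k - m k) = 0 := by
        simp only [mul_sub, Finset.sum_sub_distrib, hm, ← Finset.sum_mul, hw1, one_mul, sub_self]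
      rw [split] at this
      rw [eq_neg_of_add_eq_zero_left this, abs_neg]
    have hpos : 0 ≤ (∑ i ∈ S, w i) * (∑ k, |μ k - m k|) ^ 2 := mul_nonneg hW (sq_nonneg _)
    rw [hsum fun q => ∑ k, |q k - m k|, hsum fun q => (∑ k, |q k - m k|) ^ 2]
    nlinarith
  · rw [hsum, split fun i => w i * f (z i)]
    gcongr
    exact hf.sum_le hw z S _ μ hW hμ

end Averages

end

/-! ### Imitating an action of the belief game at a nearby belief. -/

noncomputable section

set_option linter.unusedSectionVars false

namespace IncompleteInfoGame

variable {K L Ω I J : Type*} [Fintype K] [Fintype L] [Fintype Ω] [Fintype I] [Fintype J]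

/-- A mixed action at the belief `p'` can be imitated at a nearby belief `p = (1 - β) p' + β π`,
up to merging the actions that reveal little. -/
lemma exists_imitation [Nonempty I] {Γ : IncompleteInfoGame K L Ω I J} {N lam : ℝ}
    (hlam : lam ∈ Set.Ioc (0 : ℝ) 1) (hN : ∀ k l ω i j, |Γ.g k l ω i j| ≤ N) (hN0 : 0 ≤ N)
    {i₀ : I} {j₀ : J} {v h : stdSimplex ℝ K → stdSimplex ℝ L → Ω → ℝ}
    (hv : Γ.IsRegularValue N i₀ j₀ v) {ω₀ : Ω} (hω₀ : ∀ ω, ω ≠ ω₀ → Γ.IsAbsorbing ω)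
    (hh : ∀ ω, ω ≠ ω₀ → ∀ p q, h p q ω = Γ.constPayoff i₀ j₀ p q ω)
    {p p' π : stdSimplex ℝ K} {β r κ θ Φ Λ D e : ℝ} (hβ0 : 0 ≤ β) (hβ : β ≤ 1 / 2) (hr : 0 < r)
    (hp : ∀ k, p k = (1 - β) * p' k + β * π k) (V : stdSimplex ℝ K → ℝ) (hV0 : ∀ z, 0 ≤ V z)
    (hV : ∀ z, V z ≤ D * ∑ k, |z k - p k| + e) (hκ0 : 0 ≤ κ) (hΦ : 0 ≤ Φ) (hΛ : 0 ≤ Λ) (hD : 0 ≤ D)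
    (he : 0 ≤ e)
    (hκ : 8 * Fintype.card K * Λ * D ≤ κ * r) (hθ : N * (4 * r + 2 * β) ≤ θ)
    (hlow : ∀ z z' : stdSimplex ℝ K, (∀ k, p' k = 0 → z' k = 0) →
      (∀ k, z k = (1 - β) * z' k + β * π k) → ∀ q,
      v z' q ω₀ - Φ - Λ * V z + κ * (∑ k, z k ^ 2 - 1) - θ ≤ h z q ω₀)
    (q : stdSimplex ℝ L) (x : MixedAction K I) :
    ∃ x' : MixedAction K I, ∀ y, Γ.oneShot lam v p' q ω₀ x y -
      (lam * (N * (2 * r + 2 * β)) + (Φ + θ + κ * (1 - ∑ k, p k ^ 2) + Λ * e)) ≤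
        Γ.oneShot lam h p q ω₀ x' y := by
  have hl0 := hlam.1
  have hl1 := hlam.2
  set w := actionProb p' x with hw_def
  set z := posteriorBelief p' x with hz_def
  have hw : ∀ i, 0 ≤ w i := actionProb_nonneg p' x
  have hw1 : ∑ i, w i = 1 := sum_actionProb p' x
  -- The actions keep their probabilities; only the posteriors they induce are merged.
  obtain ⟨z', hm1, hm2, hm3, hm4⟩ := exists_merge hw hw1 z p'
    (sum_actionProb_mul_posteriorBelief p' x) hr
  have hmem : ∀ i, (fun k => (1 - β) * z' i k + β * π k) ∈ stdSimplex ℝ K := fun i =>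
    convex_stdSimplex ℝ K (z' i).2 π.2 (by linarith) hβ0 (by ring)
  -- The component `π` of the belief stays uninformative, so each new posterior has the same
  -- perturbation `π`.
  let u : I → stdSimplex ℝ K := fun i => ⟨_, hmem i⟩
  have hu : ∀ i k, u i k = (1 - β) * z' i k + β * π k := fun i k => rfl
  have hup : ∀ k, ∑ i, w i * u i k = p k := fun k => by
    have : ∀ i, w i * u i k = (1 - β) * (w i * z' i k) + w i * (β * π k) := fun i => by
      rw [hu]; ring
    simp only [this, Finset.sum_add_distrib, ← Finset.mul_sum, hm1, ← Finset.sum_mul, hw1, hp,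
      one_mul]
  obtain ⟨x', hx'⟩ := exists_mixedAction_of_joint p (fun i k => w i * u i k)
    (fun i k => mul_nonneg (hw i) (stdSimplex.zero_le _ _)) hup
  have hwx' : ∀ i, actionProb p x' i = w i := fun i => by
    unfold actionProb
    simp only [hx', ← Finset.mul_sum, stdSimplex.sum_eq_one, mul_one]
  have hzx' : ∀ i, w i ≠ 0 → posteriorBelief p x' i = u i := fun i hi =>
    posteriorBelief_eq_of_mul_eq (by rwa [hwx']) fun k => by rw [hwx', hx']
  have hdist : ∀ i, w i ≠ 0 → ∑ k, |u i k - z i k| ≤ 2 * r + 2 * β := fun i hi => by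
    have h1 := hm2 i hi
    have h2 := sum_abs_sub_le_two π (z' i)
    calc _ ≤ ∑ k, (|z' i k - z i k| + β * |π k - z' i k|) := Finset.sum_le_sum fun k _ => by
          rw [hu, show (1 - β) * z' i k + β * π k - z i k =
            (z' i k - z i k) + β * (π k - z' i k) by ring]
          refine (abs_add_le _ _).trans (le_of_eq ?_)
          rw [abs_mul, abs_of_nonneg hβ0]
      _ ≤ _ := by
          rw [Finset.sum_add_distrib, ← Finset.mul_sum]
          nlinarith
  refine ⟨x', fun y => ?_⟩
  -- stage payoffs
  have hpay : Γ.beliefPayoff p' q ω₀ x y - N * (2 * r + 2 * β) ≤ Γ.beliefPayoff p q ω₀ x' y := by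
    have h1 := Γ.beliefPayoff_sub_le hN p' p q ω₀ x x' y 1 1
    have h2 : ∑ k, ∑ i, |1 * (p' k * x k i) - 1 * (p k * x' k i)| ≤ 2 * r + 2 * β := by
      have h4 : ∑ i, w i * (2 * r + 2 * β) = 2 * r + 2 * β := by rw [← Finset.sum_mul, hw1, one_mul]
      rw [Finset.sum_comm, ← h4]
      refine Finset.sum_le_sum fun i _ => ?_
      have h3 : ∀ k, |1 * (p' k * x k i) - 1 * (p k * x' k i)| = w i * |u i k - z i k| := fun k => by
        rw [hx', ← actionProb_mul_posteriorBelief p' x i k, one_mul, one_mul, ← mul_sub, abs_mul,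
          abs_of_nonneg (hw i), abs_sub_comm]
      simp only [h3, ← Finset.mul_sum]
      by_cases hi : w i = 0
      · simp [hi]
      · exact mul_le_mul_of_nonneg_left (hdist i hi) (hw i)
    nlinarith
  -- continuation payoffs
  let G : I → J → ℝ := fun i j => v (z' i) (posteriorBelief q y j) ω₀ -
    v (z i) (posteriorBelief q y j) ω₀
  let F : I → ℝ := fun i => - Φ - Λ * V (u i) + κ * (∑ k, u i k ^ 2 - 1) - θ
  have hpt : ∀ i j ω, w i ≠ 0 → v (z i) (posteriorBelief q y j) ω + (G i j + F i) ≤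
      h (u i) (posteriorBelief q y j) ω := fun i j ω hi => by
    by_cases hω : ω = ω₀
    · have hsupp : ∀ k, p' k = 0 → z' i k = 0 := fun k hk => by
        have h1 := hm1 k
        rw [hk, Finset.sum_eq_zero_iff_of_nonneg fun i _ =>
          mul_nonneg (hw i) (stdSimplex.zero_le _ _)] at h1
        exact (mul_eq_zero.1 (h1 i (Finset.mem_univ i))).resolve_left hi
      have h1 := hlow (u i) (z' i) hsupp (hu i) (posteriorBelief q y j)
      simp only [G, F, hω]
      linarith
    -- After absorption the belief error costs at most `N * (2 * r + 2 * β)` and `G` at most `N * (2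
    -- * r)`; `θ`, no longer deducted, covers both.
    · have h1 := (abs_le.1 (hv.abs_sub_left_le (u i) (z i) (posteriorBelief q y j) ω)).1
      rw [hv.absorbing ω (hω₀ ω hω) (u i), ← hh ω hω] at h1
      have h2 := (abs_le.1 (hv.abs_sub_left_le (z' i) (z i) (posteriorBelief q y j) ω₀)).2
      have h3 := mul_le_mul_of_nonneg_left (hdist i hi) hN0
      have h4 := mul_le_mul_of_nonneg_left (hm2 i hi) hN0
      have h5 := mul_nonneg hΛ (hV0 (u i))
      have h6 := mul_nonneg hκ0 (sub_nonneg.2 (sum_sq_le_one (u i)))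
      simp only [G, F]
      linarith
  have hF : -(Φ + θ + κ * (1 - ∑ k, p k ^ 2) + Λ * e) ≤ ∑ i, w i * F i := by
    have e1 : ∀ i, ∑ k, |u i k - p k| = (1 - β) * ∑ k, |z' i k - p' k| := fun i => by
      rw [Finset.mul_sum]
      refine Finset.sum_congr rfl fun k _ => ?_
      rw [hu, hp, ← abs_of_nonneg (show 0 ≤ 1 - β by linarith), ← abs_mul,
        abs_of_nonneg (show 0 ≤ 1 - β by linarith)]
      congr 1
      ring
    have e2 : ∀ i, ∑ k, (u i k - p k) ^ 2 = (1 - β) ^ 2 * ∑ k, (z' i k - p' k) ^ 2 := fun i => by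
      rw [Finset.mul_sum]
      refine Finset.sum_congr rfl fun k _ => ?_
      rw [hu, hp]
      ring
    have e3 := sum_mul_sum_sq_sub hw1 (fun i k => u i k) hup 0
    -- The expected squared norm of the posteriors exceeds that of `p` by their variance, which is
    -- the resource that pays for the splittings.
    simp only [Pi.zero_apply, sub_zero, e2] at e3
    have e4 : ∑ i, w i * F i = -Φ - Λ * ∑ i, w i * V (u i) +
        κ * (∑ i, w i * ∑ k, u i k ^ 2 - 1) - θ := by
      have : ∀ i, w i * F i = w i * (-Φ - κ - θ) - Λ * (w i * V (u i)) +
        κ * (w i * ∑ k, u i k ^ 2) := fun i => by simp only [F]; ring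
      simp only [this, Finset.sum_add_distrib, Finset.sum_sub_distrib, ← Finset.mul_sum,
        ← Finset.sum_mul, hw1]
      ring
    have e5 : ∑ i, w i * V (u i) ≤ D * ∑ i, w i * ∑ k, |z' i k - p' k| + e := by
      calc _ ≤ ∑ i, w i * (D * ∑ k, |z' i k - p' k| + e) := Finset.sum_le_sum fun i _ => by
            refine mul_le_mul_of_nonneg_left ((hV (u i)).trans ?_) (hw i)
            rw [e1]
            have : 0 ≤ ∑ k, |z' i k - p' k| := Finset.sum_nonneg fun _ _ => abs_nonneg _
            nlinarith [mul_nonneg hD this]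
        _ = _ := by
            rw [sum_mul_add_const hw1, Finset.mul_sum]
            congr 1
            exact Finset.sum_congr rfl fun i _ => by ring
    set A := ∑ i, w i * ∑ k, |z' i k - p' k| with hA
    set B := ∑ i, w i * ∑ k, (z' i k - p' k) ^ 2 with hB
    have e6 : ∑ i, w i * ((1 - β) ^ 2 * ∑ k, (z' i k - p' k) ^ 2) = (1 - β) ^ 2 * B := by
      rw [hB, Finset.mul_sum]
      exact Finset.sum_congr rfl fun i _ => by ring
    have e7 : ∑ i, w i * (∑ k, |z' i k - p' k|) ^ 2 ≤ Fintype.card K * B := by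
      rw [hB, Finset.mul_sum]
      refine Finset.sum_le_sum fun i _ => ?_
      rw [mul_left_comm]
      refine mul_le_mul_of_nonneg_left ?_ (hw i)
      have := sq_sum_le_card_mul_sum_sq (s := (Finset.univ : Finset K))
        (f := fun k => |z' i k - p' k|)
      simpa only [sq_abs, Finset.card_univ] using this
    have hB0 : 0 ≤ B := Finset.sum_nonneg fun i _ =>
      mul_nonneg (hw i) (Finset.sum_nonneg fun k _ => sq_nonneg _)
    -- Merging gives `r * A ≤ 2 * card K * B`, and `β ≤ 1 / 2` gives `(1 - β) ^ 2 ≥ 1 / 4`: hence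
    -- the factor 8 in `hκ`.
    have e8 : Λ * D * A ≤ κ * ((1 - β) ^ 2 * B) := by
      have h1 : r * (Λ * D * A) ≤ r * (κ * (1 / 4 * B)) := by
        calc r * (Λ * D * A) = Λ * D * (r * A) := by ring
          _ ≤ Λ * D * (2 * (Fintype.card K * B)) :=
              mul_le_mul_of_nonneg_left (by linarith) (mul_nonneg hΛ hD)
          _ = (8 * Fintype.card K * Λ * D) * (B / 4) := by ring
          _ ≤ (κ * r) * (B / 4) := mul_le_mul_of_nonneg_right hκ (by linarith)
          _ = _ := by ring
      refine (le_of_mul_le_mul_left h1 hr).trans (mul_le_mul_of_nonneg_left ?_ hκ0)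
      exact mul_le_mul_of_nonneg_right (by nlinarith) hB0
    rw [e4, e3, e6]
    have e9 := mul_le_mul_of_nonneg_left e5 hΛ
    linarith
  have hcont : ∑ j, actionProb q y j * ∑ i, w i * ∑ ω', Γ.ρ ω₀ i j ω' *
        v (z i) (posteriorBelief q y j) ω' - (Φ + θ + κ * (1 - ∑ k, p k ^ 2) + Λ * e) ≤
      ∑ j, actionProb q y j * ∑ i, w i * ∑ ω', Γ.ρ ω₀ i j ω' *
        h (posteriorBelief p x' i) (posteriorBelief q y j) ω' := by
    rw [sub_eq_add_neg, ← sum_mul_add_const (sum_actionProb q y)]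
    refine Finset.sum_le_sum fun j _ => mul_le_mul_of_nonneg_left ?_ (actionProb_nonneg _ _ _)
    have h1 : ∀ i, w i * (∑ ω', Γ.ρ ω₀ i j ω' * v (z i) (posteriorBelief q y j) ω' +
        (G i j + F i)) ≤ w i * ∑ ω', Γ.ρ ω₀ i j ω' *
          h (posteriorBelief p x' i) (posteriorBelief q y j) ω' := fun i => by
      by_cases hi : w i = 0
      · simp [hi]
      · refine mul_le_mul_of_nonneg_left ?_ (hw i)
        rw [← sum_mul_add_const (stdSimplex.sum_eq_one (Γ.ρ ω₀ i j)), hzx' i hi]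
        exact Finset.sum_le_sum fun ω' _ => mul_le_mul_of_nonneg_left (hpt i j ω' hi)
          (stdSimplex.zero_le _ _)
    have h2 := Finset.sum_le_sum fun i (_ : i ∈ Finset.univ) => h1 i
    simp only [mul_add, Finset.sum_add_distrib] at h2
    have h3 : 0 ≤ ∑ i, w i * G i j := by
      have := hm4 (fun p => v p (posteriorBelief q y j) ω₀) (hv.concave ω₀ _)
      simp only [G, mul_sub, Finset.sum_sub_distrib]
      linarith
    linarith
  rw [oneShot_eq, oneShot_eq]
  simp only [hwx']
  -- Being nonnegative, this loss may be counted in full although the continuation has weight only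
  -- `1 - lam`.
  have hE : 0 ≤ Φ + θ + κ * (1 - ∑ k, p k ^ 2) + Λ * e := by
    have h1 := mul_nonneg hκ0 (sub_nonneg.2 (sum_sq_le_one p))
    have h2 := mul_nonneg hΛ he
    have h3 : 0 ≤ N * (4 * r + 2 * β) := mul_nonneg hN0 (by linarith)
    linarith
  nlinarith

end IncompleteInfoGame

end

/-! ### The perturbed value function and its average over splittings. -/

noncomputable section

set_option linter.unusedSectionVars false

section PerturbedSup

variable {K : Type*} [Fintype K]

/-- The best value of `f` at a belief `p'` from which `p` arises by adding a perturbation of weight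
`β`, with a quadratic penalty for perturbations that differ from `c`. -/
def perturbedSup (N β Λ : ℝ) (c : stdSimplex ℝ K) (f : stdSimplex ℝ K → ℝ) (p : stdSimplex ℝ K) :
    ℝ :=
  sSup (insert (-N) {a | ∃ p' π : stdSimplex ℝ K, (∀ k, p k = (1 - β) * p' k + β * π k) ∧
    (∀ k, c k = 0 → p k = 0) ∧ a = f p' - Λ * ∑ k, (π k - c k) ^ 2})

variable {N β Λ : ℝ} {c : stdSimplex ℝ K} {f : stdSimplex ℝ K → ℝ}

lemma le_perturbedSup (hf : ∀ p, |f p| ≤ N) (hN : 0 ≤ N) (hΛ : 0 ≤ Λ) {p p' π : stdSimplex ℝ K}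
    (hp : ∀ k, p k = (1 - β) * p' k + β * π k) (hc : ∀ k, c k = 0 → p k = 0) :
    f p' - Λ * ∑ k, (π k - c k) ^ 2 ≤ perturbedSup N β Λ c f p := by
  refine le_csSup ⟨N, ?_⟩ (Set.mem_insert_of_mem _ ⟨p', π, hp, hc, rfl⟩)
  rintro a (rfl | ⟨p', π, -, -, rfl⟩)
  · linarith
  · have h1 := (abs_le.1 (hf p')).2
    have h2 : 0 ≤ Λ * ∑ k, (π k - c k) ^ 2 :=
      mul_nonneg hΛ (Finset.sum_nonneg fun k _ => sq_nonneg _)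
    linarith

/-- The inserted value `-N` makes the supremum meaningful at beliefs without an admissible
decomposition; above that level it is approached by actual decompositions. -/
lemma exists_of_lt_perturbedSup {p : stdSimplex ℝ K} {b : ℝ} (hb : b < perturbedSup N β Λ c f p)
    (hN : -N ≤ b) : ∃ p' π : stdSimplex ℝ K, (∀ k, p k = (1 - β) * p' k + β * π k) ∧
      (∀ k, c k = 0 → p k = 0) ∧ b < f p' - Λ * ∑ k, (π k - c k) ^ 2 := by
  obtain ⟨a, ha, hba⟩ := exists_lt_of_lt_csSup (Set.insert_nonempty _ _) hb
  rcases ha with rfl | ⟨p', π, h1, h2, rfl⟩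
  · linarith
  · exact ⟨p', π, h1, h2, hba⟩

end PerturbedSup

lemma Triangulation.splitVariance_nonneg {K : Type*} [Fintype K] (P : Triangulation K)
    (p : stdSimplex ℝ K) : 0 ≤ P.splitVariance p :=
  Finset.sum_nonneg fun _ _ => mul_nonneg (stdSimplex.zero_le _ _)
    (Finset.sum_nonneg fun _ _ => sq_nonneg _)

/-- The parameters of a perturbed value function. -/
structure Smoothing (K : Type*) [Fintype K] where
  /-- The weight of perturbations. -/
  β : ℝ
  /-- The penalty factor. -/
  Λ : ℝ
  /-- The coefficient of the quadratic term. -/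
  κ : ℝ
  /-- The loss upon continuation. -/
  θ : ℝ
  /-- The reference perturbation. -/
  center : stdSimplex ℝ K

/-- The relations between the parameters of a perturbed value function. -/
structure Smoothing.IsValid {K : Type*} [Fintype K] (S : Smoothing K) (N α C r T : ℝ) : Prop where
  N_nonneg : 0 ≤ N
  C_nonneg : 0 ≤ C
  β_pos : 0 < S.β
  β_le : S.β ≤ 1 / 2
  r_pos : 0 < r
  T_pos : 0 < T
  Λ_nonneg : 0 ≤ S.Λ
  κ_nonneg : 0 ≤ S.κ
  α_nonneg : 0 ≤ α
  α_le : α ≤ S.β * (T / 2)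
  κ_ge : 8 * Fintype.card K * (S.Λ / S.β ^ 2) * (C * α) ≤ S.κ * r
  θ_ge : N * (4 * r + 2 * S.β) ≤ S.θ
  Λ_ge : 8 * N ≤ S.Λ * T ^ 2
  center_eq_or : ∀ k, S.center k = 0 ∨ T ≤ S.center k

namespace IncompleteInfoGame

variable {K L Ω I J : Type*} [Fintype K] [Fintype L] [Fintype Ω] [Fintype I] [Fintype J]

open Classical in
/-- The perturbed value function: a subsolution of Shapley's equation for the triangulated game. -/
def barrier (Γ : IncompleteInfoGame K L Ω I J) (S : Smoothing K) (N : ℝ)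
    (v : stdSimplex ℝ K → stdSimplex ℝ L → Ω → ℝ) (i₀ : I) (j₀ : J) (ω₀ : Ω) :
    stdSimplex ℝ K → stdSimplex ℝ L → Ω → ℝ := fun p q ω =>
  if ω = ω₀ then perturbedSup N S.β S.Λ S.center (fun p => v p q ω₀) p +
    S.κ * (∑ k, p k ^ 2 - 1) - S.θ else Γ.constPayoff i₀ j₀ p q ω

/-- The continuation payoff given by the perturbed value function at the vertices. -/
def barrierExtend (Γ : IncompleteInfoGame K L Ω I J) (S : Smoothing K) (N : ℝ)
    (v : stdSimplex ℝ K → stdSimplex ℝ L → Ω → ℝ) (i₀ : I) (j₀ : J) (ω₀ : Ω) (P : Triangulation K)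
    (Q : Triangulation L) : stdSimplex ℝ K → stdSimplex ℝ L → Ω → ℝ :=
  P.extend Q fun u t ω => Γ.barrier S N v i₀ j₀ ω₀ (P.toBelief u) (Q.toBelief t) ω

variable {Γ : IncompleteInfoGame K L Ω I J} {S : Smoothing K} {N α C r T lam : ℝ} {i₀ : I} {j₀ : J}
  {v : stdSimplex ℝ K → stdSimplex ℝ L → Ω → ℝ} {ω₀ : Ω} {P : Triangulation K} {Q : Triangulation L}

lemma barrier_self (p : stdSimplex ℝ K) (q : stdSimplex ℝ L) :
    Γ.barrier S N v i₀ j₀ ω₀ p q ω₀ = perturbedSup N S.β S.Λ S.center (fun p => v p q ω₀) p +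
      S.κ * (∑ k, p k ^ 2 - 1) - S.θ := if_pos rfl

lemma barrierExtend_of_ne {ω : Ω} (hω : ω ≠ ω₀) (p : stdSimplex ℝ K) (q : stdSimplex ℝ L) :
    Γ.barrierExtend S N v i₀ j₀ ω₀ P Q p q ω = Γ.constPayoff i₀ j₀ p q ω :=
  Γ.extend_constPayoff P Q i₀ j₀ (fun _ _ => if_neg hω) p q

/-- A vertex near `z` keeps the component `z'`; the displacement is absorbed by the perturbation,
enlarged by the factor `1 / β`. Averaging the quadratic penalty gives the old penalty plus `Λ / β ^
2` times the variance of the splitting. -/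
lemma le_barrierExtend (hv : Γ.IsRegularValue N i₀ j₀ v) (hS : S.IsValid N α C r T)
    (hP : P.IsRegular α C) {z z' π : stdSimplex ℝ K} (hz : ∀ k, z k = (1 - S.β) * z' k + S.β * π k)
    (hc : ∀ k, S.center k = 0 → z k = 0) (hπ : ∀ k, |π k - S.center k| ≤ T / 2)
    (q : stdSimplex ℝ L) :
    v z' q ω₀ - S.Λ * ∑ k, (π k - S.center k) ^ 2 - S.Λ / S.β ^ 2 * P.splitVariance z +
      S.κ * (∑ k, z k ^ 2 - 1) - S.θ ≤ Γ.barrierExtend S N v i₀ j₀ ω₀ P Q z q ω₀ := by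
  have hβ := hS.β_pos
  have hβ' := hS.β_le
  have hpt : ∀ u t, P.split z u ≠ 0 → v z' (Q.toBelief t) ω₀ +
      (- S.Λ * ∑ k, (π k + (P.toBelief u k - z k) / S.β - S.center k) ^ 2 +
        S.κ * (∑ k, P.toBelief u k ^ 2 - 1) - S.θ) ≤
      Γ.barrier S N v i₀ j₀ ω₀ (P.toBelief u) (Q.toBelief t) ω₀ := fun u t hu => by
    have hzero : ∀ k, S.center k = 0 → P.toBelief u k = 0 := fun k hk => by
      have h1 := P.sum_split_mul_toBelief z k
      rw [hc k hk, Finset.sum_eq_zero_iff_of_nonneg fun i _ =>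
          mul_nonneg (stdSimplex.zero_le _ _) (stdSimplex.zero_le _ _)] at h1
      exact (mul_eq_zero.1 (h1 u (Finset.mem_univ u))).resolve_left hu
    -- Where the centre vanishes, so do `z` and all vertices that carry it, and nothing moves.
    -- Elsewhere `π k` is at least `T / 2`, while the displacement is below `T / 2` because `α ≤ β *
    -- (T / 2)`.
    have hmem : (fun k => π k + (P.toBelief u k - z k) / S.β) ∈ stdSimplex ℝ K := by
      refine ⟨fun k => ?_, ?_⟩
      · rcases hS.center_eq_or k with hk | hk
        · change 0 ≤ π k + (P.toBelief u k - z k) / S.β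
          rw [hzero k hk, hc k hk, sub_self, zero_div, add_zero]
          exact stdSimplex.zero_le π k
        · have h1 := (abs_le.1 (hπ k)).1
          have h2 := (abs_le.1 ((P.abs_toBelief_sub_le hu k).trans hP.1.le)).1
          have h3 : -(T / 2) ≤ (P.toBelief u k - z k) / S.β := by
            rw [le_div_iff₀ hβ]
            linarith [hS.α_le]
          change 0 ≤ π k + (P.toBelief u k - z k) / S.β
          linarith
      · rw [Finset.sum_add_distrib, ← Finset.sum_div, Finset.sum_sub_distrib,
          stdSimplex.sum_eq_one, stdSimplex.sum_eq_one, stdSimplex.sum_eq_one]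
        simp
    have h1 := le_perturbedSup (f := fun p => v p (Q.toBelief t) ω₀) (c := S.center) (β := S.β)
      (fun p => hv.abs_le p (Q.toBelief t) ω₀) hS.N_nonneg hS.Λ_nonneg (p := P.toBelief u) (p' := z')
      (π := ⟨_, hmem⟩) (fun k => by
        change P.toBelief u k = (1 - S.β) * z' k + S.β * (π k + (P.toBelief u k - z k) / S.β)
        rw [mul_add, mul_div_cancel₀ _ hβ.ne', hz k]
        ring) hzero
    change v z' (Q.toBelief t) ω₀ - S.Λ * ∑ k, (π k + (P.toBelief u k - z k) / S.β -
      S.center k) ^ 2 ≤ _ at h1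
    rw [barrier_self]
    linarith
  -- Convexity in the second belief: the splitting of `q` can only help Player 1.
  have hconv : v z' q ω₀ ≤ ∑ t, Q.split q t * v z' (Q.toBelief t) ω₀ := by
    have h1 := SimplexConcave.sum_le (f := fun q => swapFun v q z' ω₀) (hv.convex ω₀ z')
      (stdSimplex.zero_le (Q.split q)) Q.toBelief Finset.univ 1 q zero_le_one
      (fun l => by rw [one_mul, Q.sum_split_mul_toBelief])
    simp only [swapFun, mul_neg, Finset.sum_neg_distrib, one_mul, neg_le_neg_iff] at h1
    exact h1
  have hin : ∀ u, P.split z u * (v z' q ω₀ +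
      (- S.Λ * ∑ k, (π k + (P.toBelief u k - z k) / S.β - S.center k) ^ 2 +
        S.κ * (∑ k, P.toBelief u k ^ 2 - 1) - S.θ)) ≤ P.split z u * ∑ t, Q.split q t *
      Γ.barrier S N v i₀ j₀ ω₀ (P.toBelief u) (Q.toBelief t) ω₀ := fun u => by
    by_cases hu : P.split z u = 0
    · rw [hu, zero_mul, zero_mul]
    · refine mul_le_mul_of_nonneg_left ?_ (stdSimplex.zero_le _ _)
      refine (add_le_add_left hconv _).trans ?_
      rw [← sum_mul_add_const (stdSimplex.sum_eq_one (Q.split q))]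
      exact Finset.sum_le_sum fun t _ => mul_le_mul_of_nonneg_left (hpt u t hu)
        (stdSimplex.zero_le _ _)
  have hsum := stdSimplex.sum_eq_one (P.split z)
  -- The centre is chosen so that, after division by `β ^ 2`, this second moment is the averaged
  -- penalty.
  have e1 := sum_mul_sum_sq_sub hsum (fun u k => P.toBelief u k) (P.sum_split_mul_toBelief z)
    (fun k => z k - S.β * (π k - S.center k))
  have e2 := sum_mul_sum_sq_sub hsum (fun u k => P.toBelief u k) (P.sum_split_mul_toBelief z) 0
  simp only [Pi.zero_apply, sub_zero] at e2
  have e3 : ∀ u, ∑ k, (π k + (P.toBelief u k - z k) / S.β - S.center k) ^ 2 =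
      (1 / S.β ^ 2) * ∑ k, (P.toBelief u k - (z k - S.β * (π k - S.center k))) ^ 2 := fun u => by
    rw [Finset.mul_sum]
    refine Finset.sum_congr rfl fun k _ => ?_
    field_simp
    ring
  have e4 : ∑ k, (z k - (z k - S.β * (π k - S.center k))) ^ 2 =
      S.β ^ 2 * ∑ k, (π k - S.center k) ^ 2 := by
    rw [Finset.mul_sum]
    refine Finset.sum_congr rfl fun k _ => ?_
    ring
  rw [e4] at e1
  have e5 := P.splitVariance_nonneg z
  have e6 := mul_nonneg hS.κ_nonneg e5
  change ∑ u, _ = P.splitVariance z + _ at e1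
  change ∑ u, _ = P.splitVariance z + _ at e2
  refine le_trans ?_ (Finset.sum_le_sum fun u _ => hin u)
  have e7 : ∀ u, P.split z u * (v z' q ω₀ +
      (- S.Λ * ∑ k, (π k + (P.toBelief u k - z k) / S.β - S.center k) ^ 2 +
        S.κ * (∑ k, P.toBelief u k ^ 2 - 1) - S.θ)) =
      P.split z u * (v z' q ω₀ - S.κ - S.θ) - S.Λ / S.β ^ 2 * (P.split z u *
        ∑ k, (P.toBelief u k - (z k - S.β * (π k - S.center k))) ^ 2) +
        S.κ * (P.split z u * ∑ k, P.toBelief u k ^ 2) := fun u => by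
    rw [e3]
    ring
  simp only [e7, Finset.sum_add_distrib, Finset.sum_sub_distrib, ← Finset.mul_sum,
    ← Finset.sum_mul, hsum, e1, e2]
  have e8 : S.Λ / S.β ^ 2 * (S.β ^ 2 * ∑ k, (π k - S.center k) ^ 2) =
      S.Λ * ∑ k, (π k - S.center k) ^ 2 := by field_simp
  rw [mul_add (S.Λ / S.β ^ 2), e8]
  linarith

end IncompleteInfoGame

end

/-! ### Quitting types, comparison principle and the subsolution property. -/

noncomputable section

set_option linter.unusedSectionVars false

namespace IncompleteInfoGame

variable {K L Ω I J : Type*} [Fintype K] [Fintype L] [Fintype Ω] [Fintype I] [Fintype J]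

open Classical in
/-- The mixed action that follows `x` for the types in `A` and plays `i₀` for the other types. -/
def quitOutside (A : Finset K) (i₀ : I) (x : MixedAction K I) : MixedAction K I := fun k =>
  if k ∈ A then x k else stdSimplex.vertex i₀

/-- Quitting for the types outside `A` costs no more than the probability of these types. -/
lemma oneShot_quitOutside_ge (Γ : IncompleteInfoGame K L Ω I J) {N lam : ℝ}
    (hlam : lam ∈ Set.Ioc (0 : ℝ) 1) (hN : ∀ k l ω i j, |Γ.g k l ω i j| ≤ N) (i₀ : I) {j₀ : J}
    {h : stdSimplex ℝ K → stdSimplex ℝ L → Ω → ℝ} {ω₀ : Ω}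
    (hh : ∀ ω, ω ≠ ω₀ → ∀ p q, h p q ω = Γ.constPayoff i₀ j₀ p q ω)
    (hquit : ∀ j, Γ.ρ ω₀ i₀ j ω₀ = 0) {A : Finset K} {p p' : stdSimplex ℝ K} {c : ℝ} (hc : 0 ≤ c)
    (hA : ∀ k ∈ A, c * p' k = p k) (hAc : ∀ k ∉ A, c * p' k = 0) (q : stdSimplex ℝ L)
    (x : MixedAction K I) (y : MixedAction L J) :
    c * Γ.oneShot lam h p' q ω₀ x y - N * (1 - c) ≤
      Γ.oneShot lam h p q ω₀ (quitOutside A i₀ x) y := by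
  classical
  have hl0 := hlam.1
  have hl1 := hlam.2
  set x' := quitOutside A i₀ x with hx'
  have hxA : ∀ k ∈ A, x' k = x k := fun k hk => by
    rw [hx', quitOutside]
    exact if_pos hk
  have hxAc : ∀ k ∉ A, x' k = stdSimplex.vertex i₀ := fun k hk => by
    rw [hx', quitOutside]
    exact if_neg hk
  -- The two joint laws of type and action differ exactly by the mass `1 - c` of the quitting types.
  have hD : ∑ i, ∑ k, |c * (p' k * x k i) - 1 * (p k * x' k i)| = 1 - c := by
    rw [Finset.sum_comm]
    have h1 : ∀ k, ∑ i, |c * (p' k * x k i) - 1 * (p k * x' k i)| = p k - c * p' k := fun k => by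
      by_cases hk : k ∈ A
      · rw [hxA k hk, ← hA k hk]
        simp [mul_assoc]
      · simp only [← mul_assoc, hAc k hk, zero_mul, zero_sub, one_mul, abs_neg, sub_zero, abs_mul,
          abs_of_nonneg (stdSimplex.zero_le p k), abs_of_nonneg (stdSimplex.zero_le (x' k) _),
          ← Finset.mul_sum, stdSimplex.sum_eq_one, mul_one]
    simp only [h1, Finset.sum_sub_distrib, ← Finset.mul_sum, stdSimplex.sum_eq_one, mul_one]
  have hsame : ∀ i, i ≠ i₀ → ∀ k, c * (p' k * x k i) = p k * x' k i := fun i hi k => by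
    by_cases hk : k ∈ A
    · rw [hxA k hk, ← hA k hk, mul_assoc]
    · rw [← mul_assoc, hAc k hk, hxAc k hk]
      simp [hi.symm]
  have h1 := Γ.beliefPayoff_sub_le hN p' p q ω₀ x x' y c 1
  rw [Finset.sum_comm, hD, one_mul] at h1
  have h2 := Γ.sum_ρ_le q y ω₀ (fun i j ω' =>
      c * actionProb p' x i * h (posteriorBelief p' x i) (posteriorBelief q y j) ω' -
      1 * actionProb p x' i * h (posteriorBelief p x' i) (posteriorBelief q y j) ω')
      (fun i => N * ∑ k, |c * (p' k * x k i) - 1 * (p k * x' k i)|) fun i j ω' hω' => by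
    -- If play continues, Player 1's action was not `i₀`, and such actions have the same
    -- unnormalized posteriors under both laws. In the absorbing states the payoff is Lipschitz in
    -- the joint law.
    by_cases hω : ω' = ω₀
    · have hi : i ≠ i₀ := by
        rintro rfl
        exact hω' (hω ▸ hquit j)
      have e1 : c * actionProb p' x i = actionProb p x' i := by
        unfold actionProb
        rw [Finset.mul_sum]
        exact Finset.sum_congr rfl fun k _ => hsame i hi k
      have e2 : ∑ k, |c * (p' k * x k i) - 1 * (p k * x' k i)| = 0 :=
        Finset.sum_eq_zero fun k _ => by rw [hsame i hi, one_mul, sub_self, abs_zero]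
      rw [e2, e1, one_mul, mul_zero]
      by_cases h0 : actionProb p x' i = 0
      · simp [h0]
      · rw [posteriorBelief_eq_of_mul_eq h0 (r := posteriorBelief p' x i) fun k => by
          rw [← e1, mul_assoc, actionProb_mul_posteriorBelief, hsame i hi], sub_self]
    · rw [hh ω' hω, hh ω' hω]
      refine ((Γ.isRegularValue_constPayoff hN i₀ j₀).lipschitz_left ω' _ _ _ _ _
        (mul_nonneg hc (actionProb_nonneg _ _ _))
        (mul_nonneg zero_le_one (actionProb_nonneg _ _ _))).trans (le_of_eq ?_)
      congr 1
      refine Finset.sum_congr rfl fun k _ => ?_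
      rw [mul_assoc, mul_assoc, actionProb_mul_posteriorBelief, actionProb_mul_posteriorBelief]
  rw [← Finset.mul_sum, hD] at h2
  have h3 : ∑ j, actionProb q y j * ∑ i, ∑ ω', Γ.ρ ω₀ i j ω' *
      (c * actionProb p' x i * h (posteriorBelief p' x i) (posteriorBelief q y j) ω' -
      1 * actionProb p x' i * h (posteriorBelief p x' i) (posteriorBelief q y j) ω') =
      c * ∑ j, actionProb q y j * ∑ i, actionProb p' x i * ∑ ω', Γ.ρ ω₀ i j ω' *
        h (posteriorBelief p' x i) (posteriorBelief q y j) ω' -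
      ∑ j, actionProb q y j * ∑ i, actionProb p x' i * ∑ ω', Γ.ρ ω₀ i j ω' *
        h (posteriorBelief p x' i) (posteriorBelief q y j) ω' := by
    simp only [Finset.mul_sum, ← Finset.sum_sub_distrib]
    exact Finset.sum_congr rfl fun j _ => Finset.sum_congr rfl fun i _ =>
      Finset.sum_congr rfl fun ω' _ => by ring
  rw [h3] at h2
  rw [oneShot_eq, oneShot_eq]
  nlinarith

/-- A subsolution of Shapley's equation lies below the solution. -/
lemma le_add_of_secures_extend {Γ : IncompleteInfoGame K L Ω I J} {P : Triangulation K}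
    {Q : Triangulation L} {lam : ℝ} (hlam : lam ∈ Set.Ioc (0 : ℝ) 1)
    {b w : P.Vertex → Q.Vertex → Ω → ℝ} (hw : ∀ u t ω, IsMixedValue
      (Γ.oneShot lam (P.extend Q w) (P.toBelief u) (Q.toBelief t) ω) (w u t ω)) {e : ℝ}
    (hb : ∀ u t ω, Secures (Γ.oneShot lam (P.extend Q b) (P.toBelief u) (Q.toBelief t) ω)
      (b u t ω - lam * e)) (u : P.Vertex) (t : Q.Vertex) (ω : Ω) : b u t ω ≤ w u t ω + e := by
  have : Nonempty (P.Vertex × Q.Vertex × Ω) := ⟨(u, t, ω)⟩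
  obtain ⟨⟨u', t', ω'⟩, hmax⟩ := Finite.exists_max fun z : P.Vertex × Q.Vertex × Ω =>
    b z.1 z.2.1 z.2.2 - w z.1 z.2.1 z.2.2
  set M := b u' t' ω' - w u' t' ω' with hM
  have h1 : ∀ u t ω, b u t ω ≤ w u t ω + M := fun u t ω => by
    have := hmax (u, t, ω)
    simp only at this
    linarith
  -- At a maximizer of `b - w` this reads `b - lam * e ≤ w + (1 - lam) * M`, that is `lam * M ≤ lam
  -- * e`: the discounting is used up exactly by a defect proportional to `lam`.
  have h2 := (hw u' t' ω').le_of_secures ((hb u' t' ω').map id id fun x y =>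
    Γ.oneShot_le_add hlam.2 (P.extend_le_add Q h1) _ _ _ x y)
  have h3 : M ≤ e := by
    have : lam * M ≤ lam * e := by linarith
    exact le_of_mul_le_mul_left this hlam.1
  linarith [h1 u t ω]

variable {Γ : IncompleteInfoGame K L Ω I J} {S : Smoothing K} {N α C r T lam : ℝ} {i₀ : I} {j₀ : J}
  {v : stdSimplex ℝ K → stdSimplex ℝ L → Ω → ℝ} {ω₀ : Ω} {P : Triangulation K} {Q : Triangulation L}

/-- Player 1 imitates a nearly optimal action at the belief `p'` of a nearly optimal decomposition
of the vertex. The expected penalties after the stage are no larger than those at the vertex, so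
only errors with a factor `lam` remain: the stage payoff and the two approximations by `lam * η`. -/
lemma secures_barrier [Nonempty I] (hlam : lam ∈ Set.Ioc (0 : ℝ) 1)
    (hN : ∀ k l ω i j, |Γ.g k l ω i j| ≤ N)
    (hv : Γ.IsRegularValue N i₀ j₀ v) (hval : ∀ p q ω, IsMixedValue (Γ.oneShot lam v p q ω) (v p q ω))
    (hω₀ : ∀ ω, ω ≠ ω₀ → Γ.IsAbsorbing ω) (hquit : ∀ j, Γ.ρ ω₀ i₀ j ω₀ = 0)
    (hS : S.IsValid N α C r T) (hP : P.IsRegular α C) {η : ℝ} (hη : 0 < η) (u : P.Vertex)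
    (q : stdSimplex ℝ L) (ω : Ω) :
    Secures (Γ.oneShot lam (Γ.barrierExtend S N v i₀ j₀ ω₀ P Q) (P.toBelief u) q ω)
      (Γ.barrier S N v i₀ j₀ ω₀ (P.toBelief u) q ω -
        lam * (N * (2 * r + 2 * S.β) + 2 * η)) := by
  have hl0 := hlam.1
  have hN0 := hS.N_nonneg
  have hr := hS.r_pos
  have hβ := hS.β_pos
  have hβ' := hS.β_le
  have hloss : 0 ≤ lam * (N * (2 * r + 2 * S.β)) :=
    mul_nonneg hl0.le (mul_nonneg hN0 (by linarith))
  have hlη : 0 < lam * η := mul_pos hl0 hη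
  obtain ⟨x₀⟩ : Nonempty (MixedAction K I) := inferInstance
  by_cases hω : ω = ω₀
  swap
  · refine Secures.of_pure x₀ fun y => ?_
    rw [(hω₀ ω hω).oneShot_eq_constPayoff i₀ j₀ lam (barrierExtend_of_ne hω)]
    have : Γ.barrier S N v i₀ j₀ ω₀ (P.toBelief u) q ω = Γ.constPayoff i₀ j₀ (P.toBelief u) q ω :=
      if_neg hω
    rw [this]
    linarith
  subst hω
  have hκ := mul_nonneg hS.κ_nonneg (sub_nonneg.2 (sum_sq_le_one (P.toBelief u)))
  have hθ : 0 ≤ S.θ := (mul_nonneg hN0 (by linarith)).trans hS.θ_ge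
  rw [barrier_self]
  set U := perturbedSup N S.β S.Λ S.center (fun p => v p q ω) (P.toBelief u) with hU
  by_cases hUN : U - lam * η ≤ -N
  -- When the supremum is nearly `-N`, quitting with all types suffices. The continuation function
  -- itself may lie below `-N` in the non-absorbing state, so an arbitrary action might not.
  · refine Secures.of_pure (quitOutside ∅ i₀ x₀) fun y => ?_
    have h1 := Γ.oneShot_quitOutside_ge hlam hN i₀ (j₀ := j₀) (p := P.toBelief u)
      (p' := P.toBelief u)
      (h := Γ.barrierExtend S N v i₀ j₀ ω P Q) (fun ω' h => barrierExtend_of_ne h) hquit (A := ∅)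
      (c := 0) le_rfl (by simp) (by simp) q x₀ y
    linarith
  · push Not at hUN
    obtain ⟨p', π, hp, hc, hval'⟩ := exists_of_lt_perturbedSup (b := U - lam * η)
      (by rw [← hU]; linarith) hUN.le
    -- A larger deviation would cost at least `Λ * (T / 2) ^ 2 ≥ 2 * N` and push the value below
    -- `-N`.
    have hπ : ∀ k, |π k - S.center k| ≤ T / 2 := fun k => by
      by_contra! hk
      have h1 : (T / 2) ^ 2 ≤ ∑ k, (π k - S.center k) ^ 2 := by
        calc (T / 2) ^ 2 ≤ |π k - S.center k| ^ 2 :=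
              pow_le_pow_left₀ (by linarith [hS.T_pos]) hk.le 2
          _ = (π k - S.center k) ^ 2 := sq_abs _
          _ ≤ _ := Finset.single_le_sum (f := fun k => (π k - S.center k) ^ 2)
            (fun k _ => sq_nonneg _) (Finset.mem_univ k)
      have h2 := mul_le_mul_of_nonneg_left h1 hS.Λ_nonneg
      have h3 := (abs_le.1 (hv.abs_le p' q ω)).2
      have h4 := hS.Λ_ge
      linarith
    -- Since the current belief is a vertex, the variance bound is purely linear and `e = 0`.
    have himit := fun x => exists_imitation (h := Γ.barrierExtend S N v i₀ j₀ ω P Q) hlam hN hN0 hv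
      hω₀ (fun ω' h => barrierExtend_of_ne h) (p := P.toBelief u) (p' := p') (π := π) (β := S.β)
      (r := r) (κ := S.κ) (θ := S.θ)
      (Φ := S.Λ * ∑ k, (π k - S.center k) ^ 2) (Λ := S.Λ / S.β ^ 2) (D := C * α) (e := 0)
      hβ.le hβ' hr hp P.splitVariance P.splitVariance_nonneg
      (fun z => by rw [add_zero]; exact hP.splitVariance_le_mul hS.C_nonneg u z)
      hS.κ_nonneg (mul_nonneg hS.Λ_nonneg (Finset.sum_nonneg fun k _ => sq_nonneg _))
      (div_nonneg hS.Λ_nonneg (sq_nonneg _)) (mul_nonneg hS.C_nonneg hS.α_nonneg) le_rfl hS.κ_ge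
      hS.θ_ge (fun z z' hz' hz q => le_barrierExtend hv hS hP hz (fun k hk => by
        have h1 := hp k
        rw [hc k hk] at h1
        have h2 : 0 ≤ (1 - S.β) * p' k := mul_nonneg (by linarith) (stdSimplex.zero_le _ _)
        have h3 : 0 ≤ S.β * π k := mul_nonneg hβ.le (stdSimplex.zero_le _ _)
        have h4 : p' k = 0 := (mul_eq_zero.1 (by linarith : (1 - S.β) * p' k = 0)).resolve_left
          (by linarith)
        rw [hz, hz' k h4]
        linarith) hπ q) q x
    choose φ hφ using himit
    refine (((hval p' q ω).1 (lam * η) hlη).map (F' := Γ.oneShot lam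
      (Γ.barrierExtend S N v i₀ j₀ ω P Q) (P.toBelief u) q ω) φ id
      (e := lam * (N * (2 * r + 2 * S.β)) + (S.Λ * ∑ k, (π k - S.center k) ^ 2 + S.θ +
        S.κ * (1 - ∑ k, P.toBelief u k ^ 2))) fun x y => ?_).mono ?_
    · have := hφ x y
      simp only [id]
      linarith
    · linarith

end IncompleteInfoGame

end

/-! ### The lower bound for the value of the triangulated game. -/

noncomputable section

set_option linter.unusedSectionVars false

lemma Triangulation.IsRegular.mono {K : Type*} [Fintype K] {P : Triangulation K} {α α' C : ℝ}
    (hP : P.IsRegular α C) (h : α ≤ α') : P.IsRegular α' C :=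
  ⟨hP.1.trans_le h, hP.2⟩

/-- Conditioning a belief on the types that are not too unlikely. -/
lemma exists_conditioning {K : Type*} [Fintype K] (p : stdSimplex ℝ K) {T : ℝ}
    (hT : 0 < T) (hT2 : Fintype.card K * T ≤ 1 / 2) :
    ∃ (A : Finset K) (p' : stdSimplex ℝ K) (c : ℝ), 0 ≤ c ∧ c ≤ 1 ∧ 1 - c ≤ Fintype.card K * T ∧
      (∀ k ∈ A, c * p' k = p k) ∧ (∀ k ∉ A, c * p' k = 0) ∧
      (∀ k, c * p' k ≤ p k) ∧ ∀ k, p' k = 0 ∨ T ≤ p' k := by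
  classical
  let A : Finset K := Finset.univ.filter fun k => T ≤ p k
  set c := ∑ k ∈ A, p k with hc
  have h0 : 0 ≤ c := Finset.sum_nonneg fun k _ => stdSimplex.zero_le p k
  have h1 : c + ∑ k ∈ Aᶜ, p k = 1 := by
    rw [hc, Finset.sum_add_sum_compl, stdSimplex.sum_eq_one]
  have h2 : ∑ k ∈ Aᶜ, p k ≤ Fintype.card K * T := by
    calc _ ≤ ∑ k ∈ Aᶜ, T := Finset.sum_le_sum fun k hk => by
          by_contra! h
          exact Finset.mem_compl.1 hk (Finset.mem_filter.2 ⟨Finset.mem_univ k, h.le⟩)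
      _ ≤ ∑ k : K, T := Finset.sum_le_sum_of_subset_of_nonneg (Finset.subset_univ _)
          fun _ _ _ => hT.le
      _ = _ := by rw [Finset.sum_const, Finset.card_univ, nsmul_eq_mul]
  have h3 : 0 ≤ ∑ k ∈ Aᶜ, p k := Finset.sum_nonneg fun k _ => stdSimplex.zero_le p k
  have hcpos : 0 < c := by linarith
  let f : K → ℝ := fun k => if k ∈ A then p k / c else 0
  have hf : f ∈ stdSimplex ℝ K := by
    refine ⟨fun k => ?_, ?_⟩
    · simp only [f]
      split_ifs
      · exact div_nonneg (stdSimplex.zero_le p k) h0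
      · exact le_rfl
    · simp only [f]
      rw [Finset.sum_ite_mem, Finset.univ_inter, ← Finset.sum_div, div_self hcpos.ne']
  have hA : ∀ k ∈ A, c * (⟨f, hf⟩ : stdSimplex ℝ K) k = p k := fun k hk => by
    change c * f k = p k
    simp only [f, if_pos hk]
    field_simp
  have hAc : ∀ k ∉ A, f k = 0 := fun k hk => if_neg hk
  refine ⟨A, ⟨f, hf⟩, c, h0, by linarith, by linarith, hA, fun k hk => ?_, fun k => ?_, fun k => ?_⟩
  · change c * f k = 0
    rw [hAc k hk, mul_zero]
  · by_cases hk : k ∈ A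
    · exact (hA k hk).le
    · change c * f k ≤ p k
      rw [hAc k hk, mul_zero]
      exact stdSimplex.zero_le p k
  · by_cases hk : k ∈ A
    · right
      change T ≤ f k
      simp only [f, if_pos hk]
      rw [le_div_iff₀ hcpos]
      have := (Finset.mem_filter.1 hk).2
      nlinarith
    · exact Or.inl (hAc k hk)

namespace IncompleteInfoGame

variable {K L Ω I J : Type*} [Fintype K] [Fintype L] [Fintype Ω] [Fintype I] [Fintype J]

/-- The value of the belief game is almost a lower bound for the value of the triangulated game. -/
lemma le_add_of_isRegular [Nonempty I] {Γ : IncompleteInfoGame K L Ω I J} {N α C lam β r T η : ℝ}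
    {i₀ : I} {j₀ : J} {v : stdSimplex ℝ K → stdSimplex ℝ L → Ω → ℝ} {ω₀ : Ω} {P : Triangulation K}
    {Q : Triangulation L} (hlam : lam ∈ Set.Ioc (0 : ℝ) 1) (hN : ∀ k l ω i j, |Γ.g k l ω i j| ≤ N)
    (hN0 : 0 ≤ N) (hv : Γ.IsRegularValue N i₀ j₀ v)
    (hval : ∀ p q ω, IsMixedValue (Γ.oneShot lam v p q ω) (v p q ω))
    (hω₀ : ∀ ω, ω ≠ ω₀ → Γ.IsAbsorbing ω) (hquit : ∀ j, Γ.ρ ω₀ i₀ j ω₀ = 0)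
    {w : P.Vertex → Q.Vertex → Ω → ℝ} (hw : ∀ u t ω, IsMixedValue
      (Γ.oneShot lam (P.extend Q w) (P.toBelief u) (Q.toBelief t) ω) (w u t ω))
    (hC : 0 ≤ C) (hP : P.IsRegular α C) (hβ : 0 < β) (hβ' : β ≤ 1 / 2) (hr : 0 < r) (hT : 0 < T)
    (hη : 0 < η) (hT2 : Fintype.card K * T ≤ 1 / 2) (hα : 0 ≤ α) (hαβ : α ≤ β * (T / 2)) {κ : ℝ}
    (hκ0 : 0 ≤ κ) (hκ : 8 * Fintype.card K * (8 * N / T ^ 2 / β ^ 2) * (C * α) ≤ κ * r)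
    (u : P.Vertex) (t : Q.Vertex) (ω : Ω) :
    v (P.toBelief u) (Q.toBelief t) ω ≤ w u t ω + (4 * N * (Fintype.card K * T) +
      N * (8 * r + 6 * β) + κ + 8 * N / T ^ 2 / β ^ 2 * α ^ 2 + 3 * η) := by
  have hl0 := hlam.1
  have hl1 := hlam.2
  obtain ⟨A, p', c, hc0, hc1, hcT, hA, hAc, hle, hp'⟩ := exists_conditioning (P.toBelief u) hT hT2
  set q := Q.toBelief t with hq
  have hΛ : 0 ≤ 8 * N / T ^ 2 := div_nonneg (by linarith) (sq_nonneg _)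
  -- The barrier depends on the initial vertex: its centre is the belief conditioned on the likely
  -- types. `Λ` and `θ` are the least values allowed by `IsValid`.
  let S : Smoothing K := ⟨β, 8 * N / T ^ 2, κ, N * (4 * r + 2 * β), p'⟩
  have hS : S.IsValid N α C r T := ⟨hN0, hC, hβ, hβ', hr, hT, hΛ, hκ0, hα, hαβ, hκ, le_rfl,
    by simp only [S]; rw [div_mul_cancel₀ _ (pow_pos hT 2).ne'], hp'⟩
  have hθ : 0 ≤ N * (4 * r + 2 * β) := mul_nonneg hN0 (by linarith)
  have hloss : 0 ≤ N * (2 * r + 2 * β) := mul_nonneg hN0 (by linarith)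
  have hsub := le_add_of_secures_extend hlam hw fun u t ω =>
    secures_barrier hlam hN hv hval hω₀ hquit hS hP hη u (Q.toBelief t) ω
  have hvar : 0 ≤ 8 * N / T ^ 2 / β ^ 2 * α ^ 2 :=
    mul_nonneg (div_nonneg hΛ (sq_nonneg β)) (sq_nonneg α)
  have hcT' := mul_le_mul_of_nonneg_left hcT hN0
  have hc1' := mul_nonneg hN0 (sub_nonneg.2 hc1)
  by_cases hω : ω = ω₀
  swap
  · have h1 := hsub u t ω
    have h2 : Γ.barrier S N v i₀ j₀ ω₀ (P.toBelief u) (Q.toBelief t) ω = _ := if_neg hω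
    rw [h2, ← hv.absorbing ω (hω₀ ω hω)] at h1
    simp only [S] at h1
    linarith
  subst hω
  -- The decomposition of `p'` is the trivial one, with no penalty. As `p'` need not be a vertex,
  -- the variance bound has the additional term `e = α ^ 2`, incurred at this first stage only.
  have himit := fun x => exists_imitation (h := Γ.barrierExtend S N v i₀ j₀ ω P Q) hlam hN hN0 hv
      hω₀ (fun ω' h => barrierExtend_of_ne h) (p := p') (p' := p') (π := p') (β := β)
      (r := r) (κ := κ) (θ := N * (4 * r + 2 * β)) (Φ := 0) (Λ := 8 * N / T ^ 2 / β ^ 2)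
      (D := C * α) (e := α ^ 2) hβ.le hβ' hr (fun k => by ring) P.splitVariance
      P.splitVariance_nonneg (fun z => by
        have h1 : 0 ≤ C * α * ∑ k, |z k - p' k| :=
          mul_nonneg (mul_nonneg hC hα) (Finset.sum_nonneg fun _ _ => abs_nonneg _)
        linarith [hP.splitVariance_le_sq z])
      hκ0 le_rfl (div_nonneg hΛ (sq_nonneg _)) (mul_nonneg hC hα) (sq_nonneg _) hκ le_rfl
      (fun z z' hz' hz q => by
        have h1 := le_barrierExtend (ω₀ := ω) (Q := Q) hv hS hP (z := z) (z' := z') (π := p') hz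
          (fun k (hk : p' k = 0) => by rw [hz, hz' k hk, hk]; ring)
          (fun k => by simp only [S, sub_self, abs_zero]; linarith) q
        simpa [S] using h1) q x
  choose φ hφ using himit
  have hvN := Γ.abs_oneShot_le hlam hN hv.abs_le
  have h1 := fun x y => Γ.oneShot_quitOutside_ge hlam hN i₀ (j₀ := j₀) (p := P.toBelief u) (p' := p')
      (h := Γ.barrierExtend S N v i₀ j₀ ω P Q) (fun ω' h => barrierExtend_of_ne h) hquit (A := A)
      hc0 hA hAc q x y
  set E := N * (2 * r + 2 * β) + (N * (4 * r + 2 * β) + κ + 8 * N / T ^ 2 / β ^ 2 * α ^ 2) with hE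
  have hE0 : 0 ≤ E := by
    linarith
  have h2 : ∀ x y, Γ.oneShot lam v p' q ω x y - E ≤
      Γ.oneShot lam (Γ.barrierExtend S N v i₀ j₀ ω P Q) p' q ω (φ x) y := fun x y => by
    refine le_trans ?_ (hφ x y)
    have e1 : κ * (1 - ∑ k, p' k ^ 2) ≤ κ := mul_le_of_le_one_right hκ0
      (by linarith [Finset.sum_nonneg fun k (_ : k ∈ Finset.univ) => sq_nonneg (p' k)])
    have e2 : lam * (N * (2 * r + 2 * β)) ≤ N * (2 * r + 2 * β) := mul_le_of_le_one_left hloss hl1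
    linarith
  -- First stage at the true vertex: unlikely types quit, the others imitate, and the barrier bounds
  -- the continuation value from below.
  have h3 : ∀ x y, Γ.oneShot lam v p' q ω x y ≤ Γ.oneShot lam (P.extend Q w) (P.toBelief u) q ω
      (quitOutside A i₀ (φ x)) y + (2 * N * (1 - c) + E +
        (1 - lam) * (N * (2 * r + 2 * β) + 2 * η)) := fun x y => by
    have e1 := Γ.oneShot_le_add hl1 (P.extend_le_add Q hsub) (P.toBelief u) q ω
      (quitOutside A i₀ (φ x)) y
    have e2 := h1 (φ x) y
    have e3 := mul_le_mul_of_nonneg_left (h2 x y) hc0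
    have e4 := mul_le_mul_of_nonneg_left (abs_le.1 (hvN p' q ω x y)).2 (sub_nonneg.2 hc1)
    have e5 := mul_le_of_le_one_left hE0 hc1
    change Γ.oneShot lam (Γ.barrierExtend S N v i₀ j₀ ω P Q) _ _ _ _ _ ≤ _ at e1
    change Γ.oneShot lam (Γ.barrierExtend S N v i₀ j₀ ω P Q) _ _ _ _ _ ≤ _ + (1 - lam) *
      (N * (2 * r + 2 * β) + 2 * η) at e1
    linarith
  have h4 := (hw u t ω).le_of_secures (((hval p' q ω).1 η hη).map _ id h3)
  -- Passing from `p'` back to the vertex costs another `2 * N * (1 - c)`, whence the total `4 * N *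
  -- (card K * T)`.
  have h5 := hv.lipschitz_left ω q (P.toBelief u) p' 1 c zero_le_one hc0
  have h6 : ∑ k, |1 * P.toBelief u k - c * p' k| = 1 - c := by
    have : ∀ k, |1 * P.toBelief u k - c * p' k| = P.toBelief u k - c * p' k := fun k => by
      rw [one_mul, abs_of_nonneg (sub_nonneg.2 (hle k))]
    simp only [this, Finset.sum_sub_distrib, ← Finset.mul_sum, stdSimplex.sum_eq_one, mul_one]
  rw [h6] at h5
  have h7 := mul_le_mul_of_nonneg_left (abs_le.1 (hv.abs_le p' q ω)).1 (sub_nonneg.2 hc1)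
  have h9 : (1 - lam) * (N * (2 * r + 2 * β) + 2 * η) ≤ N * (2 * r + 2 * β) + 2 * η :=
    mul_le_of_le_one_left (by linarith) (by linarith)
  linarith

end IncompleteInfoGame

end

/-! ### Choice of the constants and conclusion. -/

noncomputable section

set_option linter.unusedSectionVars false

namespace Triangulation

lemma extend_swap {K L Ω : Type*} [Fintype K] [Fintype L] (P : Triangulation K)
    (Q : Triangulation L) (w : P.Vertex → Q.Vertex → Ω → ℝ) :
    Q.extend P (fun t u ω => -w u t ω) = IncompleteInfoGame.swapFun (P.extend Q w) := by
  funext q p ω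
  simp only [extend, IncompleteInfoGame.swapFun, mul_neg, Finset.sum_neg_distrib, Finset.mul_sum]
  rw [Finset.sum_comm]
  congr 1
  exact Finset.sum_congr rfl fun u _ => Finset.sum_congr rfl fun t _ => mul_left_comm _ _ _

end Triangulation

namespace IncompleteInfoGame

variable {K L Ω I J : Type*} [Fintype K] [Fintype L] [Fintype Ω] [Fintype I] [Fintype J]

/-- With `r = β`, `κ = ε / 10` and `η = ε / 30`, each of the five error terms is at most `ε / 10`.
Since `H` depends on `T` and `β`, the stepsize bound `α` is chosen last. -/
lemma exists_forall_le_add [Nonempty I] (Γ : IncompleteInfoGame K L Ω I J) {N C ε : ℝ}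
    (hN : ∀ k l ω i j, |Γ.g k l ω i j| ≤ N) (hN0 : 0 < N) (hC : 0 ≤ C) (hε : 0 < ε) {i₀ : I} {j₀ : J}
    {ω₀ : Ω} (hω₀ : ∀ ω, ω ≠ ω₀ → Γ.IsAbsorbing ω) (hquit : ∀ j, Γ.ρ ω₀ i₀ j ω₀ = 0) :
    ∃ α : ℝ, 0 < α ∧ ∀ (P : Triangulation K) (Q : Triangulation L), P.IsRegular α C →
      ∀ lam ∈ Set.Ioc (0 : ℝ) 1, ∀ v : stdSimplex ℝ K → stdSimplex ℝ L → Ω → ℝ,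
      Γ.IsRegularValue N i₀ j₀ v → (∀ p q ω, IsMixedValue (Γ.oneShot lam v p q ω) (v p q ω)) →
      ∀ w : P.Vertex → Q.Vertex → Ω → ℝ, (∀ u t ω, IsMixedValue
        (Γ.oneShot lam (P.extend Q w) (P.toBelief u) (Q.toBelief t) ω) (w u t ω)) →
      ∀ u t ω, v (P.toBelief u) (Q.toBelief t) ω ≤ w u t ω + ε := by
  set n : ℝ := (Fintype.card K : ℝ) with hn
  have hn0 : 0 ≤ n := Nat.cast_nonneg _
  obtain ⟨T, hT, hT1, hT2⟩ : ∃ T : ℝ, 0 < T ∧ n * T ≤ 1 / 2 ∧ 4 * N * (n * T) ≤ ε / 10 := by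
    refine ⟨min (1 / 2) (ε / (40 * N)) / (n + 1), by positivity, ?_⟩
    have h1 : n * (min (1 / 2) (ε / (40 * N)) / (n + 1)) ≤ min (1 / 2) (ε / (40 * N)) := by
      rw [mul_div_assoc', div_le_iff₀ (by positivity)]
      have : 0 ≤ min (1 / 2) (ε / (40 * N)) := by positivity
      nlinarith
    refine ⟨h1.trans (min_le_left _ _), ?_⟩
    have h2 := mul_le_mul_of_nonneg_left (h1.trans (min_le_right _ _))
      (by positivity : 0 ≤ 4 * N)
    refine h2.trans (le_of_eq ?_)
    field_simp
    norm_num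
  obtain ⟨β, hβ, hβ1, hβ2⟩ : ∃ β : ℝ, 0 < β ∧ β ≤ 1 / 2 ∧ N * (8 * β + 6 * β) ≤ ε / 10 := by
    refine ⟨min (1 / 2) (ε / (140 * N)), by positivity, min_le_left _ _, ?_⟩
    have h2 := mul_le_mul_of_nonneg_left (min_le_right (1 / 2) (ε / (140 * N)))
      (by positivity : 0 ≤ 14 * N)
    have h3 : 14 * N * (ε / (140 * N)) = ε / 10 := by
      field_simp
      norm_num
    linarith
  set H := 8 * N / T ^ 2 / β ^ 2 with hH
  have hH0 : 0 ≤ H := by positivity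
  have hG0 : 0 ≤ 8 * n * H * C := by positivity
  obtain ⟨α, hα, h1, h2, h3, h4⟩ : ∃ α : ℝ, 0 < α ∧ α ≤ 1 ∧ α ≤ β * (T / 2) ∧
      α ≤ ε / 10 * β / (8 * n * H * C + 1) ∧ α ≤ ε / 10 / (H + 1) :=
    ⟨min (min 1 (β * (T / 2))) (min (ε / 10 * β / (8 * n * H * C + 1)) (ε / 10 / (H + 1))),
      by positivity, (min_le_left _ _).trans (min_le_left _ _),
      (min_le_left _ _).trans (min_le_right _ _), (min_le_right _ _).trans (min_le_left _ _),
      (min_le_right _ _).trans (min_le_right _ _)⟩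
  rw [le_div_iff₀ (by positivity)] at h3 h4
  refine ⟨α, hα, fun P Q hP lam hlam v hv hval w hw u t ω => ?_⟩
  have h5 := le_add_of_isRegular (κ := ε / 10) (η := ε / 30) hlam hN hN0.le hv hval hω₀ hquit hw hC
    hP hβ hβ1 hβ hT (by positivity) hT1 hα.le h2 (by positivity) (by rw [← hn, ← hH]; linarith) u t ω
  have h6 : H * α ^ 2 ≤ ε / 10 := by nlinarith [mul_nonneg hH0 hα.le]
  rw [← hn, ← hH] at h5
  linarith

end IncompleteInfoGame

end

theorem mainTheorem3 {K L Ω I J : Type*} [Fintype K] [Fintype L] [Fintype Ω] [Fintype I] [Fintype J]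
    [MeasurableSpace Ω] [DiscreteMeasurableSpace Ω]
    (Γ : IncompleteInfoGame K L Ω I J)
    (hΓ : Γ.IsAbsorbingGame) (hΓ' : Γ.HasQuittingActions)
    (ε : ℝ) (hε : 0 < ε) (C : ℝ) (hC : 0 < C) :
    ∃ α : ℝ, 0 < α ∧
      ∀ (P : Triangulation K) (Q : Triangulation L), P.IsRegular α C → Q.IsRegular α C →
        ∀ (p : P.Vertex) (q : Q.Vertex) (ω : Ω) (lam : ℝ), lam ∈ Set.Ioc (0 : ℝ) 1 →
          ∃ ve vf : ℝ,
            Γ.beliefGame.IsDiscountedValue lam (P.toBelief p, Q.toBelief q, ω) ve ∧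
            (Γ.triangulatedGame P Q).IsDiscountedValue lam (p, q, ω) vf ∧
            |ve - vf| ≤ ε := by
  obtain ⟨ω₀, hω₀, huniq⟩ := hΓ
  obtain ⟨i₀, j₀, ω₁, ω₂, hω₁, hω₂, -, -, hquit⟩ := hΓ'
  obtain ⟨hi, hj, hij⟩ := hquit ω₀ hω₀
  have : Nonempty I := ⟨i₀⟩
  have : Nonempty J := ⟨j₀⟩
  have h1 : ω₁ ≠ ω₀ := by
    rintro rfl
    exact hω₀ hω₁
  have h2 : ω₂ ≠ ω₀ := by
    rintro rfl
    exact hω₀ hω₂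
  -- Either quitting action leaves the non-absorbing state with certainty, even when both are
  -- played.
  have hijz : Γ.ρ ω₀ i₀ j₀ ω₀ = 0 := by
    rw [hij]
    simp [h1, h2]
  have hquitI : ∀ j, Γ.ρ ω₀ i₀ j ω₀ = 0 := fun j => by
    by_cases h : j = j₀
    · rw [h, hijz]
    · rw [hi j h]
      simp [h1]
  have hquitJ : ∀ i, Γ.ρ ω₀ i j₀ ω₀ = 0 := fun i => by
    by_cases h : i = i₀
    · rw [h, hijz]
    · rw [hj i h]
      simp [h2]
  have habs : ∀ ω, ω ≠ ω₀ → Γ.IsAbsorbing ω := fun ω hω => by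
    by_contra h
    exact hω (huniq ω h)
  -- One is added so that the bound is positive, as the choice of constants divides by it.
  have hN : ∀ k l ω i j, |Γ.g k l ω i j| ≤ ‖Γ.g‖ + 1 := fun k l ω i j => by
    have := (norm_le_pi_norm _ j).trans <| (norm_le_pi_norm _ i).trans <|
      (norm_le_pi_norm _ ω).trans <| (norm_le_pi_norm _ l).trans (norm_le_pi_norm Γ.g k)
    rw [Real.norm_eq_abs] at this
    linarith
  have hN0 : 0 < ‖Γ.g‖ + 1 := by positivity
  have hN' : ∀ l k ω j i, |Γ.swap.g l k ω j i| ≤ ‖Γ.g‖ + 1 := fun l k ω j i => by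
    simpa [IncompleteInfoGame.swap] using hN k l ω i j
  obtain ⟨α₁, hα₁, hleft⟩ := Γ.exists_forall_le_add (j₀ := j₀) hN hN0 hC.le hε habs hquitI
  obtain ⟨α₂, hα₂, hright⟩ := Γ.swap.exists_forall_le_add (j₀ := i₀) hN' hN0 hC.le hε
    (fun ω hω => (habs ω hω).swap) hquitJ
  refine ⟨min α₁ α₂, lt_min hα₁ hα₂, fun P Q hP hQ p q ω lam hlam => ?_⟩
  obtain ⟨v, hv, hval⟩ := Γ.exists_oneShot_fixedPoint hlam hN i₀ j₀
  obtain ⟨w, hw, hwval⟩ := Γ.exists_extend_fixedPoint P Q hlam hN hN0.le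
  refine ⟨v (P.toBelief p) (Q.toBelief q) ω, w p q ω,
    Γ.isDiscountedValue_beliefGame hlam hN hv hval _ _ _,
    Γ.isDiscountedValue_triangulatedGame P Q hlam hN hw hwval _ _ _, ?_⟩
  have e1 := hleft P Q (hP.mono (min_le_left _ _)) lam hlam v hv hval w hwval p q ω
  -- The upper bound is the lower bound for Player 2: `-v` and `-w` solve Shapley's equations of the
  -- swapped game.
  have e2 := hright Q P (hQ.mono (min_le_right _ _)) lam hlam _ hv.swap
    (fun q p ω => IncompleteInfoGame.isMixedValue_swap (hval p q ω)) (fun t u ω => -w u t ω)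
    (fun t u ω => by
      rw [P.extend_swap Q w]
      exact IncompleteInfoGame.isMixedValue_swap (hwval u t ω)) q p ω
  simp only [IncompleteInfoGame.swapFun] at e2
  rw [abs_le]
  constructor <;> linarith
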